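/- **Conventions.** Let $\Gamma$ be a finite simple graph with vertex set $\{1,\dots,d\}$ and edge set $\mathbf E$. Let $G_\Gamma$ be the pro-$2$ group with generators $x_1,\dots,x_d$ and relations $[x_i,x_j]:=x_i^{-1}x_j^{-1}x_ix_j=1$ for $\{i,j\}\in\mathbf E$. Let $\Delta$ be the group of order two, with generator $x_0$. Let $\mathbf z=(z_1,\dots,z_d)\in G_\Gamma^d$ be such that there is an action $\delta_{\mathbf z}$ of $\Delta$ on $G_\Gamma$ by continuous automorphisms with $\delta_{\mathbf z}(x_0)(x_i)=z_i^{-1}x_i^{-1}z_i$ for $1\le i\le d$; the pro-$2$ group $G_{\mathbf z}:=G_\Gamma\rtimes_{\delta_{\mathbf z}}\Delta$ is then called a $\Delta$-RAAG. For a pro-$2$ group $G$, let $E(G)=\varprojlim_N\mathbb F_2[G/N]$ be its completed group algebra ($N$ running over the open normal subgroups), $E_n(G)$ the $n$-th power of the augmentation ideal, and $G_n=\{g\in G: g-1\in E_n(G)\}$ (the Zassenhaus filtration). Put $\mathcal E(G)=\bigoplus_{n\ge0}E_n(G)/E_{n+1}(G)$, a graded $\mathbb F_2$-algebra, and $\mathcal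 L(G)=\bigoplus_{n}G_n/G_{n+1}$, a graded restricted Lie algebra over $\mathbb F_2$ whose bracket is induced by the group commutator and whose restriction map is induced on homogeneous elements by $g\mapsto g^2$. When all $c_n=\dim_{\mathbb F_2}E_n(G)/E_{n+1}(G)$ are finite, put $gocha(G,t)=\sum_{n\ge 0} c_nt^n$. Let $\mathcal E$ be the algebra of noncommutative polynomials over $\mathbb F_2$ in $X_0,\dots,X_d$, each of degree $1$, and let $\mathcal L\subset\mathcal E$ be the free restricted Lie algebra on $X_0,\dots,X_d$, that is, the smallest $\mathbb F_2$-subspace containing the $X_i$ and closed under $[x,y]=xy-yx$ and $x\mapsto x^2$. For $1\le k\le d$ let $\epsilon_k\in\bigoplus_{i=1}^d\mathbb F_2X_i$ be the image of $z_k$ under the map $G_\Gamma\to G_\Gamma/G_{\Gamma,2}\hookrightarrow\bigoplus_{i=1}^d\mathbb F_2X_i$ which sends $x_i$ to $X_i$. Let $\mathcal I_{\mathbf z}$ be the two-sided ideal of $\mathcal E$, and $\mathcal J_{\mathbf z}$ the restricted Lie ideal of $\mathcal L$ (the smallest Lie ideal closed under $x\mapsto x^2$), generated by $$X_0^2,\qquad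 [X_u,X_v]\ \ (\{u,v\}\in\mathbf E),\qquad [X_0,X_k]+[X_k,\epsilon_k]+X_k^2\ \ (1\le k\le d).$$ Finally let $\Gamma(t)=\sum_{n\ge0}c_n(\Gamma)t^n$, where $c_n(\Gamma)$ is the number of complete subgraphs of $\Gamma$ with $n$ vertices (so $c_0(\Gamma)=1$). **Theorem.** For every $\Delta$-RAAG $G_{\mathbf z}$: 1. there is an isomorphism of graded $\mathbb F_2$-algebras $\mathcal E/\mathcal I_{\mathbf z}\simeq\mathcal E(G_{\mathbf z})$ sending the class of $X_i$ to the class of $x_i-1$ in $E_1(G_{\mathbf z})/E_2(G_{\mathbf z})$ for $0\le i\le d$; 2. there is an isomorphism of graded restricted Lie algebras over $\mathbb F_2$, $\mathcal L/\mathcal J_{\mathbf z}\simeq\mathcal L(G_{\mathbf z})$, sending the class of $X_i$ to the class of $x_i$ in $G_{\mathbf z,1}/G_{\mathbf z,2}$ for $0\le i\le d$; 3. every $\dim_{\mathbb F_2}E_n(G_{\mathbf z})/E_{n+1}(G_{\mathbf z})$ is finite, and $$gocha(G_{\mathbf z},t)=\frac{1+t}{\Gamma(-t)}.$$ -/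

import Mathlib

open scoped DirectSum

namespace DeltaRAAG

noncomputable section

/-! ### The graded algebra of the powers of a two-sided ideal -/

section AssociatedGraded

variable {A : Type*} [Ring A] [Algebra (ZMod 2) A]

/-- The power `I ^ n` as an `𝔽₂`-subspace (`I ^ 0` is the whole algebra). -/
def powSub (I : Ideal A) (n : ℕ) : Submodule (ZMod 2) A :=
  (I ^ n).restrictScalars (ZMod 2)

theorem powSub_anti (I : Ideal A) {m n : ℕ} (h : m ≤ n) : powSub I n ≤ powSub I m :=
  fun _ hx => Ideal.pow_le_pow_right h hx

theorem mem_powSub_zero (I : Ideal A) (a : A) : a ∈ powSub I 0 := by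
  change a ∈ I ^ 0
  rw [Submodule.pow_zero, Ideal.one_eq_top]
  trivial

theorem mul_mem_powSub (I : Ideal A) [I.IsTwoSided] {m n : ℕ} {a b : A}
    (ha : a ∈ powSub I m) (hb : b ∈ powSub I n) : a * b ∈ powSub I (m + n) := by
  change a * b ∈ I ^ (m + n)
  rw [Ideal.IsTwoSided.pow_add]
  exact Ideal.mul_mem_mul ha hb

/-- The homogeneous component `I ^ n / I ^ (n + 1)`. -/
def GrPiece (I : Ideal A) (n : ℕ) : Type _ :=
  ↥(powSub I n) ⧸ (powSub I (n + 1)).submoduleOf (powSub I n)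

instance (I : Ideal A) (n : ℕ) : AddCommGroup (GrPiece I n) :=
  inferInstanceAs (AddCommGroup (↥(powSub I n) ⧸ (powSub I (n + 1)).submoduleOf (powSub I n)))

instance (I : Ideal A) (n : ℕ) : Module (ZMod 2) (GrPiece I n) :=
  inferInstanceAs
    (Module (ZMod 2) (↥(powSub I n) ⧸ (powSub I (n + 1)).submoduleOf (powSub I n)))

/-- The class in `I ^ n / I ^ (n + 1)` of an element of `I ^ n`. -/
def grMk (I : Ideal A) {n : ℕ} (a : A) (ha : a ∈ powSub I n) : GrPiece I n :=
  Submodule.Quotient.mk ⟨a, ha⟩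

theorem grMk_eq_iff (I : Ideal A) {n : ℕ} {a b : A} {ha : a ∈ powSub I n}
    {hb : b ∈ powSub I n} : grMk I a ha = grMk I b hb ↔ a - b ∈ powSub I (n + 1) :=
  Submodule.Quotient.eq _

/-- The multiplication `I ^ m / I ^ (m + 1) × I ^ n / I ^ (n + 1) → I ^ (m + n) / I ^ (m + n + 1)`
induced by the multiplication of the algebra. -/
def grMul (I : Ideal A) [I.IsTwoSided] {m n : ℕ} (x : GrPiece I m) (y : GrPiece I n) :
    GrPiece I (m + n) :=
  Quotient.liftOn₂' x y
    (fun a b => grMk I ((a : A) * (b : A)) (mul_mem_powSub I a.2 b.2)) <| by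
      intro a b a' b' ha hb
      have ha' := (Submodule.quotientRel_def _).1 ha
      have hb' := (Submodule.quotientRel_def _).1 hb
      change (a : A) - a' ∈ powSub I (m + 1) at ha'
      change (b : A) - b' ∈ powSub I (n + 1) at hb'
      rw [grMk_eq_iff]
      have e : (a : A) * b - a' * b' = (a - a') * b + a' * (b - b') := by noncomm_ring
      rw [e]
      refine add_mem ?_ (mul_mem_powSub (m := m) (n := n + 1) I a'.2 hb')
      have := mul_mem_powSub I ha' b.2
      rwa [show m + 1 + n = m + n + 1 by omega] at this

theorem grMul_grMk (I : Ideal A) [I.IsTwoSided] {m n : ℕ} {a b : A} (ha : a ∈ powSub I m)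
    (hb : b ∈ powSub I n) :
    grMul I (grMk I a ha) (grMk I b hb) = grMk I (a * b) (mul_mem_powSub I ha hb) := rfl

theorem exists_grMk (I : Ideal A) {n : ℕ} (x : GrPiece I n) :
    ∃ (a : A) (ha : a ∈ powSub I n), x = grMk I a ha := by
  induction x using Submodule.Quotient.induction_on with
  | H a => exact ⟨a.1, a.2, rfl⟩

theorem grMk_add (I : Ideal A) {n : ℕ} {a b : A} (ha : a ∈ powSub I n) (hb : b ∈ powSub I n) :
    grMk I a ha + grMk I b hb = grMk I (a + b) (add_mem ha hb) := rfl

theorem grMk_zero (I : Ideal A) {n : ℕ} : grMk I 0 (zero_mem _) = (0 : GrPiece I n) := rfl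

theorem gradedMonoid_grMk_congr (I : Ideal A) {m n : ℕ} {a b : A} (ha : a ∈ powSub I m)
    (hb : b ∈ powSub I n) (hmn : m = n) (hab : a = b) :
    (GradedMonoid.mk m (grMk I a ha) : GradedMonoid (GrPiece I)) =
      GradedMonoid.mk n (grMk I b hb) := by
  subst hmn hab; rfl

instance (I : Ideal A) [I.IsTwoSided] : GradedMonoid.GMul (GrPiece I) where
  mul x y := grMul I x y

instance (I : Ideal A) : GradedMonoid.GOne (GrPiece I) where
  one := grMk I 1 (mem_powSub_zero I 1)

instance (I : Ideal A) [I.IsTwoSided] : GradedMonoid.GMonoid (GrPiece I) where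
  one_mul := by
    rintro ⟨n, x⟩
    obtain ⟨a, ha, rfl⟩ := exists_grMk I x
    exact gradedMonoid_grMk_congr I _ _ (zero_add n) (one_mul a)
  mul_one := by
    rintro ⟨n, x⟩
    obtain ⟨a, ha, rfl⟩ := exists_grMk I x
    exact gradedMonoid_grMk_congr I _ _ (add_zero n) (mul_one a)
  mul_assoc := by
    rintro ⟨m, x⟩ ⟨n, y⟩ ⟨p, z⟩
    obtain ⟨a, ha, rfl⟩ := exists_grMk I x
    obtain ⟨b, hb, rfl⟩ := exists_grMk I y
    obtain ⟨c, hc, rfl⟩ := exists_grMk I z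
    exact gradedMonoid_grMk_congr I _ _ (add_assoc m n p) (mul_assoc a b c)

instance (I : Ideal A) [I.IsTwoSided] : DirectSum.GRing (GrPiece I) where
  mul_zero := by
    intro i j x
    obtain ⟨a, ha, rfl⟩ := exists_grMk I x
    exact (grMk_eq_iff I).2 (by simp)
  zero_mul := by
    intro i j x
    obtain ⟨a, ha, rfl⟩ := exists_grMk I x
    exact (grMk_eq_iff I).2 (by simp)
  mul_add := by
    intro i j x y z
    obtain ⟨a, ha, rfl⟩ := exists_grMk I x
    obtain ⟨b, hb, rfl⟩ := exists_grMk I y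
    obtain ⟨c, hc, rfl⟩ := exists_grMk I z
    exact (grMk_eq_iff I).2 (by simp [mul_add])
  add_mul := by
    intro i j x y z
    obtain ⟨a, ha, rfl⟩ := exists_grMk I x
    obtain ⟨b, hb, rfl⟩ := exists_grMk I y
    obtain ⟨c, hc, rfl⟩ := exists_grMk I z
    exact (grMk_eq_iff I).2 (by simp [add_mul])
  natCast n := grMk I (n : A) (mem_powSub_zero I _)
  natCast_zero := (grMk_eq_iff I).2 (by simp)
  natCast_succ n := (grMk_eq_iff I).2 (by simp)
  intCast n := grMk I (n : A) (mem_powSub_zero I _)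
  intCast_ofNat n := (grMk_eq_iff I).2 (by simp)
  intCast_negSucc_ofNat n := (grMk_eq_iff I).2 (by simp)

instance (I : Ideal A) [I.IsTwoSided] : DirectSum.GAlgebra (ZMod 2) (GrPiece I) where
  toFun :=
    { toFun := fun r => grMk I (algebraMap (ZMod 2) A r) (mem_powSub_zero I _)
      map_zero' := (grMk_eq_iff I).2 (by simp)
      map_add' := fun r s => (grMk_eq_iff I).2 (by simp) }
  map_one := (grMk_eq_iff I).2 (by simp)
  map_mul r s := gradedMonoid_grMk_congr I _ _ (add_zero 0).symm (map_mul _ r s)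
  commutes := by
    rintro r ⟨n, x⟩
    obtain ⟨a, ha, rfl⟩ := exists_grMk I x
    exact gradedMonoid_grMk_congr I _ _ (add_comm 0 n) (Algebra.commutes r a)
  smul_def := by
    rintro r ⟨n, x⟩
    obtain ⟨a, ha, rfl⟩ := exists_grMk I x
    exact gradedMonoid_grMk_congr I (Submodule.smul_mem _ r ha) _ (zero_add n).symm
      (Algebra.smul_def r a)

end AssociatedGraded

/-! ### The completed group algebra and its augmentation ideal -/

section CompletedGroupAlgebra

variable (G : Type*) [Group G] [TopologicalSpace G]

/-- The completed group algebra `E(G) = lim 𝔽₂[G/N]` over the open normal subgroups `N` of `G`,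
realised as the algebra of compatible families. -/
def completedGroupAlgebra : Subalgebra (ZMod 2)
    (∀ N : OpenNormalSubgroup G, MonoidAlgebra (ZMod 2) (G ⧸ N.toSubgroup)) where
  carrier := {f | ∀ (N M : OpenNormalSubgroup G) (h : N.toSubgroup ≤ M.toSubgroup),
    MonoidAlgebra.mapDomainAlgHom (ZMod 2) (ZMod 2)
      (QuotientGroup.map N.toSubgroup M.toSubgroup (MonoidHom.id G) h) (f N) = f M}
  mul_mem' hf hg N M h := by simp only [Pi.mul_apply, map_mul, hf N M h, hg N M h]
  add_mem' hf hg N M h := by simp only [Pi.add_apply, map_add, hf N M h, hg N M h]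
  algebraMap_mem' r N M h := by simp only [Pi.algebraMap_apply, AlgHom.commutes]

/-- The algebra `E(G)` as a type. -/
def CGA : Type _ := ↥(completedGroupAlgebra G)

instance : Ring (CGA G) := inferInstanceAs (Ring ↥(completedGroupAlgebra G))

instance : Algebra (ZMod 2) (CGA G) :=
  inferInstanceAs (Algebra (ZMod 2) ↥(completedGroupAlgebra G))

/-- The component of an element of `E(G)` in `𝔽₂[G/N]`. -/
def CGA.proj (N : OpenNormalSubgroup G) :
    CGA G →ₐ[ZMod 2] MonoidAlgebra (ZMod 2) (G ⧸ N.toSubgroup) :=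
  (Pi.evalAlgHom (ZMod 2) _ N).comp (completedGroupAlgebra G).val

/-- The canonical map `G → E(G)`. -/
def toCGA : G →* CGA G where
  toFun g := ⟨fun N => MonoidAlgebra.of (ZMod 2) (G ⧸ N.toSubgroup) (g : G ⧸ N.toSubgroup), by
    intro N M h
    simp only [MonoidAlgebra.of_apply, MonoidAlgebra.mapDomainAlgHom_apply,
      MonoidAlgebra.mapDomain_single]
    rfl⟩
  map_one' := Subtype.ext (funext fun N => map_one (MonoidAlgebra.of (ZMod 2) (G ⧸ N.toSubgroup)))
  map_mul' g h := Subtype.ext (funext fun N =>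
    map_mul (MonoidAlgebra.of (ZMod 2) (G ⧸ N.toSubgroup)) (g : G ⧸ N.toSubgroup) h)

theorem proj_toCGA (N : OpenNormalSubgroup G) (g : G) : CGA.proj G N (toCGA G g) =
    MonoidAlgebra.of (ZMod 2) (G ⧸ N.toSubgroup) (g : G ⧸ N.toSubgroup) := rfl

/-- The augmentation ideal of `E(G)`: the families all of whose components have coefficient
sum `0`. -/
def augIdeal : Ideal (CGA G) :=
  ⨅ N : OpenNormalSubgroup G, RingHom.ker
    ((MonoidAlgebra.lift (ZMod 2) (ZMod 2) (G ⧸ N.toSubgroup) 1).comp (CGA.proj G N))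

variable {G}

theorem mem_augIdeal {f : CGA G} : f ∈ augIdeal G ↔ ∀ N : OpenNormalSubgroup G,
    MonoidAlgebra.lift (ZMod 2) (ZMod 2) (G ⧸ N.toSubgroup) 1 (CGA.proj G N f) = 0 := by
  simp [augIdeal, RingHom.mem_ker]

instance : (augIdeal G).IsTwoSided where
  mul_mem_of_left := by
    intro a b ha
    rw [mem_augIdeal] at ha ⊢
    intro N
    rw [map_mul, map_mul, ha N, zero_mul]

variable (G)

/-- `𝓔(G) = ⨁ Eₙ(G) / Eₙ₊₁(G)`, where `Eₙ(G)` is the `n`-th power of the augmentation ideal.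
It is a graded `𝔽₂`-algebra. -/
abbrev GrE : Type _ := ⨁ n : ℕ, GrPiece (augIdeal G) n

/-- The series `∑ cₙ tⁿ` with `cₙ = dim Eₙ(G) / Eₙ₊₁(G)`. -/
def gocha : PowerSeries ℚ :=
  PowerSeries.mk fun n => (Module.finrank (ZMod 2) (GrPiece (augIdeal G) n) : ℚ)

end CompletedGroupAlgebra

/-! ### The Zassenhaus filtration and its graded Lie algebra -/

section Zassenhaus

variable (G : Type*) [Group G] [TopologicalSpace G]

variable {G} in
theorem toCGA_sub_one_mem (g : G) : toCGA G g - 1 ∈ powSub (augIdeal G) 1 := by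
  change toCGA G g - 1 ∈ augIdeal G ^ 1
  rw [Submodule.pow_one, mem_augIdeal]
  intro N
  simp [proj_toCGA, MonoidAlgebra.of_apply]

variable {G} in
theorem mul_mem_powSub_left {n : ℕ} (a : CGA G) {b : CGA G} (hb : b ∈ powSub (augIdeal G) n) :
    a * b ∈ powSub (augIdeal G) n :=
  (augIdeal G ^ n).mul_mem_left a hb

variable {G} in
theorem mul_mem_powSub_right {n : ℕ} {a : CGA G} (b : CGA G) (ha : a ∈ powSub (augIdeal G) n) :
    a * b ∈ powSub (augIdeal G) n :=
  (augIdeal G ^ n).mul_mem_right b ha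

section identities

variable {R : Type*} [Ring R] (a b : R)

theorem ident_mul : a * b - 1 = (a - 1) * b + (b - 1) := by
  simp only [sub_mul, one_mul]; abel

theorem ident_comm : (a - 1) * (b - 1) - (b - 1) * (a - 1) = a * b - b * a := by
  simp only [sub_mul, mul_sub, one_mul, mul_one]; abel

theorem ident_mul' : a * b - 1 - ((a - 1) + (b - 1)) = (a - 1) * (b - 1) := by
  simp only [sub_mul, mul_sub, one_mul, mul_one]; abel

theorem ident_sq (h : (2 : R) = 0) : a ^ 2 - 1 = (a - 1) * (a - 1) := by
  have e : (a - 1) * (a - 1) = a ^ 2 - 1 - 2 * (a - 1) := by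
    rw [two_mul]
    simp only [sub_mul, mul_sub, one_mul, mul_one, pow_two]; abel
  rw [e, h, zero_mul, sub_zero]

theorem ident_bracket (a a' b b' : R) : a * b - b * a - (a' * b' - b' * a') =
    ((a - a') * b - b * (a - a')) + (a' * (b - b') - (b - b') * a') := by
  simp only [sub_mul, mul_sub]; abel

theorem ident_cancel (u v x y : R) : u - 1 - x - (v - 1 - y) + (x - y) = u - v := by
  abel

end identities

/-- The Zassenhaus filtration `Gₙ = {g ∈ G | g - 1 ∈ Eₙ(G)}`. -/
def zassenhaus (n : ℕ) : Subgroup G where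
  carrier := {g | toCGA G g - 1 ∈ powSub (augIdeal G) n}
  one_mem' := by simp
  mul_mem' {g h} hg hh := by
    rw [Set.mem_ofPred_eq] at *
    rw [map_mul, ident_mul]
    exact add_mem (mul_mem_powSub_right _ hg) hh
  inv_mem' {g} hg := by
    rw [Set.mem_ofPred_eq] at *
    have e : toCGA G g⁻¹ - 1 = -(toCGA G g⁻¹ * (toCGA G g - 1)) := by
      rw [mul_sub, ← map_mul]; simp
    rw [e]
    exact neg_mem (mul_mem_powSub_left _ hg)

variable {G}

theorem mem_zassenhaus {n : ℕ} {g : G} :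
    g ∈ zassenhaus G n ↔ toCGA G g - 1 ∈ powSub (augIdeal G) n := Iff.rfl

theorem mem_zassenhaus_zero (g : G) : g ∈ zassenhaus G 0 :=
  mem_zassenhaus.2 (mem_powSub_zero (augIdeal G) _)

theorem mem_zassenhaus_one (g : G) : g ∈ zassenhaus G 1 :=
  mem_zassenhaus.2 (toCGA_sub_one_mem g)

theorem commutator_sub_one (g h : G) : toCGA G (g⁻¹ * h⁻¹ * g * h) - 1 = toCGA G (g⁻¹ * h⁻¹) *
    ((toCGA G g - 1) * (toCGA G h - 1) - (toCGA G h - 1) * (toCGA G g - 1)) := by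
  rw [ident_comm, ← map_mul, ← map_mul, mul_sub, ← map_mul, ← map_mul,
    show g⁻¹ * h⁻¹ * (g * h) = g⁻¹ * h⁻¹ * g * h by group,
    show g⁻¹ * h⁻¹ * (h * g) = 1 by group, map_one]

theorem bracket_mem {m n : ℕ} {a b : CGA G} (ha : a ∈ powSub (augIdeal G) m)
    (hb : b ∈ powSub (augIdeal G) n) : a * b - b * a ∈ powSub (augIdeal G) (m + n) := by
  refine sub_mem (mul_mem_powSub _ ha hb) ?_
  rw [add_comm m n]
  exact mul_mem_powSub _ hb ha

theorem commutator_mem_zassenhaus {m n : ℕ} {g h : G} (hg : g ∈ zassenhaus G m)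
    (hh : h ∈ zassenhaus G n) : g⁻¹ * h⁻¹ * g * h ∈ zassenhaus G (m + n) := by
  rw [mem_zassenhaus] at *
  rw [commutator_sub_one]
  exact mul_mem_powSub_left _ (bracket_mem hg hh)

theorem commutator_congr {m n : ℕ} {g h : G} (hg : g ∈ zassenhaus G m)
    (hh : h ∈ zassenhaus G n) : toCGA G (g⁻¹ * h⁻¹ * g * h) - 1 -
      ((toCGA G g - 1) * (toCGA G h - 1) - (toCGA G h - 1) * (toCGA G g - 1)) ∈
        powSub (augIdeal G) (m + n + 1) := by
  rw [mem_zassenhaus] at *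
  rw [commutator_sub_one, ← sub_one_mul, add_comm (m + n) 1]
  exact mul_mem_powSub _ (toCGA_sub_one_mem _) (bracket_mem hg hh)

theorem sq_mem_zassenhaus {n : ℕ} {g : G} (hg : g ∈ zassenhaus G n) :
    g ^ 2 ∈ zassenhaus G (2 * n) := by
  have h2 : (2 : CGA G) = 0 := by
    have h0 := (algebraMap (ZMod 2) (CGA G)).map_zero
    rwa [show (0 : ZMod 2) = 2 from rfl, map_ofNat] at h0
  rw [mem_zassenhaus] at *
  rw [map_pow, ident_sq _ h2, two_mul]
  exact mul_mem_powSub _ hg hg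

theorem zassenhaus_anti {m n : ℕ} (h : m ≤ n) : zassenhaus G n ≤ zassenhaus G m :=
  fun _ hg => powSub_anti _ h hg

instance (n : ℕ) : ((zassenhaus G (n + 1)).subgroupOf (zassenhaus G n)).Normal where
  conj_mem := by
    rintro ⟨h, hh⟩ hh' ⟨g, hg⟩
    rw [Subgroup.mem_subgroupOf] at hh' ⊢
    change h ∈ zassenhaus G (n + 1) at hh'
    change g * h * g⁻¹ ∈ zassenhaus G (n + 1)
    rw [mem_zassenhaus] at hh' ⊢
    have e : toCGA G (g * h * g⁻¹) - 1 =
        toCGA G g * (toCGA G h - 1) * toCGA G g⁻¹ := by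
      rw [mul_sub, sub_mul, ← map_mul, ← map_mul, mul_one, ← map_mul]; simp
    rw [e]
    exact mul_mem_powSub_right _ (mul_mem_powSub_left _ hh')

variable (G) in
/-- The quotient `𝓛ₙ(G) = Gₙ / Gₙ₊₁`, written additively. -/
def LiePiece (n : ℕ) : Type _ :=
  Additive (↥(zassenhaus G n) ⧸ (zassenhaus G (n + 1)).subgroupOf (zassenhaus G n))

/-- The class in `Gₙ / Gₙ₊₁` of an element of `Gₙ`. -/
def lieMk {n : ℕ} (g : G) (hg : g ∈ zassenhaus G n) : LiePiece G n :=
  Additive.ofMul (QuotientGroup.mk (⟨g, hg⟩ : ↥(zassenhaus G n)))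

instance (n : ℕ) : AddGroup (LiePiece G n) :=
  inferInstanceAs (AddGroup (Additive
    (↥(zassenhaus G n) ⧸ (zassenhaus G (n + 1)).subgroupOf (zassenhaus G n))))

theorem exists_lieMk {n : ℕ} (x : LiePiece G n) :
    ∃ (g : G) (hg : g ∈ zassenhaus G n), x = lieMk g hg := by
  obtain ⟨y, rfl⟩ := Additive.ofMul.surjective x
  induction y using QuotientGroup.induction_on with
  | H g => exact ⟨g.1, g.2, rfl⟩

theorem lieMk_add {n : ℕ} {g h : G} (hg : g ∈ zassenhaus G n) (hh : h ∈ zassenhaus G n) :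
    lieMk g hg + lieMk h hh = lieMk (g * h) (mul_mem hg hh) := rfl

theorem lieMk_eq_iff {n : ℕ} {g h : G} {hg : g ∈ zassenhaus G n} {hh : h ∈ zassenhaus G n} :
    lieMk g hg = lieMk h hh ↔ toCGA G g - toCGA G h ∈ powSub (augIdeal G) (n + 1) := by
  have h1 : lieMk g hg = lieMk h hh ↔ g⁻¹ * h ∈ zassenhaus G (n + 1) := by
    refine (Additive.ofMul.injective.eq_iff.trans QuotientGroup.eq).trans ?_
    rw [Subgroup.mem_subgroupOf]
    rfl
  rw [h1, mem_zassenhaus]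
  constructor
  · intro H
    have := neg_mem (mul_mem_powSub_left (toCGA G g) H)
    rwa [mul_sub, ← map_mul, mul_inv_cancel_left, mul_one, neg_sub] at this
  · intro H
    have := neg_mem (mul_mem_powSub_left (toCGA G g⁻¹) H)
    rwa [mul_sub, ← map_mul, ← map_mul, inv_mul_cancel, map_one, neg_sub] at this

/-- The injection `Gₙ / Gₙ₊₁ → Eₙ(G) / Eₙ₊₁(G)` sending the class of `g` to that of `g - 1`. -/
def lieToGr (n : ℕ) (x : LiePiece G n) : GrPiece (augIdeal G) n :=
  Quotient.liftOn' (Additive.toMul x)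
    (fun g => grMk (augIdeal G) (toCGA G g.1 - 1) (mem_zassenhaus.1 g.2)) <| by
      rintro ⟨g, hg⟩ ⟨h, hh⟩ hgh
      refine (grMk_eq_iff _).2 ?_
      rw [sub_sub_sub_cancel_right]
      exact (lieMk_eq_iff (hg := hg) (hh := hh)).1 (congrArg Additive.ofMul (Quotient.sound' hgh))

theorem lieToGr_lieMk {n : ℕ} {g : G} (hg : g ∈ zassenhaus G n) :
    lieToGr n (lieMk g hg) = grMk (augIdeal G) (toCGA G g - 1) (mem_zassenhaus.1 hg) := rfl

theorem lieToGr_injective (n : ℕ) : Function.Injective (lieToGr (G := G) n) := by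
  intro x y hxy
  obtain ⟨g, hg, rfl⟩ := exists_lieMk x
  obtain ⟨h, hh, rfl⟩ := exists_lieMk y
  rw [lieToGr_lieMk, lieToGr_lieMk, grMk_eq_iff, sub_sub_sub_cancel_right] at hxy
  exact lieMk_eq_iff.2 hxy

theorem mul_sub_mul_mem (n : ℕ) {g : G} (h : G) (hg : g ∈ zassenhaus G n) :
    toCGA G (g * h) - 1 - ((toCGA G g - 1) + (toCGA G h - 1)) ∈ powSub (augIdeal G) (n + 1) := by
  rw [map_mul, ident_mul']
  exact mul_mem_powSub _ (mem_zassenhaus.1 hg) (toCGA_sub_one_mem h)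

theorem lieToGr_add (n : ℕ) (x y : LiePiece G n) :
    lieToGr n (x + y) = lieToGr n x + lieToGr n y := by
  obtain ⟨g, hg, rfl⟩ := exists_lieMk x
  obtain ⟨h, hh, rfl⟩ := exists_lieMk y
  rw [lieMk_add, lieToGr_lieMk, lieToGr_lieMk, lieToGr_lieMk, grMk_add]
  exact (grMk_eq_iff _).2 (mul_sub_mul_mem n h hg)

instance (n : ℕ) : AddCommGroup (LiePiece G n) where
  add_comm x y := lieToGr_injective n (by rw [lieToGr_add, lieToGr_add, add_comm])

/-- `lieToGr` as an additive map. -/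
def lieToGrHom (n : ℕ) : LiePiece G n →+ GrPiece (augIdeal G) n :=
  AddMonoidHom.mk' (lieToGr n) (lieToGr_add n)

instance (n : ℕ) : Module (ZMod 2) (LiePiece G n) :=
  AddCommGroup.zmodModule (n := 2) fun x => lieToGr_injective n (by
    change lieToGrHom n (2 • x) = lieToGrHom n 0
    rw [map_nsmul, map_zero, ← Nat.cast_smul_eq_nsmul (ZMod 2)]
    exact zero_smul (ZMod 2) _)

/-- The bracket `𝓛ₘ(G) × 𝓛ₙ(G) → 𝓛ₘ₊ₙ(G)` sending the classes of `g` and `h` to the class of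
the commutator `g⁻¹h⁻¹gh`. -/
def lieBracket {m n : ℕ} (x : LiePiece G m) (y : LiePiece G n) : LiePiece G (m + n) :=
  Quotient.liftOn₂' (Additive.toMul x) (Additive.toMul y)
    (fun g h => lieMk (g.1⁻¹ * h.1⁻¹ * g.1 * h.1) (commutator_mem_zassenhaus g.2 h.2)) <| by
      rintro ⟨g, hg⟩ ⟨h, hh⟩ ⟨g', hg'⟩ ⟨h', hh'⟩ hgg hhh
      have h1 := (lieMk_eq_iff (hg := hg) (hh := hg')).1
        (congrArg Additive.ofMul (Quotient.sound' hgg))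
      have h2 := (lieMk_eq_iff (hg := hh) (hh := hh')).1
        (congrArg Additive.ofMul (Quotient.sound' hhh))
      refine lieMk_eq_iff.2 ?_
      have c1 := commutator_congr hg hh
      have c2 := commutator_congr hg' hh'
      rw [mem_zassenhaus] at hg hh hg' hh'
      have key : (toCGA G g - 1) * (toCGA G h - 1) - (toCGA G h - 1) * (toCGA G g - 1) -
          ((toCGA G g' - 1) * (toCGA G h' - 1) - (toCGA G h' - 1) * (toCGA G g' - 1)) ∈
            powSub (augIdeal G) (m + n + 1) := by
        rw [ident_bracket, sub_sub_sub_cancel_right, sub_sub_sub_cancel_right]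
        refine add_mem ?_ (bracket_mem (m := m) (n := n + 1) hg' h2)
        have := bracket_mem (m := m + 1) (n := n) h1 hh
        rwa [show m + 1 + n = m + n + 1 by omega] at this
      have := add_mem (sub_mem c1 c2) key
      rwa [ident_cancel] at this

theorem lieBracket_lieMk {m n : ℕ} {g h : G} (hg : g ∈ zassenhaus G m)
    (hh : h ∈ zassenhaus G n) : lieBracket (lieMk g hg) (lieMk h hh) =
      lieMk (g⁻¹ * h⁻¹ * g * h) (commutator_mem_zassenhaus hg hh) := rfl

theorem of_lieToGr_lieBracket {m n : ℕ} (x : LiePiece G m) (y : LiePiece G n) :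
    DirectSum.of (GrPiece (augIdeal G)) (m + n) (lieToGr (m + n) (lieBracket x y)) =
      DirectSum.of (GrPiece (augIdeal G)) m (lieToGr m x) *
        DirectSum.of (GrPiece (augIdeal G)) n (lieToGr n y) -
      DirectSum.of (GrPiece (augIdeal G)) n (lieToGr n y) *
        DirectSum.of (GrPiece (augIdeal G)) m (lieToGr m x) := by
  obtain ⟨g, hg, rfl⟩ := exists_lieMk x
  obtain ⟨h, hh, rfl⟩ := exists_lieMk y
  have hg1 := mem_zassenhaus.1 hg
  have hh1 := mem_zassenhaus.1 hh
  rw [lieBracket_lieMk, lieToGr_lieMk, lieToGr_lieMk, lieToGr_lieMk, DirectSum.of_mul_of,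
    DirectSum.of_mul_of]
  have e2 : DirectSum.of (GrPiece (augIdeal G)) (n + m)
      (GradedMonoid.GMul.mul (grMk (augIdeal G) (toCGA G h - 1) hh1)
        (grMk (augIdeal G) (toCGA G g - 1) hg1)) =
      DirectSum.of (GrPiece (augIdeal G)) (m + n)
        (grMk (augIdeal G) ((toCGA G h - 1) * (toCGA G g - 1))
          (by rw [add_comm m n]; exact mul_mem_powSub _ hh1 hg1)) :=
    DirectSum.of_eq_of_gradedMonoid_eq
      (gradedMonoid_grMk_congr (augIdeal G) _ _ (add_comm n m) rfl)
  rw [e2, ← map_sub]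
  congr 1
  exact (grMk_eq_iff _).2 (commutator_congr hg hh)

theorem lieBracket_add_left {m n : ℕ} (x x' : LiePiece G m) (y : LiePiece G n) :
    lieBracket (x + x') y = lieBracket x y + lieBracket x' y := by
  apply lieToGr_injective
  apply DirectSum.of_injective (β := GrPiece (augIdeal G))
  rw [lieToGr_add, map_add, of_lieToGr_lieBracket, of_lieToGr_lieBracket, of_lieToGr_lieBracket,
    lieToGr_add, map_add, add_mul, mul_add]
  abel

theorem lieBracket_add_right {m n : ℕ} (x : LiePiece G m) (y y' : LiePiece G n) :
    lieBracket x (y + y') = lieBracket x y + lieBracket x y' := by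
  apply lieToGr_injective
  apply DirectSum.of_injective (β := GrPiece (augIdeal G))
  rw [lieToGr_add, map_add, of_lieToGr_lieBracket, of_lieToGr_lieBracket, of_lieToGr_lieBracket,
    lieToGr_add, map_add, add_mul, mul_add]
  abel

/-- The bracket of homogeneous elements as a biadditive map. -/
def lieBracketHom (m n : ℕ) : LiePiece G m →+ LiePiece G n →+ LiePiece G (m + n) :=
  AddMonoidHom.mk' (fun x => AddMonoidHom.mk' (fun y => lieBracket x y) (lieBracket_add_right x))
    fun x x' => AddMonoidHom.ext fun y => lieBracket_add_left x x' y

variable (G) in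
/-- `𝓛(G) = ⨁ Gₙ / Gₙ₊₁`, the graded Lie algebra of the Zassenhaus filtration. -/
def GrL : Type _ := ⨁ n : ℕ, LiePiece G n

instance : AddCommGroup (GrL G) := inferInstanceAs (AddCommGroup (⨁ n : ℕ, LiePiece G n))

instance : Module (ZMod 2) (GrL G) :=
  inferInstanceAs (Module (ZMod 2) (⨁ n : ℕ, LiePiece G n))

variable (G) in
/-- The inclusion of the homogeneous component of degree `n` of `𝓛(G)`. -/
def GrL.of (n : ℕ) : LiePiece G n →ₗ[ZMod 2] GrL G :=
  DirectSum.lof (ZMod 2) ℕ (LiePiece G) n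

/-- The biadditive extension of the bracket of homogeneous elements to `𝓛(G)`. -/
def GrL.bracketHom : GrL G →+ GrL G →+ GrL G :=
  DirectSum.toAddMonoid (β := LiePiece G) fun m => AddMonoidHom.flip <|
    DirectSum.toAddMonoid (β := LiePiece G) fun n => AddMonoidHom.flip <|
      (DirectSum.of (LiePiece G) (m + n)).compHom.comp (lieBracketHom m n)

instance : Bracket (GrL G) (GrL G) := ⟨fun x y => GrL.bracketHom x y⟩

theorem GrL.of_bracket_of {m n : ℕ} (x : LiePiece G m) (y : LiePiece G n) :
    ⁅GrL.of G m x, GrL.of G n y⁆ = GrL.of G (m + n) (lieBracket x y) := by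
  change GrL.bracketHom (DirectSum.of (LiePiece G) m x) (DirectSum.of (LiePiece G) n y) = _
  refine (DFunLike.congr_fun (DirectSum.toAddMonoid_of (β := LiePiece G) _ m x) _).trans ?_
  exact DFunLike.congr_fun (DirectSum.toAddMonoid_of (β := LiePiece G)
    (fun n => ((DirectSum.of (LiePiece G) (m + n)).compHom.comp (lieBracketHom m n)).flip) n y) x

/-- The injection `𝓛(G) → 𝓔(G)` induced by `g ↦ g - 1`. -/
def GrL.toGrE : GrL G →+ GrE G := DirectSum.map fun n => lieToGrHom (G := G) n

theorem GrL.toGrE_of {n : ℕ} (x : LiePiece G n) :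
    GrL.toGrE (GrL.of G n x) = DirectSum.of (GrPiece (augIdeal G)) n (lieToGr n x) :=
  DirectSum.map_of _ _ _

theorem GrL.toGrE_injective : Function.Injective (GrL.toGrE (G := G)) :=
  (DirectSum.map_injective _).2 fun n => lieToGr_injective n

theorem GrL.induction_on {p : GrL G → Prop} (x : GrL G) (h0 : p 0)
    (hof : ∀ (n : ℕ) (x : LiePiece G n), p (GrL.of G n x))
    (hadd : ∀ x y, p x → p y → p (x + y)) : p x :=
  DirectSum.induction_on (β := LiePiece G) x h0 hof hadd

theorem GrL.toGrE_bracket (x y : GrL G) :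
    GrL.toGrE ⁅x, y⁆ = GrL.toGrE x * GrL.toGrE y - GrL.toGrE y * GrL.toGrE x := by
  have hadd1 : ∀ x x' y : GrL G, ⁅x + x', y⁆ = ⁅x, y⁆ + ⁅x', y⁆ := fun x x' y => by
    change GrL.bracketHom (x + x') y = _; rw [map_add]; rfl
  have hadd2 : ∀ x y y' : GrL G, ⁅x, y + y'⁆ = ⁅x, y⁆ + ⁅x, y'⁆ := fun x y y' => by
    change GrL.bracketHom x (y + y') = _; rw [map_add]; rfl
  have hz1 : ∀ y : GrL G, ⁅(0 : GrL G), y⁆ = 0 := fun y => by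
    change GrL.bracketHom 0 y = _; rw [map_zero]; rfl
  have hz2 : ∀ y : GrL G, ⁅y, (0 : GrL G)⁆ = 0 := fun y => by
    change GrL.bracketHom y 0 = _; rw [map_zero]
  induction x using GrL.induction_on with
  | h0 => rw [hz1, map_zero, zero_mul, mul_zero, sub_zero]
  | hadd x x' hx hx' =>
    rw [hadd1, map_add, hx, hx', map_add, add_mul, mul_add]; abel
  | hof m x =>
    induction y using GrL.induction_on with
    | h0 => rw [hz2, map_zero, zero_mul, mul_zero, sub_zero]
    | hadd x x' hx hx' =>
      rw [hadd2, map_add, hx, hx', map_add, add_mul, mul_add]; abel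
    | hof n y =>
      rw [GrL.of_bracket_of, GrL.toGrE_of, GrL.toGrE_of, GrL.toGrE_of, of_lieToGr_lieBracket]

instance : LieRing (GrL G) where
  add_lie x y z := by
    apply GrL.toGrE_injective
    simp only [map_add, GrL.toGrE_bracket, add_mul, mul_add]; abel
  lie_add x y z := by
    apply GrL.toGrE_injective
    simp only [map_add, GrL.toGrE_bracket, add_mul, mul_add]; abel
  lie_self x := by
    apply GrL.toGrE_injective
    rw [GrL.toGrE_bracket, map_zero, sub_self]
  leibniz_lie x y z := by
    apply GrL.toGrE_injective
    simp only [map_add, GrL.toGrE_bracket, sub_mul, mul_sub, mul_assoc]; abel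

instance : LieAlgebra (ZMod 2) (GrL G) where
  lie_smul r x y := by
    obtain rfl | rfl : r = 0 ∨ r = 1 := by revert r; decide
    · rw [zero_smul, zero_smul, lie_zero]
    · rw [one_smul, one_smul]

end Zassenhaus

/-! ### Free pro-2 groups and pro-2 right-angled Artin groups -/

section ProTwo

/-- The normal subgroups of `2`-power index of an abstract group. -/
def TwoPowerQuotient (H : Type*) [Group H] : Type _ :=
  {N : Subgroup H // N.Normal ∧ ∃ k : ℕ, N.index = 2 ^ k}

instance {H : Type*} [Group H] (N : TwoPowerQuotient H) : N.1.Normal := N.2.1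

/-- The pro-`2` completion `lim H/N` over the normal subgroups `N` of `2`-power index, as the
group of compatible families. -/
def proTwoCompletion (H : Type*) [Group H] : Subgroup (∀ N : TwoPowerQuotient H, H ⧸ N.1) where
  carrier := {f | ∀ (N M : TwoPowerQuotient H) (h : N.1 ≤ M.1),
    QuotientGroup.map N.1 M.1 (MonoidHom.id H) h (f N) = f M}
  mul_mem' hf hg N M h := by rw [Pi.mul_apply, Pi.mul_apply, map_mul, hf N M h, hg N M h]
  one_mem' N M h := by rw [Pi.one_apply, Pi.one_apply, map_one]
  inv_mem' hf N M h := by rw [Pi.inv_apply, Pi.inv_apply, map_inv, hf N M h]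

/-- The free pro-`2` group on `X` (for finite `X`): the pro-`2` completion of the free group. -/
def FreeProTwo (X : Type*) : Type _ := ↥(proTwoCompletion (FreeGroup X))

variable (X : Type*)

instance : Group (FreeProTwo X) := inferInstanceAs (Group ↥(proTwoCompletion (FreeGroup X)))

/-- The projection of the free pro-`2` group to one of its defining finite quotients. -/
def FreeProTwo.proj (N : TwoPowerQuotient (FreeGroup X)) : FreeProTwo X →* FreeGroup X ⧸ N.1 :=
  (Pi.evalMonoidHom _ N).comp (proTwoCompletion (FreeGroup X)).subtype

/-- The profinite topology: the coarsest one for which the projections to the (discrete) finite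
quotients are continuous. -/
instance : TopologicalSpace (FreeProTwo X) :=
  ⨅ N : TwoPowerQuotient (FreeGroup X), TopologicalSpace.induced (FreeProTwo.proj X N) ⊥

instance : IsTopologicalGroup (FreeProTwo X) :=
  topologicalGroup_iInf fun N => by
    let : TopologicalSpace (FreeGroup X ⧸ N.1) := ⊥
    have : DiscreteTopology (FreeGroup X ⧸ N.1) := ⟨rfl⟩
    exact topologicalGroup_induced (FreeProTwo.proj X N)

variable {X}

/-- The free generators. -/
def FreeProTwo.gen (i : X) : FreeProTwo X :=
  ⟨fun N => (FreeGroup.of i : FreeGroup X ⧸ N.1), fun _ _ _ => rfl⟩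

theorem FreeProTwo.isOpen_proj_ker (N : TwoPowerQuotient (FreeGroup X)) :
    IsOpen ((FreeProTwo.proj X N).ker : Set (FreeProTwo X)) := by
  refine iInf_le (fun N : TwoPowerQuotient (FreeGroup X) =>
    TopologicalSpace.induced (FreeProTwo.proj X N) ⊥) N _ ?_
  exact ⟨{1}, trivial, rfl⟩

/-- The kernel of a homomorphism to `ℤ/2`, as one of the subgroups defining the completion. -/
def kerTwo {H : Type*} [Group H] (f : H →* Multiplicative (ZMod 2)) : TwoPowerQuotient H :=
  ⟨f.ker, inferInstance, by
    have h : f.ker.index ∣ 2 ^ 1 := by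
      rw [Subgroup.index_ker]
      have := Subgroup.card_subgroup_dvd_card f.range
      simpa using this
    obtain ⟨k, -, hk⟩ := (Nat.dvd_prime_pow Nat.prime_two).1 h
    exact ⟨k, hk⟩⟩

/-- The continuous homomorphism from the free pro-`2` group to `ℤ/2` with prescribed values on
the generators. -/
def FreeProTwo.liftTwo (c : X → Multiplicative (ZMod 2)) :
    FreeProTwo X →* Multiplicative (ZMod 2) :=
  (QuotientGroup.kerLift (FreeGroup.lift c)).comp
    (FreeProTwo.proj X (kerTwo (FreeGroup.lift c)))

theorem FreeProTwo.liftTwo_gen (c : X → Multiplicative (ZMod 2)) (i : X) :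
    FreeProTwo.liftTwo c (FreeProTwo.gen i) = c i := by
  change QuotientGroup.kerLift (FreeGroup.lift c) (FreeGroup.of i : FreeGroup X ⧸ _) = c i
  rw [QuotientGroup.kerLift_mk, FreeGroup.lift_apply_of]

theorem FreeProTwo.isClosed_liftTwo_ker (c : X → Multiplicative (ZMod 2)) :
    IsClosed ((FreeProTwo.liftTwo c).ker : Set (FreeProTwo X)) := by
  refine Subgroup.isClosed_of_isOpen _ (Subgroup.isOpen_mono ?_
    (FreeProTwo.isOpen_proj_ker (kerTwo (FreeGroup.lift c))))
  intro x hx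
  rw [MonoidHom.mem_ker] at hx ⊢
  exact (congrArg (QuotientGroup.kerLift (FreeGroup.lift c)) hx).trans (map_one _)

end ProTwo

section RAAG

variable {d : ℕ} (Γ : SimpleGraph (Fin d))

/-- The closed normal subgroup generated by the commutators `[xᵢ, xⱼ] = xᵢ⁻¹xⱼ⁻¹xᵢxⱼ` for the
edges `{i, j}` of `Γ`. -/
def raagRelations : Subgroup (FreeProTwo (Fin d)) :=
  (Subgroup.normalClosure {r | ∃ i j : Fin d, Γ.Adj i j ∧
    r = (FreeProTwo.gen i)⁻¹ * (FreeProTwo.gen j)⁻¹ * FreeProTwo.gen i * FreeProTwo.gen j}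
    ).topologicalClosure

instance : (raagRelations Γ).Normal := Subgroup.is_normal_topologicalClosure _

/-- The pro-`2` right-angled Artin group `G_Γ`. -/
def RAAG : Type := FreeProTwo (Fin d) ⧸ raagRelations Γ

instance : Group (RAAG Γ) := inferInstanceAs (Group (FreeProTwo (Fin d) ⧸ raagRelations Γ))

instance : TopologicalSpace (RAAG Γ) :=
  inferInstanceAs (TopologicalSpace (FreeProTwo (Fin d) ⧸ raagRelations Γ))

instance : IsTopologicalGroup (RAAG Γ) :=
  inferInstanceAs (IsTopologicalGroup (FreeProTwo (Fin d) ⧸ raagRelations Γ))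

/-- The canonical generators `xᵢ` of `G_Γ`. -/
def RAAG.gen (i : Fin d) : RAAG Γ :=
  QuotientGroup.mk' (raagRelations Γ) (FreeProTwo.gen i)

/-- The continuous homomorphism `G_Γ → ℤ/2` sending `xᵢ` to `1` and the other generators to
`0`. -/
def RAAG.coord (i : Fin d) : RAAG Γ →* Multiplicative (ZMod 2) :=
  QuotientGroup.lift (raagRelations Γ)
    (FreeProTwo.liftTwo fun j => Multiplicative.ofAdd (if j = i then 1 else 0)) (by
      refine Subgroup.topologicalClosure_minimal _ (Subgroup.normalClosure_le_normal ?_)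
        (FreeProTwo.isClosed_liftTwo_ker _)
      rintro _ ⟨u, v, -, rfl⟩
      rw [SetLike.mem_coe, MonoidHom.mem_ker]
      simp only [map_mul, map_inv]
      rw [mul_comm, mul_assoc (_)⁻¹, mul_comm (_)⁻¹ (_ * _)]
      simp)

theorem RAAG.coord_gen (i j : Fin d) :
    RAAG.coord Γ i (RAAG.gen Γ j) = Multiplicative.ofAdd (if j = i then 1 else 0) :=
  FreeProTwo.liftTwo_gen _ _

end RAAG

/-! ### Δ-right-angled Artin groups -/

/-- The group `Δ` of order two. -/
abbrev Delta : Type := Multiplicative (ZMod 2)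

/-- The generator `x₀` of `Δ`. -/
def Delta.x₀ : Delta := Multiplicative.ofAdd 1

section DeltaRAAG

variable {d : ℕ} (Γ : SimpleGraph (Fin d))

/-- `δ` is an action of `Δ` on the pro-`2` group `G_Γ` by continuous automorphisms, for which the
generator of `Δ` maps every `xᵢ` to `zᵢ⁻¹ xᵢ⁻¹ zᵢ`. -/
structure IsDeltaAction (z : Fin d → RAAG Γ) (δ : Delta →* MulAut (RAAG Γ)) : Prop where
  continuous : ∀ s : Delta, Continuous (δ s)
  apply_gen : ∀ i : Fin d, δ Delta.x₀ (RAAG.gen Γ i) = (z i)⁻¹ * (RAAG.gen Γ i)⁻¹ * z i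

variable {Γ}

/-- The semidirect product `G_z = G_Γ ⋊ Δ`. -/
abbrev GZ (δ : Delta →* MulAut (RAAG Γ)) : Type := RAAG Γ ⋊[δ] Delta

/-- The product topology on `G_Γ ⋊ Δ`, for the discrete topology on `Δ`. -/
instance (δ : Delta →* MulAut (RAAG Γ)) : TopologicalSpace (GZ δ) :=
  TopologicalSpace.induced SemidirectProduct.left inferInstance ⊓
    TopologicalSpace.induced SemidirectProduct.right ⊥

/-- The generators `x₀, x₁, …, x_d` of `G_z`, the first one being the generator of `Δ`. -/
def deltaGen (δ : Delta →* MulAut (RAAG Γ)) : Fin (d + 1) → GZ δ :=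
  Fin.cons (SemidirectProduct.inr Delta.x₀) fun i => SemidirectProduct.inl (RAAG.gen Γ i)

end DeltaRAAG

/-! ### The algebras given by generators and relations -/

section Algebras

variable (d : ℕ)

/-- The algebra `𝓔` of noncommutative polynomials in `X₀, …, X_d` over `𝔽₂`. -/
abbrev NCPoly : Type := FreeAlgebra (ZMod 2) (Fin (d + 1))

/-- The commutator bracket `xy - yx`. -/
instance : LieRing (NCPoly d) := LieRing.ofAssociativeRing

instance : LieAlgebra (ZMod 2) (NCPoly d) := LieAlgebra.ofAssociativeAlgebra

variable {d} in
/-- The indeterminate `Xᵢ`. -/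
abbrev var (i : Fin (d + 1)) : NCPoly d := FreeAlgebra.ι (ZMod 2) i

/-- The homogeneous noncommutative polynomials of degree `n`. -/
def ncHomogeneous (n : ℕ) : Submodule (ZMod 2) (NCPoly d) :=
  Submodule.span (ZMod 2) (Set.range (var (d := d))) ^ n

/-- The free restricted Lie algebra `𝓛` on `X₀, …, X_d` over `𝔽₂`, realised as usual inside the
free associative algebra: the smallest subspace containing the `Xᵢ` and closed under the bracket
`xy - yx` and the restriction map `x ↦ x²`. -/
def restrictedFree : LieSubalgebra (ZMod 2) (NCPoly d) :=
  sInf {K | (∀ i, var i ∈ K) ∧ ∀ x ∈ K, x * x ∈ K}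

variable {d}

theorem mem_restrictedFree {x : NCPoly d} : x ∈ restrictedFree d ↔
    ∀ K : LieSubalgebra (ZMod 2) (NCPoly d), (∀ i, var i ∈ K) → (∀ x ∈ K, x * x ∈ K) → x ∈ K := by
  rw [restrictedFree, ← SetLike.mem_coe, LieSubalgebra.coe_sInf, Set.mem_iInter₂]
  exact ⟨fun h K h1 h2 => h K ⟨h1, h2⟩, fun h K hK => h K hK.1 hK.2⟩

theorem var_mem_restrictedFree (i : Fin (d + 1)) : var i ∈ restrictedFree d := by
  rw [mem_restrictedFree]
  exact fun K h _ => h i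

theorem sq_mem_restrictedFree {x : NCPoly d} (hx : x ∈ restrictedFree d) :
    x * x ∈ restrictedFree d := by
  rw [mem_restrictedFree] at hx ⊢
  exact fun K h1 h2 => h2 x (hx K h1 h2)

/-- The restriction map `x ↦ x²` of `𝓛`. -/
def restrictedSq (x : ↥(restrictedFree d)) : ↥(restrictedFree d) :=
  ⟨x.1 * x.1, sq_mem_restrictedFree x.2⟩

variable {Γ : SimpleGraph (Fin d)}

/-- The image `ε` of `g ∈ G_Γ` in the space spanned by the `Xᵢ`: the composite of
`G_Γ → G_Γ/G_{Γ,2}` with the injective linear map sending the class of `xᵢ` to `Xᵢ`. -/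
def epsilon (g : RAAG Γ) : NCPoly d :=
  ∑ i : Fin d, (RAAG.coord Γ i g).toAdd • var i.succ

/-- The relations `X₀²`, `[X_u, X_v]` for the edges `{u, v}`, and `[X₀, X_k] + [X_k, ε_k] + X_k²`
for the vertices `k`. -/
inductive IsRelator (z : Fin d → RAAG Γ) : NCPoly d → Prop
  | sq_zero : IsRelator z (var 0 * var 0)
  | edge (u v : Fin d) (h : Γ.Adj u v) : IsRelator z ⁅(var u.succ : NCPoly d), (var v.succ : NCPoly d)⁆
  | vertex (k : Fin d) : IsRelator z
      (⁅(var 0 : NCPoly d), (var k.succ : NCPoly d)⁆ +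
        ⁅(var k.succ : NCPoly d), epsilon (z k)⁆ + var k.succ * var k.succ)

theorem IsRelator.mem_restrictedFree {z : Fin d → RAAG Γ} {r : NCPoly d} (h : IsRelator z r) :
    r ∈ restrictedFree d := by
  have hv := var_mem_restrictedFree (d := d)
  cases h with
  | sq_zero => exact sq_mem_restrictedFree (hv 0)
  | edge u v h => exact (restrictedFree d).lie_mem (hv _) (hv _)
  | vertex k =>
    refine add_mem (add_mem ((restrictedFree d).lie_mem (hv _) (hv _))
      ((restrictedFree d).lie_mem (hv _) ?_)) (sq_mem_restrictedFree (hv _))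
    exact sum_mem fun i _ => (restrictedFree d).smul_mem _ (hv _)

/-- The two-sided ideal `𝓘_z` of `𝓔` generated by the relations. -/
def idealI (z : Fin d → RAAG Γ) : TwoSidedIdeal (NCPoly d) :=
  TwoSidedIdeal.span {r | IsRelator z r}

/-- `𝓔_z = 𝓔 / 𝓘_z`. -/
abbrev EZ (z : Fin d → RAAG Γ) : Type := (idealI z).ringCon.Quotient

/-- The projection `𝓔 → 𝓔_z`. -/
def EZ.mk (z : Fin d → RAAG Γ) : NCPoly d →ₐ[ZMod 2] EZ z :=
  (idealI z).ringCon.mkₐ (α := ZMod 2)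

/-- The homogeneous component of degree `n` of `𝓔_z`. -/
def EZ.homogeneous (z : Fin d → RAAG Γ) (n : ℕ) : Submodule (ZMod 2) (EZ z) :=
  (ncHomogeneous d n).map (EZ.mk z).toLinearMap

/-- The restricted Lie ideal `𝓙_z` of `𝓛` generated by the relations: the smallest Lie ideal
which contains them and is closed under the restriction map. -/
def idealJ (z : Fin d → RAAG Γ) : LieIdeal (ZMod 2) ↥(restrictedFree d) :=
  sInf {K | (∀ x : ↥(restrictedFree d), IsRelator z x.1 → x ∈ K) ∧ ∀ x ∈ K, restrictedSq x ∈ K}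

/-- `𝓛_z = 𝓛 / 𝓙_z`. -/
abbrev LZ (z : Fin d → RAAG Γ) : Type := ↥(restrictedFree d) ⧸ idealJ z

/-- The projection `𝓛 → 𝓛_z`. -/
def LZ.mk (z : Fin d → RAAG Γ) : ↥(restrictedFree d) →ₗ[ZMod 2] LZ z :=
  (idealJ z).toSubmodule.mkQ

/-- The homogeneous component of degree `n` of `𝓛_z`. -/
def LZ.homogeneous (z : Fin d → RAAG Γ) (n : ℕ) : Submodule (ZMod 2) (LZ z) :=
  ((ncHomogeneous d n).comap (restrictedFree d).toSubmodule.subtype).map (LZ.mk z)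

end Algebras

/-- The clique polynomial `Γ(t) = ∑ cₙ(Γ) tⁿ`, where `cₙ(Γ)` is the number of complete subgraphs
of `Γ` with `n` vertices (so `c₀(Γ) = 1`). -/
def cliquePolynomial {d : ℕ} (Γ : SimpleGraph (Fin d)) : Polynomial ℚ :=
  ∑ n ∈ Finset.range (d + 1),
    Polynomial.C (({s : Finset (Fin d) | Γ.IsNClique n s}.ncard : ℕ) : ℚ) * Polynomial.X ^ n

end

end DeltaRAAG

/-! Sending `X_i` to the class of `x_i - 1` defines a homomorphism from the free algebra to the
graded algebra of `G_z`. It is onto because compactness makes the augmentation ideal a left ideal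
generated by the `x_i - 1` (`CGA.exists_eq_sum`, `IsTopGen.isGenerated`). It kills the relators
because the group relations, expanded in the `x_i - 1`, give each relator modulo the cube of the
augmentation ideal (`IsRelator.evalAt_mem`).

For injectivity, the vertex relations move `X_0` to the right and `X_0²` vanishes, so the products
`w X_0^b`, with `w` a trace (a word in `X_1, …, X_d` up to the commutations of the graph) and `b` in
`{0, 1}`, span the presented algebra (`span_normalEZ`). They are separated by a representation: the
Magnus representation `x_i ↦ 1 + X_i` of `G_Γ` in the truncated trace algebra is induced to `G_z`.
In a suitable basis this gives 2 × 2 matrices compatible with a filtration in which `x_0 - 1` has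
weight one (`gzMat_sub_one_mem`), and the first row of the image of `w X_0^b` is `w` in column `b`
(`normalLift_row`). A combination of normal forms of degree `n` that lies in the next power of the
augmentation ideal is therefore zero (`eq_zero_of_normalPoly_mem_matFilt`). This gives the first
isomorphism. Counting normal forms gives the series as `1 + t` times the growth series of the trace
monoid, which the Cartier–Foata identity inverts (`Trace.growth_mul`).

The Lie statement needs two more facts. The map from `𝓛/𝓙_z` to `𝓔/𝓘_z` must be injective: modulo
elements of large degree the quotient is finite, and a representation with the right kernel is built
by adjoining one element at a time, by an explicit induced representation (`HasRep.step`,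
`mem_subJ_of_mk_eq_zero`). And `𝓛(G_z)` must be generated in degree one, which follows from a count
in the style of Jennings and Quillen. For the finite 2-group `P = G/G_m`, the group algebra has
dimension `|P|`, and its graded algebra is generated by the image `L'` of `𝓛`, so it has dimension
at most `2 ^ dim L'` (`HasStable.step`, `card_quotient_le`). Since `|P|` is the product of the
orders of the `G_k/G_{k+1}` with `k < m`, the image of `𝓛` fills every degree
(`map_lieHom_eq_lieRange`). The count requires each `G_m` to be open, which the same matrices show
(`isOpen_zassenhaus`). -/

namespace DeltaRAAG

noncomputable section

/-! ### The trace monoid of a graph -/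

section Trace

variable {d : ℕ} (Γ : SimpleGraph (Fin d))

/-- The commutation relations `ij = ji` for the edges `{i, j}`. -/
inductive TraceRel : FreeMonoid (Fin d) → FreeMonoid (Fin d) → Prop
  | comm (i j : Fin d) (h : Γ.Adj i j) :
      TraceRel (FreeMonoid.of i * FreeMonoid.of j) (FreeMonoid.of j * FreeMonoid.of i)

/-- The free partially commutative monoid of `Γ`. -/
abbrev Trace : Type := PresentedMonoid (TraceRel Γ)

namespace Trace

/-- The letters. -/
def of (i : Fin d) : Trace Γ := PresentedMonoid.of (TraceRel Γ) i

variable {Γ}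

theorem of_mul_of {i j : Fin d} (h : Γ.Adj i j) : of Γ i * of Γ j = of Γ j * of Γ i :=
  PresentedMonoid.mk_eq_mk_of_rel (TraceRel.comm i j h)

/-- The universal property of the trace monoid. -/
def lift {N : Type*} [Monoid N] (f : Fin d → N)
    (h : ∀ i j, Γ.Adj i j → f i * f j = f j * f i) : Trace Γ →* N :=
  PresentedMonoid.lift f (by
    rintro _ _ ⟨i, j, hij⟩
    simpa using h i j hij)

@[simp] theorem lift_of {N : Type*} [Monoid N] (f : Fin d → N)
    (h : ∀ i j, Γ.Adj i j → f i * f j = f j * f i) (i : Fin d) : lift f h (of Γ i) = f i := rfl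

theorem induction {p : Trace Γ → Prop} (one : p 1) (of_mul : ∀ i w, p w → p (of Γ i * w))
    (w : Trace Γ) : p w := by
  induction w using PresentedMonoid.inductionOn with
  | h a =>
    induction a using FreeMonoid.inductionOn' with
    | one => exact one
    | of_mul i a ih => exact of_mul i _ ih

/-- The length of a trace. -/
def lenHom : Trace Γ →* Multiplicative ℕ :=
  lift (fun _ => Multiplicative.ofAdd 1) fun _ _ _ => rfl

/-- The length of a trace. -/
def len (w : Trace Γ) : ℕ := (lenHom w).toAdd

@[simp] theorem len_one : len (1 : Trace Γ) = 0 := rfl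

@[simp] theorem len_of (i : Fin d) : len (of Γ i) = 1 := rfl

@[simp] theorem len_mul (v w : Trace Γ) : len (v * w) = len v + len w := by
  simp [len]

instance finite_len (n : ℕ) : Finite {w : Trace Γ // len w = n} := by
  induction n with
  | zero =>
    refine Finite.of_injective (β := Unit) (fun _ => ()) ?_
    rintro ⟨v, hv⟩ ⟨w, hw⟩ -
    have key : ∀ u : Trace Γ, len u = 0 → u = 1 := fun u => by
      induction u using induction with
      | one => exact fun _ => rfl
      | of_mul i u ih => intro h; simp at h
    exact Subtype.ext ((key v hv).trans (key w hw).symm)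
  | succ n ih =>
    refine Finite.of_surjective (α := Fin d × {w : Trace Γ // len w = n})
      (fun p => ⟨of Γ p.1 * p.2.1, by simp [p.2.2, add_comm]⟩) ?_
    rintro ⟨w, hw⟩
    induction w using induction with
    | one => simp at hw
    | of_mul i u _ =>
      refine ⟨(i, ⟨u, ?_⟩), rfl⟩
      simp at hw
      omega

variable (Γ) in
open Classical in
/-- One step of the computation of the left quotient by the letter `i`. -/
def remStep (i j : Fin d) : Function.End (Trace Γ × Option (Trace Γ)) := fun p =>
  (of Γ j * p.1, if j = i then some p.1 else
    if Γ.Adj i j then p.2.map (of Γ j * ·) else none)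

/-- The recursion for the left quotient by `i` carries the trace along, since reading the letter `i`
must return everything read before. Commutation is what lets the recursion descend from words to
traces. If one of `j`, `k` equals `i`, adjacency makes both orders return the same quotient. -/
theorem remStep_comm (i j k : Fin d) (h : Γ.Adj j k) :
    remStep Γ i j * remStep Γ i k = remStep Γ i k * remStep Γ i j := by
  have hne : j ≠ k := h.ne
  funext ⟨m, o⟩
  change remStep Γ i j (remStep Γ i k (m, o)) = remStep Γ i k (remStep Γ i j (m, o))
  have e : ∀ u, of Γ j * (of Γ k * u) = of Γ k * (of Γ j * u) := fun u => by
    rw [← mul_assoc, of_mul_of h, mul_assoc]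
  simp only [remStep, e, Prod.mk.injEq, true_and]
  by_cases hj : j = i
  · subst hj
    simp [hne.symm, h]
  · by_cases hk : k = i
    · subst hk
      simp [hj, h.symm]
    · by_cases h1 : Γ.Adj i j <;> by_cases h2 : Γ.Adj i k <;>
        simp [hj, hk, h1, h2, Option.map_map, Function.comp_def, e]

/-- The action of traces on pairs consisting of a trace and its left quotient by `i`. -/
def remHom (i : Fin d) : Trace Γ →* Function.End (Trace Γ × Option (Trace Γ)) :=
  lift (remStep Γ i) fun j k h => remStep_comm i j k h

/-- The left quotient of `w` by the letter `i`, if it exists. -/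
def rem (i : Fin d) (w : Trace Γ) : Option (Trace Γ) := (remHom i w (1, none)).2

theorem remHom_fst (i : Fin d) (w : Trace Γ) : (remHom i w (1, none)).1 = w := by
  induction w using induction with
  | one => rfl
  | of_mul j w ih =>
    rw [map_mul]
    exact congrArg (of Γ j * ·) ih

theorem rem_one (i : Fin d) : rem i (1 : Trace Γ) = none := rfl

open Classical in
theorem rem_of_mul (i j : Fin d) (w : Trace Γ) : rem i (of Γ j * w) =
    if j = i then some w else if Γ.Adj i j then (rem i w).map (of Γ j * ·) else none := by
  have : remHom i w (1, none) = (w, rem i w) := Prod.ext (remHom_fst i w) rfl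
  rw [rem, map_mul]
  change (remStep Γ i j (remHom i w (1, none))).2 = _
  rw [this]
  rfl

theorem rem_of_mul_self (i : Fin d) (w : Trace Γ) : rem i (of Γ i * w) = some w := by
  simp [rem_of_mul]

theorem eq_of_rem {i : Fin d} {w w' : Trace Γ} (h : rem i w = some w') : w = of Γ i * w' := by
  induction w using induction generalizing w' with
  | one => simp [rem_one] at h
  | of_mul j w ih =>
    rw [rem_of_mul] at h
    split_ifs at h with h1 h2
    · rw [h1, Option.some_injective _ h]
    · obtain ⟨u, hu, rfl⟩ := Option.map_eq_some_iff.1 h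
      rw [ih hu, ← mul_assoc, ← mul_assoc, of_mul_of h2]

/-- The quotient `rem i` is a left inverse of multiplication by the letter. -/
theorem of_mul_injective (i : Fin d) : Function.Injective (of Γ i * ·) := fun v w h => by
  have := congrArg (rem i) h
  simp only [rem_of_mul_self] at this
  exact Option.some_injective _ this

open Classical in
/-- The set of letters which divide `w` on the left. -/
def initials (w : Trace Γ) : Finset (Fin d) := {i | (rem i w).isSome}

theorem mem_initials {i : Fin d} {w : Trace Γ} : i ∈ initials w ↔ ∃ w', w = of Γ i * w' := by
  simp only [initials, Finset.mem_filter, Finset.mem_univ, true_and, Option.isSome_iff_exists]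
  constructor
  · rintro ⟨w', h⟩
    exact ⟨w', eq_of_rem h⟩
  · rintro ⟨w', rfl⟩
    exact ⟨w', rem_of_mul_self i w'⟩

theorem mem_initials_of_mul {i j : Fin d} (hij : j ≠ i) {w : Trace Γ} :
    i ∈ initials (of Γ j * w) ↔ Γ.Adj i j ∧ i ∈ initials w := by
  simp only [initials, Finset.mem_filter, Finset.mem_univ, true_and, rem_of_mul, if_neg hij]
  split_ifs with h <;> simp [h]

theorem initials_eq_empty {w : Trace Γ} : initials w = ∅ ↔ w = 1 := by
  constructor
  · induction w using induction with
    | one => exact fun _ => rfl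
    | of_mul j w ih =>
      intro h
      exact absurd (h ▸ mem_initials.2 ⟨w, rfl⟩ : j ∈ (∅ : Finset (Fin d))) (Finset.notMem_empty j)
  · rintro rfl
    refine Finset.eq_empty_of_forall_notMem fun i hi => ?_
    obtain ⟨w', hw⟩ := mem_initials.1 hi
    have := congrArg len hw
    simp at this
    omega

variable (Γ) in
/-- The number of traces of length `n` that are divisible on the left by every letter of `S`. -/
def countInit (S : Finset (Fin d)) (n : ℕ) : ℕ :=
  Nat.card {w : Trace Γ // len w = n ∧ S ⊆ initials w}

theorem countInit_insert_zero (i : Fin d) (S : Finset (Fin d)) :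
    countInit Γ (insert i S) 0 = 0 := by
  rw [countInit, Nat.card_eq_zero]
  refine Or.inl ⟨?_⟩
  rintro ⟨w, hw, hS⟩
  obtain ⟨w', rfl⟩ := mem_initials.1 (hS (Finset.mem_insert_self i S))
  simp at hw

/-- Cancelling the letter `i` is a bijection: a letter adjacent to `i` divides `i w` exactly when it
divides `w`. -/
theorem countInit_insert_succ {i : Fin d} {S : Finset (Fin d)} (hi : i ∉ S)
    (h : ∀ j ∈ S, Γ.Adj j i) (n : ℕ) :
    countInit Γ (insert i S) (n + 1) = countInit Γ S n := by
  have key : ∀ w : Trace Γ, S ⊆ initials (of Γ i * w) ↔ S ⊆ initials w := fun w => by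
    refine forall₂_congr fun j hj => ?_
    have hij : i ≠ j := by rintro rfl; exact hi hj
    rw [mem_initials_of_mul hij]
    simp [h j hj]
  refine (Nat.card_congr (Equiv.ofBijective
    (fun w : {w : Trace Γ // len w = n ∧ S ⊆ initials w} =>
      (⟨of Γ i * w.1, by simp [w.2.1, add_comm], ?_⟩ :
        {w : Trace Γ // len w = n + 1 ∧ insert i S ⊆ initials w})) ⟨?_, ?_⟩)).symm
  · exact Finset.insert_subset (mem_initials.2 ⟨_, rfl⟩) ((key _).2 w.2.2)
  · intro v w hvw
    exact Subtype.ext (of_mul_injective i (congrArg Subtype.val hvw))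
  · rintro ⟨w, hw, hS⟩
    obtain ⟨w', rfl⟩ := mem_initials.1 (hS (Finset.mem_insert_self i S))
    refine ⟨⟨w', ?_, (key _).1 ((Finset.subset_insert i S).trans hS)⟩, rfl⟩
    simp at hw
    omega

/-- Two distinct letters can both start the same trace only if they commute. -/
theorem countInit_of_not_clique {S : Finset (Fin d)} (h : ¬ Γ.IsClique S) (n : ℕ) :
    countInit Γ S n = 0 := by
  rw [countInit, Nat.card_eq_zero]
  refine Or.inl ⟨?_⟩
  rintro ⟨w, hw, hS⟩
  refine h fun i hi j hj hij => ?_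
  obtain ⟨w', rfl⟩ := mem_initials.1 (hS hj)
  exact ((mem_initials_of_mul hij.symm).1 (hS hi)).1

variable (Γ) in
/-- The growth series of the trace monoid. -/
def growth : PowerSeries ℚ := PowerSeries.mk fun n => (Nat.card {w : Trace Γ // len w = n} : ℚ)

open Classical in
-- The letters of a clique can be cancelled one after the other, each cancellation costing one
-- factor `X`.
theorem mk_countInit (S : Finset (Fin d)) :
    (PowerSeries.mk fun n => (countInit Γ S n : ℚ)) =
      if Γ.IsClique S then PowerSeries.X ^ S.card * growth Γ else 0 := by
  induction S using Finset.induction_on with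
  | empty => simp [countInit, growth]
  | insert i S hi ih =>
    split_ifs with h
    · rw [if_pos (h.subset (by simp))] at ih
      rw [Finset.card_insert_of_notMem hi, pow_succ', mul_assoc, ← ih]
      ext n
      rcases n with _ | n
      · simp [countInit_insert_zero]
      · rw [PowerSeries.coeff_succ_X_mul, PowerSeries.coeff_mk, PowerSeries.coeff_mk,
          countInit_insert_succ hi]
        intro j hj
        exact h (by simp [hj]) (by simp) (fun e => hi (e ▸ hj))
    · ext n
      simp [countInit_of_not_clique h]

/-- Inclusion–exclusion. After exchanging the sums, a trace contributes the alternating sum over all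
subsets of its set of initial letters. This vanishes unless that set is empty, which happens only
for the trivial trace. -/
theorem sum_countInit (n : ℕ) :
    ∑ S : Finset (Fin d), (-1 : ℤ) ^ S.card * countInit Γ S n = if n = 0 then 1 else 0 := by
  classical
  have := Fintype.ofFinite {w : Trace Γ // len w = n}
  have h1 : ∀ S : Finset (Fin d), (countInit Γ S n : ℤ) =
      ∑ w : {w : Trace Γ // len w = n}, if S ⊆ initials w.1 then 1 else 0 := fun S => by
    rw [Finset.sum_boole, countInit, Nat.card_congr (Equiv.subtypeSubtypeEquivSubtypeInter
      (fun w : Trace Γ => len w = n) (fun w => S ⊆ initials w)).symm, Nat.card_eq_fintype_card,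
      Fintype.card_subtype]
  simp_rw [h1, Finset.mul_sum]
  rw [Finset.sum_comm]
  have h2 : ∀ w : {w : Trace Γ // len w = n}, ∑ S : Finset (Fin d), (-1 : ℤ) ^ S.card *
      (if S ⊆ initials w.1 then 1 else 0) = if w.1 = 1 then 1 else 0 := fun w => by
    simp_rw [mul_ite, mul_one, mul_zero, ← Finset.mem_powerset]
    rw [Finset.sum_ite_mem, Finset.univ_inter, Finset.sum_powerset_neg_one_pow_card]
    simp only [initials_eq_empty]
  rw [Finset.sum_congr rfl fun w _ => h2 w]
  split_ifs with hn
  · subst hn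
    rw [Finset.sum_eq_single ⟨1, rfl⟩]
    · simp
    · intro w _ hw
      rw [if_neg fun e => hw (Subtype.ext e)]
    · simp
  · refine Finset.sum_eq_zero fun w _ => if_neg fun e => hn ?_
    rw [← w.2, e, len_one]

open Classical in
theorem cliquePolynomial_comp : (cliquePolynomial Γ).comp (-Polynomial.X) =
    ∑ S : Finset (Fin d), if Γ.IsClique S then (-Polynomial.X) ^ S.card else 0 := by
  rw [cliquePolynomial, Polynomial.sum_comp]
  rw [← Finset.sum_fiberwise_of_maps_to (s := Finset.univ) (t := Finset.range (d + 1))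
    (g := Finset.card) (fun S _ => by
      rw [Finset.mem_range]
      have := S.card_le_univ
      simp at this
      omega)]
  refine Finset.sum_congr rfl fun n _ => ?_
  rw [Set.ncard_eq_toFinset_card', ← Finset.sum_filter, Finset.filter_filter,
    Finset.sum_congr rfl (g := fun _ => (-Polynomial.X : Polynomial ℚ) ^ n)]
  · rw [Finset.sum_const, nsmul_eq_mul]
    simp only [Polynomial.mul_comp, Polynomial.pow_comp, Polynomial.X_comp, map_natCast]
    congr 4
    ext S
    simp [SimpleGraph.isNClique_iff, and_comm]
  · intro S hS
    rw [(Finset.mem_filter.1 hS).2.1]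

/-- The Cartier–Foata identity. -/
theorem growth_mul : growth Γ *
    (((cliquePolynomial Γ).comp (-Polynomial.X) : Polynomial ℚ) : PowerSeries ℚ) = 1 := by
  classical
  have h : ∑ S : Finset (Fin d), (-1 : PowerSeries ℚ) ^ S.card *
      (PowerSeries.mk fun n => (countInit Γ S n : ℚ)) = 1 := by
    ext n
    have := congrArg (Int.cast : ℤ → ℚ) (sum_countInit (Γ := Γ) n)
    push_cast at this
    rw [map_sum, PowerSeries.coeff_one, ← this]
    refine Finset.sum_congr rfl fun S _ => ?_
    rcases Nat.even_or_odd S.card with h' | h' <;> simp [h'.neg_one_pow]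
  rw [← h, cliquePolynomial_comp, ← Polynomial.coeToPowerSeries.ringHom_apply, map_sum,
    Finset.mul_sum]
  refine Finset.sum_congr rfl fun S _ => ?_
  rw [mk_countInit]
  split_ifs
  · rw [map_pow, map_neg, Polynomial.coeToPowerSeries.ringHom_apply, Polynomial.coe_X,
      neg_pow PowerSeries.X]
    ring
  · rw [map_zero, mul_zero, mul_zero]

end Trace

end Trace

end

end DeltaRAAG

namespace DeltaRAAG

noncomputable section

/-! ### Open subgroups of free pro-2 groups, of pro-2 RAAGs and of Δ-RAAGs -/

/-- The family `x` generates every quotient of `G` by an open normal subgroup, and these quotients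
are finite. -/
def IsTopGen {G ι : Type*} [Group G] [TopologicalSpace G] (x : ι → G) : Prop :=
  ∀ N : OpenNormalSubgroup G, Finite (G ⧸ N.toSubgroup) ∧
    ∀ g : G, ∃ h ∈ Subgroup.closure (Set.range x), g⁻¹ * h ∈ N.toSubgroup

/-! ### Free pro-2 groups: a basis of neighbourhoods, dense words and maps to finite 2-groups -/

section FreeProTwo

/-- Makes the family of subgroups defining the pro-2 completion directed. -/
theorem index_inf_eq_two_pow {H : Type*} [Group H] {N M : Subgroup H} [N.Normal]
    (hN : ∃ k : ℕ, N.index = 2 ^ k) (hM : ∃ k : ℕ, M.index = 2 ^ k) :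
    ∃ k : ℕ, (N ⊓ M).index = 2 ^ k := by
  obtain ⟨a, ha⟩ := hN
  obtain ⟨b, hb⟩ := hM
  have h1 : N.relIndex M * M.index = (N ⊓ M).index := by
    rw [← Subgroup.inf_relIndex_right, Subgroup.relIndex_mul_index inf_le_right]
  have h2 : (N ⊓ M).index ∣ 2 ^ (a + b) := by
    rw [← h1, hb, pow_add, ← ha]
    exact mul_dvd_mul_right (Subgroup.relIndex_dvd_index_of_normal N M) _
  obtain ⟨k, -, hk⟩ := (Nat.dvd_prime_pow Nat.prime_two).1 h2
  exact ⟨k, hk⟩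

variable {X : Type*}

/-- The topology is an infimum of induced topologies, so the neighbourhood filter of `1` is an
infimum of principal filters. It is directed because the projection to `H/(N ∩ M)` determines those
to `H/N` and `H/M`. -/
theorem FreeProTwo.exists_ker_proj_le {U : Set (FreeProTwo X)} (hU : IsOpen U) (h1 : 1 ∈ U) :
    ∃ N : TwoPowerQuotient (FreeGroup X), ((FreeProTwo.proj X N).ker : Set (FreeProTwo X)) ⊆ U := by
  have h := hU.mem_nhds h1
  rw [nhds_iInf] at h
  have e : ∀ N : TwoPowerQuotient (FreeGroup X),
      @nhds _ (TopologicalSpace.induced (FreeProTwo.proj X N) ⊥) 1 =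
        Filter.principal ((FreeProTwo.proj X N).ker : Set (FreeProTwo X)) := fun N => by
    let : TopologicalSpace (FreeGroup X ⧸ N.1) := ⊥
    have : DiscreteTopology (FreeGroup X ⧸ N.1) := ⟨rfl⟩
    rw [nhds_induced, nhds_discrete, ← Filter.principal_singleton, Filter.comap_principal]
    congr 1
  simp_rw [e] at h
  have : Nonempty (TwoPowerQuotient (FreeGroup X)) := ⟨⟨⊤, inferInstance, 0, by simp⟩⟩
  rw [Filter.mem_iInf_of_directed] at h
  · exact h
  · intro N M
    refine ⟨⟨N.1 ⊓ M.1, inferInstance, index_inf_eq_two_pow N.2.2 M.2.2⟩, ?_, ?_⟩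
    · refine Filter.principal_mono.2 fun f hf => ?_
      rw [SetLike.mem_coe, MonoidHom.mem_ker] at hf ⊢
      have := f.2 ⟨N.1 ⊓ M.1, inferInstance, index_inf_eq_two_pow N.2.2 M.2.2⟩ N inf_le_left
      exact this.symm.trans ((congrArg _ hf).trans (map_one _))
    · refine Filter.principal_mono.2 fun f hf => ?_
      rw [SetLike.mem_coe, MonoidHom.mem_ker] at hf ⊢
      have := f.2 ⟨N.1 ⊓ M.1, inferInstance, index_inf_eq_two_pow N.2.2 M.2.2⟩ M inf_le_right
      exact this.symm.trans ((congrArg _ hf).trans (map_one _))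

theorem FreeProTwo.proj_lift_gen (N : TwoPowerQuotient (FreeGroup X)) (w : FreeGroup X) :
    FreeProTwo.proj X N (FreeGroup.lift FreeProTwo.gen w) = (w : FreeGroup X ⧸ N.1) := by
  have : (FreeProTwo.proj X N).comp (FreeGroup.lift FreeProTwo.gen) = QuotientGroup.mk' N.1 := by
    ext i
    rw [MonoidHom.comp_apply, FreeGroup.lift_apply_of]
    rfl
  exact DFunLike.congr_fun this w

theorem TwoPowerQuotient.finite {H : Type*} [Group H] (N : TwoPowerQuotient H) :
    Finite (H ⧸ N.1) := by
  obtain ⟨k, hk⟩ := N.2.2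
  exact Nat.finite_of_card_ne_zero (show N.1.index ≠ 0 by rw [hk]; positivity)

theorem FreeProTwo.finiteIndex_of_isOpen {U : Subgroup (FreeProTwo X)}
    (hU : IsOpen (U : Set (FreeProTwo X))) : U.FiniteIndex := by
  obtain ⟨N, hN⟩ := FreeProTwo.exists_ker_proj_le hU (one_mem U)
  have := N.finite
  have : (FreeProTwo.proj X N).ker.FiniteIndex := inferInstance
  exact Subgroup.finiteIndex_of_le (H := (FreeProTwo.proj X N).ker) hN

theorem FreeProTwo.exists_word {U : Subgroup (FreeProTwo X)}
    (hU : IsOpen (U : Set (FreeProTwo X))) (f : FreeProTwo X) :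
    ∃ w : FreeGroup X, f⁻¹ * FreeGroup.lift FreeProTwo.gen w ∈ U := by
  obtain ⟨N, hN⟩ := FreeProTwo.exists_ker_proj_le hU (one_mem U)
  obtain ⟨w, hw⟩ := QuotientGroup.mk_surjective (FreeProTwo.proj X N f)
  refine ⟨w, hN ?_⟩
  rw [SetLike.mem_coe, MonoidHom.mem_ker, map_mul, map_inv, FreeProTwo.proj_lift_gen, hw,
    inv_mul_cancel]

/-- The universal property of the free pro-`2` group for finite `2`-groups. -/
theorem FreeProTwo.exists_lift {P : Type*} [Group P] [Finite P] (hP : IsPGroup 2 P) (p : X → P) :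
    ∃ f : FreeProTwo X →* P, (∀ i, f (FreeProTwo.gen i) = p i) ∧
      IsOpen (f.ker : Set (FreeProTwo X)) := by
  have hidx : ∃ k : ℕ, (FreeGroup.lift p).ker.index = 2 ^ k := by
    have := Fact.mk Nat.prime_two
    obtain ⟨k, hk⟩ := IsPGroup.iff_card.1 (hP.to_subgroup (FreeGroup.lift p).range)
    exact ⟨k, by rw [Subgroup.index_ker, hk]⟩
  let N : TwoPowerQuotient (FreeGroup X) := ⟨(FreeGroup.lift p).ker, inferInstance, hidx⟩
  refine ⟨(QuotientGroup.kerLift (FreeGroup.lift p)).comp (FreeProTwo.proj X N), fun i => ?_, ?_⟩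
  · change QuotientGroup.kerLift (FreeGroup.lift p) (FreeGroup.of i : FreeGroup X ⧸ _) = p i
    rw [QuotientGroup.kerLift_mk, FreeGroup.lift_apply_of]
  · refine Subgroup.isOpen_mono ?_ (FreeProTwo.isOpen_proj_ker N)
    intro x hx
    rw [MonoidHom.mem_ker] at hx ⊢
    exact (congrArg (QuotientGroup.kerLift (FreeGroup.lift p)) hx).trans (map_one _)

end FreeProTwo

/-! ### Pro-2 right-angled Artin groups -/

section RAAG

variable {d : ℕ} {Γ : SimpleGraph (Fin d)}

variable (Γ) in
/-- The projection of the free pro-`2` group to `G_Γ`. -/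
def RAAG.mk : FreeProTwo (Fin d) →* RAAG Γ := QuotientGroup.mk' (raagRelations Γ)

theorem RAAG.mk_surjective : Function.Surjective (RAAG.mk Γ) := QuotientGroup.mk_surjective

theorem RAAG.isOpen_iff {U : Set (RAAG Γ)} : IsOpen U ↔ IsOpen (RAAG.mk Γ ⁻¹' U) :=
  isOpen_coinduced

theorem RAAG.gen_commute {i j : Fin d} (h : Γ.Adj i j) :
    RAAG.gen Γ i * RAAG.gen Γ j = RAAG.gen Γ j * RAAG.gen Γ i := by
  have h1 : (FreeProTwo.gen i)⁻¹ * (FreeProTwo.gen j)⁻¹ * FreeProTwo.gen i * FreeProTwo.gen j ∈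
      raagRelations Γ :=
    Subgroup.le_topologicalClosure _ (Subgroup.subset_normalClosure ⟨i, j, h, rfl⟩)
  have h2 := (QuotientGroup.eq_one_iff _).2 h1
  have h3 : (RAAG.gen Γ i)⁻¹ * (RAAG.gen Γ j)⁻¹ * RAAG.gen Γ i * RAAG.gen Γ j = 1 := h2
  have h4 : (RAAG.gen Γ j * RAAG.gen Γ i)⁻¹ * (RAAG.gen Γ i * RAAG.gen Γ j) = 1 := by
    rw [← h3]; group
  exact (inv_mul_eq_one.1 h4).symm

theorem RAAG.finite_quotient {N : Subgroup (RAAG Γ)} (hN : IsOpen (N : Set (RAAG Γ))) :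
    Finite (RAAG Γ ⧸ N) := by
  have h := FreeProTwo.finiteIndex_of_isOpen (U := N.comap (RAAG.mk Γ)) (RAAG.isOpen_iff.1 hN)
  have e := N.index_comap_of_surjective RAAG.mk_surjective
  exact Nat.finite_of_card_ne_zero (show N.index ≠ 0 by rw [← e]; exact h.index_ne_zero)

theorem RAAG.exists_word {N : Subgroup (RAAG Γ)} (hN : IsOpen (N : Set (RAAG Γ))) (g : RAAG Γ) :
    ∃ h ∈ Subgroup.closure (Set.range (RAAG.gen Γ)), g⁻¹ * h ∈ N := by
  obtain ⟨f, rfl⟩ := RAAG.mk_surjective g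
  obtain ⟨w, hw⟩ := FreeProTwo.exists_word (U := N.comap (RAAG.mk Γ)) (RAAG.isOpen_iff.1 hN) f
  refine ⟨RAAG.mk Γ (FreeGroup.lift FreeProTwo.gen w), ?_, by simpa using hw⟩
  have : (RAAG.mk Γ).comp (FreeGroup.lift FreeProTwo.gen) = FreeGroup.lift (RAAG.gen Γ) := by
    ext i
    rw [MonoidHom.comp_apply, FreeGroup.lift_apply_of, FreeGroup.lift_apply_of]
    rfl
  rw [← MonoidHom.comp_apply, this, ← FreeGroup.range_lift_eq_closure]
  exact ⟨w, rfl⟩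

/-- The words in the generators are dense. Applied to subgroups on which two homomorphisms agree,
this extends a property of the generators to all of `G_Γ`. -/
theorem RAAG.eq_top_of_isOpen {H N : Subgroup (RAAG Γ)} (hN : IsOpen (N : Set (RAAG Γ)))
    (hNH : N ≤ H) (hgen : ∀ i, RAAG.gen Γ i ∈ H) : H = ⊤ := by
  refine (Subgroup.eq_top_iff' H).2 fun g => ?_
  obtain ⟨h, hh, hgh⟩ := RAAG.exists_word hN g
  have h1 : h ∈ H := (Subgroup.closure_le H).2 (by rintro _ ⟨i, rfl⟩; exact hgen i) hh
  have := H.mul_mem h1 (H.inv_mem (hNH hgh))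
  simpa using this

/-- The universal property of `G_Γ` for finite `2`-groups. -/
theorem RAAG.exists_lift {P : Type*} [Group P] [Finite P] (hP : IsPGroup 2 P) (p : Fin d → P)
    (hp : ∀ i j, Γ.Adj i j → p i * p j = p j * p i) :
    ∃ f : RAAG Γ →* P, (∀ i, f (RAAG.gen Γ i) = p i) ∧ IsOpen (f.ker : Set (RAAG Γ)) := by
  obtain ⟨f, hf, ho⟩ := FreeProTwo.exists_lift hP p
  have hle : raagRelations Γ ≤ f.ker := by
    refine Subgroup.topologicalClosure_minimal _ (Subgroup.normalClosure_le_normal ?_)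
      (Subgroup.isClosed_of_isOpen _ ho)
    rintro _ ⟨u, v, huv, rfl⟩
    rw [SetLike.mem_coe, MonoidHom.mem_ker]
    simp only [map_mul, map_inv, hf]
    rw [mul_assoc, hp u v huv]
    group
  refine ⟨QuotientGroup.lift (raagRelations Γ) f hle, fun i => hf i, ?_⟩
  rw [RAAG.isOpen_iff]
  exact ho

end RAAG

/-! ### The semidirect product with the group of order two -/

section GZ

variable {d : ℕ} {Γ : SimpleGraph (Fin d)} (δ : Delta →* MulAut (RAAG Γ))

theorem GZ.continuous_left : Continuous (SemidirectProduct.left : GZ δ → RAAG Γ) :=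
  continuous_iff_le_induced.2 inf_le_left

theorem GZ.isOpen_right_preimage (S : Set Delta) :
    IsOpen ((SemidirectProduct.right : GZ δ → Delta) ⁻¹' S) := by
  refine (inf_le_right : (_ : TopologicalSpace (GZ δ)) ≤
    TopologicalSpace.induced SemidirectProduct.right ⊥) _ ?_
  exact ⟨S, trivial, rfl⟩

theorem GZ.continuous_inl : Continuous (SemidirectProduct.inl : RAAG Γ →* GZ δ) := by
  refine continuous_inf_rng.2 ⟨continuous_induced_rng.2 ?_, continuous_induced_rng.2 ?_⟩
  · exact (continuous_id : Continuous fun g : RAAG Γ => g)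
  · exact @continuous_const _ _ _ ⊥ 1

theorem Delta.eq_one_or (s : Delta) : s = 1 ∨ s = Delta.x₀ := by
  revert s; decide

theorem GZ.inl_mem_closure {g : RAAG Γ} (hg : g ∈ Subgroup.closure (Set.range (RAAG.gen Γ))) :
    (SemidirectProduct.inl g : GZ δ) ∈ Subgroup.closure (Set.range (deltaGen δ)) := by
  have : Subgroup.closure (Set.range (RAAG.gen Γ)) ≤
      (Subgroup.closure (Set.range (deltaGen δ))).comap SemidirectProduct.inl := by
    rw [Subgroup.closure_le]
    rintro _ ⟨i, rfl⟩
    exact Subgroup.subset_closure ⟨i.succ, rfl⟩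
  exact this hg

theorem GZ.inr_mem_closure (s : Delta) :
    (SemidirectProduct.inr s : GZ δ) ∈ Subgroup.closure (Set.range (deltaGen δ)) := by
  obtain rfl | rfl := Delta.eq_one_or s
  · rw [map_one]; exact one_mem _
  · exact Subgroup.subset_closure ⟨0, rfl⟩

theorem GZ.isTopGen : IsTopGen (deltaGen δ) := by
  intro N
  have hK : IsOpen ((N.toSubgroup.comap (SemidirectProduct.inl : RAAG Γ →* GZ δ)) :
      Set (RAAG Γ)) := N.isOpen'.preimage (GZ.continuous_inl δ)
  constructor
  · have := RAAG.finite_quotient hK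
    refine Finite.of_surjective (α := (RAAG Γ ⧸ N.toSubgroup.comap
      (SemidirectProduct.inl : RAAG Γ →* GZ δ)) × Delta) (fun p =>
        QuotientGroup.mk' N.toSubgroup
          (SemidirectProduct.inl p.1.out * SemidirectProduct.inr p.2)) ?_
    intro x
    obtain ⟨g, rfl⟩ := QuotientGroup.mk_surjective x
    refine ⟨((g.left : RAAG Γ ⧸ _), g.right), ?_⟩
    have h1 : (g.left)⁻¹ * (Quotient.out (g.left : RAAG Γ ⧸ N.toSubgroup.comap
      (SemidirectProduct.inl : RAAG Γ →* GZ δ))) ∈ N.toSubgroup.comap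
      (SemidirectProduct.inl : RAAG Γ →* GZ δ) := by
      rw [← QuotientGroup.eq, QuotientGroup.out_eq']
    have h2 : QuotientGroup.mk' N.toSubgroup (SemidirectProduct.inl g.left) =
        QuotientGroup.mk' N.toSubgroup (SemidirectProduct.inl (Quotient.out (g.left : RAAG Γ ⧸
          N.toSubgroup.comap (SemidirectProduct.inl : RAAG Γ →* GZ δ)))) := by
      refine QuotientGroup.eq.2 ?_
      rw [← map_inv, ← map_mul]
      exact h1
    simp only
    rw [map_mul, ← h2, ← map_mul, SemidirectProduct.inl_left_mul_inr_right]
    rfl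
  · intro g
    obtain ⟨h, hh, hgh⟩ := RAAG.exists_word hK g.left
    refine ⟨SemidirectProduct.inl h * SemidirectProduct.inr g.right,
      mul_mem (GZ.inl_mem_closure δ hh) (GZ.inr_mem_closure δ _), ?_⟩
    have h1 : (SemidirectProduct.inl (g.left⁻¹ * h) : GZ δ) ∈ N.toSubgroup := hgh
    -- The error of the approximation in `G_z` is the error in `G_Γ` conjugated by the component in
    -- `Δ`.
    have h2 := (inferInstance : N.toSubgroup.Normal).conj_mem _ h1
      (SemidirectProduct.inr g.right)⁻¹
    convert h2 using 1
    nth_rewrite 1 [← SemidirectProduct.inl_left_mul_inr_right g]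
    rw [map_mul, map_inv]
    group

/-- The kernel of a homomorphism on `G_z` is open as soon as that of the restriction to `G_Γ` is. -/
theorem GZ.isOpen_ker {P : Type*} [Group P] (f : GZ δ →* P)
    (h : IsOpen ((f.comp SemidirectProduct.inl).ker : Set (RAAG Γ))) :
    IsOpen (f.ker : Set (GZ δ)) := by
  -- The kernel is cut along the cosets of `G_Γ`. On each coset the condition on the `G_Γ`-component
  -- is invariant under translation by the open kernel of the restriction.
  have hset : (f.ker : Set (GZ δ)) = ⋃ s : Delta,
      (SemidirectProduct.left ⁻¹' {g : RAAG Γ | f (SemidirectProduct.inl g) *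
        f (SemidirectProduct.inr s) = 1}) ∩ (SemidirectProduct.right ⁻¹' {s}) := by
    ext g
    simp only [SetLike.mem_coe, MonoidHom.mem_ker, Set.mem_iUnion, Set.mem_inter_iff,
      Set.mem_preimage, Set.mem_ofPred_eq, Set.mem_singleton_iff]
    constructor
    · intro hg
      exact ⟨g.right, by rw [← map_mul, SemidirectProduct.inl_left_mul_inr_right, hg], rfl⟩
    · rintro ⟨s, h1, rfl⟩
      rwa [← map_mul, SemidirectProduct.inl_left_mul_inr_right] at h1
  rw [hset]
  refine isOpen_iUnion fun s => IsOpen.inter (IsOpen.preimage (GZ.continuous_left δ) ?_)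
    (GZ.isOpen_right_preimage δ _)
  rw [isOpen_iff_mem_nhds]
  intro g hg
  have h1 : IsOpen ((fun x : RAAG Γ => g⁻¹ * x) ⁻¹'
      ((f.comp SemidirectProduct.inl).ker : Set (RAAG Γ))) :=
    h.preimage (continuous_const.mul continuous_id)
  refine Filter.mem_of_superset (h1.mem_nhds (by simp)) ?_
  intro x hx
  have hx' : f (SemidirectProduct.inl (g⁻¹ * x)) = 1 := hx
  rw [map_mul, map_mul, map_inv, map_inv, inv_mul_eq_one] at hx'
  rw [Set.mem_ofPred_eq] at hg ⊢
  rw [← hx', hg]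

end GZ

end

end DeltaRAAG

namespace DeltaRAAG

noncomputable section

/-! ### Completed group algebras of topologically finitely generated groups -/

section GroupAlgebra

variable {Q R : Type*} [Group Q] [Ring R] [Algebra (ZMod 2) R]

/-- The augmentation of a group algebra. -/
abbrev augMap (Q : Type*) [Group Q] : MonoidAlgebra (ZMod 2) Q →ₐ[ZMod 2] ZMod 2 :=
  MonoidAlgebra.lift (ZMod 2) (ZMod 2) Q 1

/-- Elements of augmentation zero are combinations of the `q - 1`. Only linearity is used, so `F`
may be any subspace, for example a step of a filtration or a left ideal. -/
theorem lift_sub_augMap_mem (F : Submodule (ZMod 2) R) (ψ : Q →* R) (hψ : ∀ q, ψ q - 1 ∈ F)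
    (x : MonoidAlgebra (ZMod 2) Q) :
    MonoidAlgebra.lift (ZMod 2) R Q ψ x - algebraMap (ZMod 2) R (augMap Q x) ∈ F := by
  induction x using MonoidAlgebra.induction_on with
  | of q => simpa using hψ q
  | add x y hx hy =>
    have := add_mem hx hy
    rw [map_add, map_add, map_add]
    convert this using 1
    abel
  | smul r x hx =>
    have := F.smul_mem r hx
    rw [map_smul, map_smul, smul_eq_mul, map_mul, ← Algebra.smul_def, ← smul_sub]
    exact this

theorem mem_span_sub_one {ι : Type*} (x : ι → Q) (hx : ∀ q, q ∈ Subgroup.closure (Set.range x))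
    (f : MonoidAlgebra (ZMod 2) Q) (hf : augMap Q f = 0) :
    f ∈ Ideal.span (Set.range fun i => MonoidAlgebra.of (ZMod 2) Q (x i) - 1) := by
  have key : ∀ q, MonoidAlgebra.of (ZMod 2) Q q - 1 ∈
      Ideal.span (Set.range fun i => MonoidAlgebra.of (ZMod 2) Q (x i) - 1) := fun q => by
    induction hx q using Subgroup.closure_induction with
    | mem q hq =>
      obtain ⟨i, rfl⟩ := hq
      exact Ideal.subset_span ⟨i, rfl⟩
    | one => rw [map_one, sub_self]; exact zero_mem _
    | mul q r _ _ hq hr =>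
      rw [map_mul, show MonoidAlgebra.of (ZMod 2) Q q * MonoidAlgebra.of (ZMod 2) Q r - 1 =
        MonoidAlgebra.of (ZMod 2) Q q * (MonoidAlgebra.of (ZMod 2) Q r - 1) +
          (MonoidAlgebra.of (ZMod 2) Q q - 1) by noncomm_ring]
      exact add_mem (Ideal.mul_mem_left _ _ hr) hq
    | inv q _ hq =>
      have e : MonoidAlgebra.of (ZMod 2) Q q⁻¹ - 1 =
          -(MonoidAlgebra.of (ZMod 2) Q q⁻¹ * (MonoidAlgebra.of (ZMod 2) Q q - 1)) := by
        rw [mul_sub, ← map_mul, inv_mul_cancel, map_one, mul_one, neg_sub]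
      rw [e]
      exact neg_mem (Ideal.mul_mem_left _ _ hq)
  have h := lift_sub_augMap_mem ((Ideal.span (Set.range fun i =>
    MonoidAlgebra.of (ZMod 2) Q (x i) - 1)).restrictScalars (ZMod 2))
    (MonoidAlgebra.of (ZMod 2) Q) key f
  have e : MonoidAlgebra.lift (ZMod 2) _ Q (MonoidAlgebra.of (ZMod 2) Q) =
      AlgHom.id (ZMod 2) (MonoidAlgebra (ZMod 2) Q) := by
    ext; simp
  rw [hf, map_zero, sub_zero, e] at h
  exact h

end GroupAlgebra

/-! ### The completed group algebra as an inverse limit -/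

section CGA

variable {G : Type*} [Group G] [TopologicalSpace G]

section lift

variable {R : Type*} [Ring R] [Algebra (ZMod 2) R]

/-- The extension to `E(G)` of a homomorphism with open kernel from `G` to the units of an
algebra. -/
def CGA.lift (φ : G →* R) (N : OpenNormalSubgroup G) (hN : N.toSubgroup ≤ φ.ker) :
    CGA G →ₐ[ZMod 2] R :=
  (MonoidAlgebra.lift (ZMod 2) R (G ⧸ N.toSubgroup) (QuotientGroup.lift N.toSubgroup φ hN)).comp
    (CGA.proj G N)

theorem CGA.lift_toCGA (φ : G →* R) (N : OpenNormalSubgroup G) (hN : N.toSubgroup ≤ φ.ker)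
    (g : G) : CGA.lift φ N hN (toCGA G g) = φ g := by
  rw [CGA.lift, AlgHom.comp_apply, proj_toCGA, MonoidAlgebra.lift_of]
  rfl

theorem CGA.lift_mem (φ : G →* R) (N : OpenNormalSubgroup G) (hN : N.toSubgroup ≤ φ.ker)
    (F : Submodule (ZMod 2) R) (hF : ∀ g, φ g - 1 ∈ F) {f : CGA G} (hf : f ∈ augIdeal G) :
    CGA.lift φ N hN f ∈ F := by
  have h := lift_sub_augMap_mem F (QuotientGroup.lift N.toSubgroup φ hN) (fun q => by
    obtain ⟨g, rfl⟩ := QuotientGroup.mk_surjective q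
    exact hF g) (CGA.proj G N f)
  rw [mem_augIdeal.1 hf N, map_zero, sub_zero] at h
  exact h

end lift

theorem CGA.proj_surjective (N : OpenNormalSubgroup G) : Function.Surjective (CGA.proj G N) := by
  intro x
  induction x using MonoidAlgebra.induction_on with
  | of q =>
    obtain ⟨g, rfl⟩ := QuotientGroup.mk_surjective q
    exact ⟨toCGA G g, rfl⟩
  | add x y hx hy =>
    obtain ⟨a, rfl⟩ := hx
    obtain ⟨b, rfl⟩ := hy
    exact ⟨a + b, map_add _ _ _⟩
  | smul r x hx =>
    obtain ⟨a, rfl⟩ := hx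
    exact ⟨r • a, map_smul _ _ _⟩

/-- The transition map `𝔽₂[G/N] → 𝔽₂[G/M]`. -/
def CGA.trans {N M : OpenNormalSubgroup G} (h : N.toSubgroup ≤ M.toSubgroup) :
    MonoidAlgebra (ZMod 2) (G ⧸ N.toSubgroup) →ₐ[ZMod 2]
      MonoidAlgebra (ZMod 2) (G ⧸ M.toSubgroup) :=
  MonoidAlgebra.mapDomainAlgHom (ZMod 2) (ZMod 2)
    (QuotientGroup.map N.toSubgroup M.toSubgroup (MonoidHom.id G) h)

theorem CGA.trans_proj {N M : OpenNormalSubgroup G} (h : N.toSubgroup ≤ M.toSubgroup)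
    (f : CGA G) : CGA.trans h (CGA.proj G N f) = CGA.proj G M f := f.2 N M h

theorem CGA.trans_self {N : OpenNormalSubgroup G} (h : N.toSubgroup ≤ N.toSubgroup)
    (a : MonoidAlgebra (ZMod 2) (G ⧸ N.toSubgroup)) : CGA.trans h a = a := by
  obtain ⟨f, rfl⟩ := CGA.proj_surjective N a
  exact CGA.trans_proj h f

theorem CGA.trans_trans {N M K : OpenNormalSubgroup G} (h : N.toSubgroup ≤ M.toSubgroup)
    (h' : M.toSubgroup ≤ K.toSubgroup) (a : MonoidAlgebra (ZMod 2) (G ⧸ N.toSubgroup)) :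
    CGA.trans h' (CGA.trans h a) = CGA.trans (h.trans h') a := by
  obtain ⟨f, rfl⟩ := CGA.proj_surjective N a
  rw [CGA.trans_proj, CGA.trans_proj, CGA.trans_proj]

theorem CGA.augMap_proj {N M : OpenNormalSubgroup G} (h : N.toSubgroup ≤ M.toSubgroup)
    (f : CGA G) : augMap _ (CGA.proj G M f) = augMap _ (CGA.proj G N f) := by
  rw [← CGA.trans_proj h, ← AlgHom.comp_apply]
  congr 1
  ext q
  simp [CGA.trans]

variable (G) in
/-- The whole group as an open normal subgroup. -/
def topSubgroup : OpenNormalSubgroup G where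
  toOpenSubgroup := ⊤
  isNormal' := inferInstanceAs (⊤ : Subgroup G).Normal

variable (G) in
/-- The augmentation `E(G) → 𝔽₂`. -/
def CGA.aug : CGA G →ₐ[ZMod 2] ZMod 2 := (augMap _).comp (CGA.proj G (topSubgroup G))

/-- Transition maps preserve the augmentation, so it can be tested in the trivial quotient. -/
theorem CGA.mem_augIdeal_iff {f : CGA G} : f ∈ augIdeal G ↔ CGA.aug G f = 0 := by
  rw [mem_augIdeal]
  constructor
  · exact fun h => h (topSubgroup G)
  · intro h N
    rw [← h]
    exact (CGA.augMap_proj (M := topSubgroup G) (fun _ _ => trivial) f).symm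

theorem CGA.sub_aug_mem (f : CGA G) :
    f - algebraMap (ZMod 2) (CGA G) (CGA.aug G f) ∈ augIdeal G := by
  rw [CGA.mem_augIdeal_iff, map_sub, AlgHom.commutes, sub_eq_zero]
  rfl

open CategoryTheory in
/-- The augmentation ideal is generated, as a left ideal, by the elements `xᵢ - 1` for every
finite family of topological generators. -/
theorem CGA.exists_eq_sum {ι : Type*} [Fintype ι] {x : ι → G} (hx : IsTopGen x) {f : CGA G}
    (hf : f ∈ augIdeal G) : ∃ a : ι → CGA G, f = ∑ i, a i * (toCGA G (x i) - 1) := by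
  classical
  -- The solutions at level `N`. These sets are finite because `G/N` is, and nonempty by the
  -- statement for discrete groups; a compatible choice is a solution in `E(G)`.
  let T : ∀ N : OpenNormalSubgroup G, Type _ := fun N =>
    {a : ι → MonoidAlgebra (ZMod 2) (G ⧸ N.toSubgroup) //
      CGA.proj G N f = ∑ i, a i * (CGA.proj G N (toCGA G (x i) - 1))}
  let F : OpenNormalSubgroup G ⥤ Type _ :=
    { obj := T
      map := fun {N M} h => TypeCat.ofHom fun a => ⟨fun i => CGA.trans (leOfHom h) (a.1 i), by
          have := congrArg (CGA.trans (leOfHom h)) a.2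
          simpa only [CGA.trans_proj, map_sum, map_mul] using this⟩
      map_id := fun N => by
        ext a i q
        exact congrArg (fun t => t.coeff q) (CGA.trans_self (le_refl _) (a.1 i))
      map_comp := fun f g => by
        ext a i q
        exact congrArg (fun t => t.coeff q)
          (CGA.trans_trans (leOfHom f) (leOfHom g) (a.1 i)).symm }
  have hfin : ∀ N, Finite (F.obj N) := fun N => by
    have := (hx N).1
    have := Fintype.ofFinite (G ⧸ N.toSubgroup)
    have : Finite (MonoidAlgebra (ZMod 2) (G ⧸ N.toSubgroup)) :=
      Finite.of_equiv _ MonoidAlgebra.coeffEquiv.symm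
    exact inferInstanceAs (Finite (T N))
  have hne : ∀ N, Nonempty (F.obj N) := fun N => by
    have h1 := mem_span_sub_one (fun i => ((x i : G) : G ⧸ N.toSubgroup)) (fun q => by
      obtain ⟨g, rfl⟩ := QuotientGroup.mk_surjective q
      obtain ⟨h, hh, hgh⟩ := (hx N).2 g
      rw [QuotientGroup.eq.2 hgh]
      have := Subgroup.mem_map_of_mem (QuotientGroup.mk' N.toSubgroup) hh
      rw [MonoidHom.map_closure, ← Set.range_comp] at this
      exact this) (CGA.proj G N f) (mem_augIdeal.1 hf N)
    obtain ⟨c, hc⟩ := (Submodule.mem_span_range_iff_exists_fun _).1 h1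
    exact ⟨⟨c, by rw [← hc]; rfl⟩⟩
  obtain ⟨s, hs⟩ := nonempty_sections_of_finite_cofiltered_system F
  refine ⟨fun i => ⟨fun N => (s N).1 i, fun N M h => ?_⟩, ?_⟩
  · have := hs (homOfLE h : N ⟶ M)
    exact congrFun (congrArg Subtype.val this) i
  · refine Subtype.ext (funext fun N => (s N).2.trans ?_)
    change _ = CGA.proj G N (∑ i, _ * _)
    rw [map_sum]
    rfl

end CGA

/-! ### Graded algebras generated in degree one -/

section Generated

variable {d : ℕ} {A : Type*} [Ring A] [Algebra (ZMod 2) A]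

/-- The evaluation of a noncommutative polynomial. -/
abbrev evalAt (y : Fin (d + 1) → A) : NCPoly d →ₐ[ZMod 2] A := FreeAlgebra.lift (ZMod 2) y

theorem mem_powSub_one {I : Ideal A} {a : A} : a ∈ powSub I 1 ↔ a ∈ I := by
  change a ∈ I ^ 1 ↔ _
  rw [Submodule.pow_one]

variable (I : Ideal A) [I.IsTwoSided] {y : Fin (d + 1) → A} (hy : ∀ i, y i ∈ powSub I 1)

/-- The homomorphism from the free algebra to the graded algebra of the powers of `I` which sends
`Xᵢ` to the class of `yᵢ`. -/
def grEval : NCPoly d →ₐ[ZMod 2] ⨁ n, GrPiece I n :=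
  FreeAlgebra.lift (ZMod 2) fun i => DirectSum.of (GrPiece I) 1 (grMk I (y i) (hy i))

theorem grEval_var (i : Fin (d + 1)) :
    grEval I hy (var i) = DirectSum.of (GrPiece I) 1 (grMk I (y i) (hy i)) :=
  FreeAlgebra.lift_ι_apply _ _

theorem of_grMk_mul (I : Ideal A) [I.IsTwoSided] {m n : ℕ} {a b : A} (ha : a ∈ powSub I m)
    (hb : b ∈ powSub I n) : DirectSum.of (GrPiece I) m (grMk I a ha) *
      DirectSum.of (GrPiece I) n (grMk I b hb) =
        DirectSum.of (GrPiece I) (m + n) (grMk I (a * b) (mul_mem_powSub I ha hb)) :=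
  DirectSum.of_mul_of _ _

/-- Passes between the graded algebra and computations in `A`: the vanishing of the class of a
homogeneous `p` means that its value at `y` falls into the next power of `I`. -/
theorem grEval_of_mem {n : ℕ} {p : NCPoly d} (hp : p ∈ ncHomogeneous d n) :
    ∃ h : evalAt y p ∈ powSub I n,
      grEval I hy p = DirectSum.of (GrPiece I) n (grMk I (evalAt y p) h) := by
  have hlin : ∀ m ∈ Submodule.span (ZMod 2) (Set.range (var (d := d))),
      ∃ h : evalAt y m ∈ powSub I 1,
        grEval I hy m = DirectSum.of (GrPiece I) 1 (grMk I (evalAt y m) h) := fun m hm => by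
    induction hm using Submodule.span_induction with
    | mem m hm =>
      obtain ⟨i, rfl⟩ := hm
      have e : evalAt y (var i) = y i := FreeAlgebra.lift_ι_apply _ _
      exact ⟨e ▸ hy i, by rw [grEval_var]; congr 2; exact e.symm⟩
    | zero => exact ⟨by rw [map_zero]; exact zero_mem _, by
        rw [map_zero, ← map_zero (DirectSum.of (GrPiece I) 1)]
        congr 1
        rw [← grMk_zero]
        congr 1
        rw [map_zero]⟩
    | add a b _ _ iha ihb =>
      obtain ⟨ha, ea⟩ := iha
      obtain ⟨hb, eb⟩ := ihb
      refine ⟨by rw [map_add]; exact add_mem ha hb, ?_⟩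
      rw [map_add, ea, eb, ← map_add, grMk_add]
      congr 2
      rw [map_add]
    | smul r a _ iha =>
      obtain ⟨ha, ea⟩ := iha
      refine ⟨by rw [map_smul]; exact Submodule.smul_mem _ r ha, ?_⟩
      rw [map_smul, ea, ← DirectSum.lof_eq_of (ZMod 2), ← map_smul, DirectSum.lof_eq_of]
      congr 1
      refine (grMk_eq_iff (ha := Submodule.smul_mem _ r ha) I).2 ?_
      rw [map_smul, sub_self]
      exact zero_mem _
  induction hp using Submodule.pow_induction_on_right' with
  | algebraMap r =>
    refine ⟨mem_powSub_zero I _, ?_⟩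
    rw [AlgHom.commutes, DirectSum.algebraMap_apply]
    congr 1
    refine (grMk_eq_iff (ha := mem_powSub_zero I _) I).2 ?_
    rw [AlgHom.commutes, sub_self]
    exact zero_mem _
  | add a b i _ _ iha ihb =>
    obtain ⟨ha, ea⟩ := iha
    obtain ⟨hb, eb⟩ := ihb
    refine ⟨by rw [map_add]; exact add_mem ha hb, ?_⟩
    rw [map_add, ea, eb, ← map_add, grMk_add]
    congr 2
    rw [map_add]
  | mul_mem i a _ iha m hm =>
    obtain ⟨ha, ea⟩ := iha
    obtain ⟨hb, eb⟩ := hlin m hm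
    refine ⟨by rw [map_mul]; exact mul_mem_powSub I ha hb, ?_⟩
    rw [map_mul, ea, eb, of_grMk_mul]
    congr 2
    rw [map_mul]

/-- The algebra `A` is generated by the family `y` modulo all the powers of `I`. -/
def IsGenerated (I : Ideal A) (y : Fin (d + 1) → A) : Prop :=
  ∀ n, ∀ a ∈ powSub I n, ∃ p ∈ ncHomogeneous d n, a - evalAt y p ∈ powSub I (n + 1)

variable {I}

theorem IsGenerated.map_ncHomogeneous (hI : IsGenerated I y) (n : ℕ) :
    (ncHomogeneous d n).map (grEval I hy).toLinearMap =
      LinearMap.range (DirectSum.lof (ZMod 2) ℕ (GrPiece I) n) := by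
  apply le_antisymm
  · rintro _ ⟨p, hp, rfl⟩
    obtain ⟨h, e⟩ := grEval_of_mem I hy hp
    exact ⟨_, e.symm⟩
  · rintro _ ⟨x, rfl⟩
    obtain ⟨a, ha, rfl⟩ := exists_grMk I x
    obtain ⟨p, hp, hap⟩ := hI n a ha
    obtain ⟨h, e⟩ := grEval_of_mem I hy hp
    refine ⟨p, hp, e.trans ?_⟩
    rw [DirectSum.lof_eq_of]
    congr 1
    exact ((grMk_eq_iff I).2 hap).symm

theorem IsGenerated.grEval_surjective (hI : IsGenerated I y) :
    Function.Surjective (grEval I hy) := by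
  intro x
  induction x using DirectSum.induction_on with
  | zero => exact ⟨0, map_zero _⟩
  | of n x =>
    have h : DirectSum.of (GrPiece I) n x ∈
        LinearMap.range (DirectSum.lof (ZMod 2) ℕ (GrPiece I) n) := ⟨x, rfl⟩
    rw [← hI.map_ncHomogeneous hy n] at h
    obtain ⟨p, -, hp⟩ := h
    exact ⟨p, hp⟩
  | add x y hx hy =>
    obtain ⟨p, rfl⟩ := hx
    obtain ⟨q, rfl⟩ := hy
    exact ⟨p + q, map_add _ _ _⟩

end Generated

/-! ### Generation of the completed group algebra modulo powers of its augmentation ideal -/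

section CGAGenerated

variable {d : ℕ} {G : Type*} [Group G] [TopologicalSpace G]

theorem var_mem_ncHomogeneous (i : Fin (d + 1)) : var i ∈ ncHomogeneous d 1 := by
  rw [ncHomogeneous, pow_one]
  exact Submodule.subset_span ⟨i, rfl⟩

theorem mul_mem_ncHomogeneous {m n : ℕ} {a b : NCPoly d} (ha : a ∈ ncHomogeneous d m)
    (hb : b ∈ ncHomogeneous d n) : a * b ∈ ncHomogeneous d (m + n) := by
  rw [ncHomogeneous, pow_add]
  exact Submodule.mul_mem_mul ha hb

/-- An element of `I^(n+1)` is a sum of products `g h` with `g` in `I` and `h` in `I^n`. Write `g`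
as a left combination of the `x_i - 1` and approximate `h` by induction. Modulo higher terms the
coefficients may be replaced by their augmentations. -/
theorem IsTopGen.isGenerated {x : Fin (d + 1) → G} (hx : IsTopGen x) :
    IsGenerated (augIdeal G) fun i => toCGA G (x i) - 1 := by
  set y : Fin (d + 1) → CGA G := fun i => toCGA G (x i) - 1
  have hy : ∀ i, y i ∈ powSub (augIdeal G) 1 := fun i => toCGA_sub_one_mem _
  intro n
  induction n with
  | zero =>
    intro a _
    refine ⟨algebraMap _ _ (CGA.aug G a), ?_, ?_⟩
    · rw [ncHomogeneous, pow_zero]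
      exact Submodule.algebraMap_mem _
    · rw [AlgHom.commutes]
      exact mem_powSub_one.2 (CGA.sub_aug_mem a)
  | succ n ih =>
    intro a ha
    change a ∈ augIdeal G ^ (n + 1) at ha
    rw [Ideal.IsTwoSided.pow_succ] at ha
    induction ha using Submodule.smul_induction_on' with
    | smul g hg h hh =>
      obtain ⟨c, rfl⟩ := CGA.exists_eq_sum hx hg
      obtain ⟨p, hp, hhp⟩ := ih h hh
      refine ⟨∑ i, CGA.aug G (c i) • (var i * p), Submodule.sum_mem _ fun i _ =>
        Submodule.smul_mem _ _ ?_, ?_⟩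
      · rw [add_comm n 1]
        exact mul_mem_ncHomogeneous (var_mem_ncHomogeneous i) hp
      · rw [smul_eq_mul, map_sum, Finset.sum_mul, ← Finset.sum_sub_distrib]
        refine Submodule.sum_mem _ fun i _ => ?_
        have e1 : evalAt y (var i) = y i := FreeAlgebra.lift_ι_apply _ _
        rw [map_smul, map_mul, e1, Algebra.smul_def]
        set r := algebraMap (ZMod 2) (CGA G) (CGA.aug G (c i))
        -- Two errors, both in degree `n + 2`: replacing the coefficient by the scalar `r`, and
        -- replacing `h` by its polynomial approximation.
        have e : c i * (toCGA G (x i) - 1) * h - r * (y i * evalAt y p) =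
            (c i - r) * (y i * h) + r * (y i * (h - evalAt y p)) := by
          change c i * y i * h - _ = _
          noncomm_ring
        rw [e]
        have h1 : c i - r ∈ powSub (augIdeal G) 1 := mem_powSub_one.2 (CGA.sub_aug_mem _)
        refine add_mem ?_ (mul_mem_powSub_left _ ?_)
        · have := mul_mem_powSub _ h1 (mul_mem_powSub _ (hy i) (show h ∈ powSub _ n from hh))
          rwa [show 1 + (1 + n) = n + 1 + 1 by omega] at this
        · have := mul_mem_powSub _ (hy i) hhp
          rwa [show 1 + (n + 1) = n + 1 + 1 by omega] at this
    | add a _ b _ iha ihb =>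
      obtain ⟨p, hp, hap⟩ := iha
      obtain ⟨q, hq, hbq⟩ := ihb
      refine ⟨p + q, add_mem hp hq, ?_⟩
      rw [map_add, add_sub_add_comm]
      exact add_mem hap hbq

end CGAGenerated

end

end DeltaRAAG

namespace DeltaRAAG

noncomputable section

/-! ### The relations hold in the graded algebra of a Δ-RAAG -/

section Relations

theorem two_eq_zero_of_algebra (R : Type*) [Ring R] [Algebra (ZMod 2) R] : (2 : R) = 0 := by
  have h0 := (algebraMap (ZMod 2) R).map_zero
  rwa [show (0 : ZMod 2) = 2 from rfl, map_ofNat] at h0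

theorem neg_eq_self_of_algebra {R : Type*} [Ring R] [Algebra (ZMod 2) R] (a : R) : -a = a := by
  rw [neg_eq_iff_add_eq_zero, ← two_mul, two_eq_zero_of_algebra, zero_mul]

/-- The homomorphism to the units of the dual numbers attached to a character. -/
def dualHom : Multiplicative (ZMod 2) →* DualNumber (ZMod 2) where
  toFun a := 1 + TrivSqZeroExt.inr a.toAdd
  map_one' := by simp
  map_mul' a b := by
    ext <;> simp [add_comm]

/-- The linear part of `g - 1` has as coefficients the augmentations in an expression `g - 1 = ∑ a_i
(x_i - 1)`. A character `χ` reads them off through `g ↦ 1 + χ(g) ε`, which extends to a homomorphism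
from `E(G)` to the dual numbers. -/
theorem exists_character_eq_sum {d : ℕ} {G : Type*} [Group G] [TopologicalSpace G]
    {x : Fin (d + 1) → G} (hx : IsTopGen x) (g : G) : ∃ r : Fin (d + 1) → ZMod 2,
      toCGA G g - 1 - ∑ i, r i • (toCGA G (x i) - 1) ∈ powSub (augIdeal G) 2 ∧
      ∀ χ : G →* Multiplicative (ZMod 2), IsOpen (χ.ker : Set G) →
        (χ g).toAdd = ∑ i, r i * (χ (x i)).toAdd := by
  obtain ⟨a, ha⟩ := CGA.exists_eq_sum hx (mem_powSub_one.1 (toCGA_sub_one_mem g))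
  refine ⟨fun i => CGA.aug G (a i), ?_, fun χ hχ => ?_⟩
  · rw [ha, ← Finset.sum_sub_distrib]
    refine Submodule.sum_mem _ fun i _ => ?_
    rw [Algebra.smul_def, ← sub_mul]
    exact mul_mem_powSub _ (mem_powSub_one.2 (CGA.sub_aug_mem _)) (toCGA_sub_one_mem _)
  · let N : OpenNormalSubgroup G := ⟨⟨χ.ker, hχ⟩, inferInstanceAs χ.ker.Normal⟩
    have hN : N.toSubgroup ≤ (dualHom.comp χ).ker := fun h hh => by
      have : χ h = 1 := hh
      rw [MonoidHom.mem_ker, MonoidHom.comp_apply, this, map_one]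
    let D := CGA.lift (dualHom.comp χ) N hN
    have hD : ∀ h, D (toCGA G h) = 1 + TrivSqZeroExt.inr (χ h).toAdd := fun h =>
      CGA.lift_toCGA _ _ _ h
    have hfst : ∀ f : CGA G, (D f).fst = CGA.aug G f := fun f => by
      have h1 : D (f - algebraMap _ _ (CGA.aug G f)) ∈
          LinearMap.ker (TrivSqZeroExt.fstHom (ZMod 2) (ZMod 2) (ZMod 2)).toLinearMap := by
        refine CGA.lift_mem _ N hN _ (fun h => ?_) (CGA.sub_aug_mem f)
        change TrivSqZeroExt.fst (dualHom (χ h) - 1) = 0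
        simp [dualHom]
      rw [map_sub, AlgHom.commutes] at h1
      have h2 : TrivSqZeroExt.fst (D f - algebraMap (ZMod 2) (DualNumber (ZMod 2))
        (CGA.aug G f)) = 0 := h1
      rw [TrivSqZeroExt.fst_sub, sub_eq_zero] at h2
      exact h2
    have h := congrArg D ha
    rw [map_sub, map_one, hD, map_sum] at h
    have h' := congrArg TrivSqZeroExt.snd h
    rw [TrivSqZeroExt.snd_sum] at h'
    simpa [hD, hfst, mul_comm] using h'

variable {d : ℕ} {Γ : SimpleGraph (Fin d)} {z : Fin d → RAAG Γ}
  {δ : Delta →* MulAut (RAAG Γ)}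

theorem RAAG.isOpen_coord_ker (i : Fin d) : IsOpen ((RAAG.coord Γ i).ker : Set (RAAG Γ)) := by
  rw [RAAG.isOpen_iff]
  refine Subgroup.isOpen_mono (H₁ := (FreeProTwo.proj (Fin d) (kerTwo (FreeGroup.lift
    fun j => Multiplicative.ofAdd (if j = i then (1 : ZMod 2) else 0)))).ker)
    (H₂ := ((RAAG.coord Γ i).comp (RAAG.mk Γ)).ker) ?_ (FreeProTwo.isOpen_proj_ker _)
  intro x hx
  rw [MonoidHom.mem_ker] at hx ⊢
  exact (congrArg (QuotientGroup.kerLift (FreeGroup.lift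
    fun j => Multiplicative.ofAdd (if j = i then (1 : ZMod 2) else 0))) hx).trans (map_one _)

/-- On generators the action is an inversion followed by a conjugation, and both are invisible in
`ℤ/2`. This is what extends the coordinates to characters of `G_z`. -/
theorem IsDeltaAction.coord_apply (hδ : IsDeltaAction Γ z δ) (i : Fin d) (s : Delta)
    (g : RAAG Γ) : RAAG.coord Γ i (δ s g) = RAAG.coord Γ i g := by
  obtain rfl | rfl := Delta.eq_one_or s
  · simp
  have htop : (MonoidHom.eqLocus ((RAAG.coord Γ i).comp (δ Delta.x₀).toMonoidHom)
      (RAAG.coord Γ i)) = ⊤ := by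
    refine RAAG.eq_top_of_isOpen (N := (RAAG.coord Γ i).ker.comap (δ Delta.x₀).toMonoidHom ⊓
      (RAAG.coord Γ i).ker) (IsOpen.inter ((RAAG.isOpen_coord_ker i).preimage
        (hδ.continuous Delta.x₀)) (RAAG.isOpen_coord_ker i)) ?_ ?_
    · rintro g ⟨h1, h2⟩
      exact Eq.trans h1 (Eq.symm h2)
    · intro j
      change RAAG.coord Γ i (δ Delta.x₀ (RAAG.gen Γ j)) = RAAG.coord Γ i (RAAG.gen Γ j)
      rw [hδ.apply_gen, map_mul, map_mul, mul_comm, map_inv, mul_inv_cancel_left, map_inv]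
      generalize RAAG.coord Γ i (RAAG.gen Γ j) = c
      revert c
      decide
  have : g ∈ MonoidHom.eqLocus ((RAAG.coord Γ i).comp (δ Delta.x₀).toMonoidHom)
      (RAAG.coord Γ i) := htop ▸ Subgroup.mem_top g
  exact this

/-- The coordinate characters on `G_z`. -/
def IsDeltaAction.coordHom (hδ : IsDeltaAction Γ z δ) (i : Fin d) :
    GZ δ →* Multiplicative (ZMod 2) :=
  MonoidHom.mk' (fun g => RAAG.coord Γ i g.left) fun g h => by
    rw [SemidirectProduct.mul_left, map_mul, hδ.coord_apply]

variable (δ) in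
/-- The generators `yᵢ = xᵢ - 1` of the augmentation ideal of `E(G_z)`. -/
def genSub (i : Fin (d + 1)) : CGA (GZ δ) := toCGA (GZ δ) (deltaGen δ i) - 1

theorem genSub_mem (i : Fin (d + 1)) : genSub δ i ∈ powSub (augIdeal (GZ δ)) 1 :=
  toCGA_sub_one_mem _

theorem evalAt_genSub_var (i : Fin (d + 1)) : evalAt (genSub δ) (var i) = genSub δ i :=
  FreeAlgebra.lift_ι_apply _ _

variable (δ) in
theorem isGenerated_genSub : IsGenerated (augIdeal (GZ δ)) (genSub δ) :=
  (GZ.isTopGen δ).isGenerated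

/-- The projection to `Δ` shows that `x_0` does not occur in the linear part, and the coordinate
characters identify the remaining coefficients with those of `epsilon g`. -/
theorem IsDeltaAction.sub_epsilon_mem (hδ : IsDeltaAction Γ z δ) (g : RAAG Γ) :
    toCGA (GZ δ) (SemidirectProduct.inl g) - 1 - evalAt (genSub δ) (epsilon g) ∈
      powSub (augIdeal (GZ δ)) 2 := by
  obtain ⟨r, hr, hχ⟩ := exists_character_eq_sum (GZ.isTopGen δ) (SemidirectProduct.inl g)
  have h0 : r 0 = 0 := by
    have := hχ SemidirectProduct.rightHom (GZ.isOpen_right_preimage δ {1})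
    rw [Fin.sum_univ_succ] at this
    simpa [deltaGen, Delta.x₀] using this.symm
  have hs : ∀ i, r i.succ = (RAAG.coord Γ i g).toAdd := fun i => by
    have := hχ (hδ.coordHom i) ((RAAG.isOpen_coord_ker i).preimage (GZ.continuous_left δ))
    rw [Fin.sum_univ_succ, h0, zero_mul, zero_add, Finset.sum_eq_single i] at this
    · have e := RAAG.coord_gen Γ i i
      simpa [IsDeltaAction.coordHom, deltaGen, e] using this.symm
    · intro j _ hj
      have e := RAAG.coord_gen Γ i j
      simp [IsDeltaAction.coordHom, deltaGen, e, hj]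
    · simp
  convert hr using 2
  rw [Fin.sum_univ_succ, h0, zero_smul, zero_add, epsilon, map_sum]
  refine Finset.sum_congr rfl fun i _ => ?_
  rw [map_smul, evalAt_genSub_var, hs]
  rfl

theorem lie_eq (a b : NCPoly d) : ⁅a, b⁆ = a * b - b * a := rfl

theorem epsilon_mem (g : RAAG Γ) : epsilon g ∈ ncHomogeneous d 1 :=
  Submodule.sum_mem _ fun _ _ => Submodule.smul_mem _ _ (var_mem_ncHomogeneous _)

theorem IsRelator.mem_ncHomogeneous {r : NCPoly d} (h : IsRelator z r) :
    r ∈ ncHomogeneous d 2 := by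
  have hm : ∀ {a b : NCPoly d}, a ∈ ncHomogeneous d 1 → b ∈ ncHomogeneous d 1 →
      a * b ∈ ncHomogeneous d 2 := fun ha hb => mul_mem_ncHomogeneous ha hb
  have hv := var_mem_ncHomogeneous (d := d)
  cases h with
  | sq_zero => exact hm (hv 0) (hv 0)
  | edge u v h => exact sub_mem (hm (hv _) (hv _)) (hm (hv _) (hv _))
  | vertex k =>
    exact add_mem (add_mem (sub_mem (hm (hv _) (hv _)) (hm (hv _) (hv _)))
      (sub_mem (hm (hv _) (epsilon_mem _)) (hm (epsilon_mem _) (hv _)))) (hm (hv _) (hv _))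

theorem genSub_zero_mul_self : genSub δ 0 * genSub δ 0 = 0 := by
  rw [genSub, ← ident_sq _ (two_eq_zero_of_algebra _), ← map_pow]
  have : (deltaGen δ 0) ^ 2 = 1 := by
    change (SemidirectProduct.inr Delta.x₀ : GZ δ) ^ 2 = 1
    rw [← map_pow, show Delta.x₀ ^ 2 = 1 by decide, map_one]
  rw [this, map_one, sub_self]

theorem genSub_commute {u v : Fin d} (h : Γ.Adj u v) :
    genSub δ u.succ * genSub δ v.succ = genSub δ v.succ * genSub δ u.succ := by
  rw [← sub_eq_zero, genSub, genSub, ident_comm, ← map_mul, ← map_mul, sub_eq_zero]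
  congr 1
  change (SemidirectProduct.inl (RAAG.gen Γ u) : GZ δ) * SemidirectProduct.inl (RAAG.gen Γ v) =
    SemidirectProduct.inl (RAAG.gen Γ v) * SemidirectProduct.inl (RAAG.gen Γ u)
  rw [← map_mul, RAAG.gen_commute h, map_mul]

/-- The first two kinds of relators vanish exactly. For a vertex, the relation `x_0 x x_0⁻¹ = z⁻¹
x⁻¹ z` is expanded up to terms of degree three. -/
theorem IsRelator.evalAt_mem (hδ : IsDeltaAction Γ z δ) {r : NCPoly d} (h : IsRelator z r) :
    evalAt (genSub δ) r ∈ powSub (augIdeal (GZ δ)) 3 := by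
  cases h with
  | sq_zero =>
    rw [map_mul, evalAt_genSub_var, genSub_zero_mul_self]
    exact zero_mem _
  | edge u v h =>
    rw [lie_eq, map_sub, map_mul, map_mul, evalAt_genSub_var, evalAt_genSub_var,
      genSub_commute h, sub_self]
    exact zero_mem _
  | vertex k =>
    rw [lie_eq, lie_eq]
    simp only [map_add, map_sub, map_mul, evalAt_genSub_var]
    set e := evalAt (genSub δ) (epsilon (z k))
    set y := genSub δ k.succ with hy
    set g : GZ δ := SemidirectProduct.inl (z k) with hg
    set x : GZ δ := deltaGen δ k.succ with hx
    set x0 : GZ δ := deltaGen δ 0 with hx0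
    -- The conjugate of `x⁻¹` by `z_k` is written as a commutator times `x⁻¹`. The commutator
    -- produces the term with `ε_k`, the inverse produces the square.
    have hxz : x0 * x = (g⁻¹ * x⁻¹ * g * x) * x⁻¹ * x0 := by
      have h1 : (SemidirectProduct.inl (δ Delta.x₀ (RAAG.gen Γ k)) : GZ δ) = x0 * x * x0⁻¹ := by
        rw [SemidirectProduct.inl_aut, map_inv]
        rfl
      rw [hδ.apply_gen, map_mul, map_mul, map_inv, map_inv] at h1
      change g⁻¹ * x⁻¹ * g = x0 * x * x0⁻¹ at h1
      rw [mul_assoc (g⁻¹ * x⁻¹ * g), mul_inv_cancel, mul_one, h1, inv_mul_cancel_right]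
    have h1 := mem_powSub_one.1 (toCGA_sub_one_mem g)
    have hc := commutator_congr (mem_zassenhaus_one g) (mem_zassenhaus_one x)
    have hz := hδ.sub_epsilon_mem (z k)
    change toCGA _ g - 1 - e ∈ _ at hz
    have hyx : toCGA _ x - 1 = y := rfl
    rw [hyx] at hc
    set c := toCGA (GZ δ) (g⁻¹ * x⁻¹ * g * x) - 1 with hcdef
    set w := toCGA (GZ δ) g - 1
    have hcm : c ∈ powSub (augIdeal (GZ δ)) 2 :=
      commutator_mem_zassenhaus (mem_zassenhaus_one g) (mem_zassenhaus_one x)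
    have hy1 : y ∈ powSub (augIdeal (GZ δ)) 1 := genSub_mem _
    have hyy : y * y ∈ powSub (augIdeal (GZ δ)) 2 := mul_mem_powSub _ hy1 hy1
    have hx1 : toCGA (GZ δ) x * toCGA (GZ δ) x⁻¹ = 1 := by rw [← map_mul, mul_inv_cancel, map_one]
    have hx2 : toCGA (GZ δ) x⁻¹ * toCGA (GZ δ) x = 1 := by rw [← map_mul, inv_mul_cancel, map_one]
    have e1 : genSub δ 0 * y - y * genSub δ 0 =
        toCGA _ x0 * toCGA _ x - toCGA _ x * toCGA _ x0 := ident_comm _ _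
    have e2 : genSub δ 0 * y - y * genSub δ 0 =
        (c * toCGA _ x⁻¹ + toCGA _ x⁻¹ * (y * y)) * toCGA _ x0 := by
      rw [e1, ← map_mul, hxz, map_mul, map_mul, ← sub_mul]
      congr 1
      have e3 : toCGA (GZ δ) (g⁻¹ * x⁻¹ * g * x) = c + 1 := by rw [hcdef]; abel
      have e4 : toCGA (GZ δ) x⁻¹ * (y * y) = toCGA _ x - toCGA _ x⁻¹ := by
        rw [← hyx, ← ident_sq _ (two_eq_zero_of_algebra _), mul_sub, mul_one, pow_two,
          ← mul_assoc, hx2, one_mul]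
      rw [e3, e4, add_mul, one_mul]
      have := neg_eq_self_of_algebra (toCGA (GZ δ) x⁻¹ - toCGA (GZ δ) x)
      rw [neg_sub] at this
      rw [this]
      abel
    -- To leading order the bracket with `x_0 - 1` is `c + y²`. The commutator part `c` agrees with
    -- `[w, y]`, hence with `[e, y]`, modulo degree three, and the two squares cancel in
    -- characteristic two; every other summand has a factor of degree two and one of degree one.
    have key : genSub δ 0 * y - y * genSub δ 0 + (y * e - e * y) + y * y =
        (c - (w * y - y * w)) + ((w - e) * y - y * (w - e)) + (y * y + y * y) +
        (c * (toCGA _ x⁻¹ - 1)) * toCGA _ x0 + c * (toCGA _ x0 - 1) +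
        ((toCGA _ x⁻¹ - 1) * (y * y)) * toCGA _ x0 + (y * y) * (toCGA _ x0 - 1) := by
      rw [e2]
      noncomm_ring
    rw [key]
    have hxi : toCGA (GZ δ) x⁻¹ - 1 ∈ powSub (augIdeal (GZ δ)) 1 := toCGA_sub_one_mem _
    have hx0i : toCGA (GZ δ) x0 - 1 ∈ powSub (augIdeal (GZ δ)) 1 := toCGA_sub_one_mem _
    refine add_mem (add_mem (add_mem (add_mem (add_mem (add_mem hc ?_) ?_) ?_) ?_) ?_) ?_
    · exact bracket_mem hz hy1
    · rw [← two_mul, two_eq_zero_of_algebra, zero_mul]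
      exact zero_mem _
    · exact mul_mem_powSub_right _ (mul_mem_powSub _ hcm hxi)
    · exact mul_mem_powSub _ hcm hx0i
    · exact mul_mem_powSub_right _ (mul_mem_powSub (m := 1) (n := 2) _ hxi hyy)
    · exact mul_mem_powSub _ hyy hx0i

theorem IsRelator.grEval_eq_zero (hδ : IsDeltaAction Γ z δ) {r : NCPoly d} (h : IsRelator z r) :
    grEval (augIdeal (GZ δ)) (genSub_mem (δ := δ)) r = 0 := by
  obtain ⟨h2, e⟩ := grEval_of_mem (augIdeal (GZ δ)) (genSub_mem (δ := δ)) h.mem_ncHomogeneous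
  rw [e, (grMk_eq_iff (hb := zero_mem _) _).2 (by rw [sub_zero]; exact h.evalAt_mem hδ),
    grMk_zero, map_zero]

theorem EZ.mk_surjective : Function.Surjective (EZ.mk z) := Quotient.mk_surjective

theorem EZ.mk_eq_zero_of_isRelator {r : NCPoly d} (h : IsRelator z r) : EZ.mk z r = 0 := by
  have h1 : r ∈ idealI z := TwoSidedIdeal.subset_span h
  have h2 : (idealI z).ringCon r 0 := (TwoSidedIdeal.mem_iff _ _).1 h1
  exact Quotient.sound h2

/-- The universal property of `𝓔_z`. -/
def EZ.lift {B : Type*} [Ring B] [Algebra (ZMod 2) B] (f : NCPoly d →ₐ[ZMod 2] B)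
    (hf : ∀ r, IsRelator z r → f r = 0) : EZ z →ₐ[ZMod 2] B :=
  (idealI z).ringCon.liftₐ f (by
    have h1 : idealI z ≤ TwoSidedIdeal.ker f.toRingHom :=
      TwoSidedIdeal.span_le.2 fun r hr => (TwoSidedIdeal.mem_ker _).2 (hf r hr)
    intro a b hab
    have h2 := h1 ((TwoSidedIdeal.rel_iff _ _ _).1 hab)
    rw [TwoSidedIdeal.mem_ker, map_sub, sub_eq_zero] at h2
    exact h2)

theorem EZ.lift_mk {B : Type*} [Ring B] [Algebra (ZMod 2) B] (f : NCPoly d →ₐ[ZMod 2] B)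
    (hf : ∀ r, IsRelator z r → f r = 0) (p : NCPoly d) : EZ.lift f hf (EZ.mk z p) = f p := rfl

/-- The homomorphism `𝓔_z → 𝓔(G_z)` which sends the class of `Xᵢ` to the class of `xᵢ - 1`. -/
def toGrE (hδ : IsDeltaAction Γ z δ) : EZ z →ₐ[ZMod 2] GrE (GZ δ) :=
  EZ.lift (grEval (augIdeal (GZ δ)) (genSub_mem (δ := δ))) fun _ h => h.grEval_eq_zero hδ

end Relations

end

end DeltaRAAG

namespace DeltaRAAG

noncomputable section

/-! ### The truncated algebra of the trace monoid -/

section Truncated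

variable {d : ℕ} (Γ : SimpleGraph (Fin d))

/-- The algebra of the trace monoid. -/
abbrev TraceAlg : Type := MonoidAlgebra (ZMod 2) (Trace Γ)

/-- The elements of the algebra of the trace monoid without terms of length less than `k`. -/
def lenSub (k : ℕ) : Submodule (ZMod 2) (TraceAlg Γ) :=
  MonoidAlgebra.supported (ZMod 2) (ZMod 2) {w | k ≤ Trace.len w}

variable {Γ}

theorem mem_lenSub {k : ℕ} {f : TraceAlg Γ} :
    f ∈ lenSub Γ k ↔ ∀ w, Trace.len w < k → f.coeff w = 0 := by
  rw [lenSub, MonoidAlgebra.mem_supported']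
  simp

theorem mul_mem_lenSub {a b : ℕ} {f g : TraceAlg Γ} (hf : f ∈ lenSub Γ a)
    (hg : g ∈ lenSub Γ b) : f * g ∈ lenSub Γ (a + b) := by
  classical
  rw [lenSub, MonoidAlgebra.mem_supported] at *
  intro w hw
  obtain ⟨u, hu, v, hv, rfl⟩ := Finset.mem_mul.1 (MonoidAlgebra.support_coeff_mul_subset f g hw)
  have h1 : a ≤ Trace.len u := hf hu
  have h2 : b ≤ Trace.len v := hg hv
  change a + b ≤ Trace.len (u * v)
  rw [Trace.len_mul]
  omega

theorem lenSub_anti {a b : ℕ} (h : a ≤ b) : lenSub Γ b ≤ lenSub Γ a := fun _ hf =>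
  mem_lenSub.2 fun w hw => mem_lenSub.1 hf w (hw.trans_le h)

theorem lenSub_zero (f : TraceAlg Γ) : f ∈ lenSub Γ 0 := mem_lenSub.2 fun _ h => by omega

variable (Γ) in
/-- The ideal of the elements without terms of length less than `m`. -/
def lenIdeal (m : ℕ) : Ideal (TraceAlg Γ) where
  carrier := lenSub Γ m
  add_mem' := add_mem
  zero_mem' := zero_mem _
  smul_mem' c f hf := by
    have := mul_mem_lenSub (lenSub_zero c) hf
    rwa [zero_add] at this

instance (m : ℕ) : (lenIdeal Γ m).IsTwoSided where
  mul_mem_of_left g hf := mul_mem_lenSub hf (lenSub_zero g)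

variable (Γ) in
/-- The algebra of the trace monoid truncated at length `m`. -/
def Trunc (m : ℕ) : Type := TraceAlg Γ ⧸ lenIdeal Γ m

instance (m : ℕ) : Ring (Trunc Γ m) := inferInstanceAs (Ring (TraceAlg Γ ⧸ lenIdeal Γ m))

instance (m : ℕ) : Algebra (ZMod 2) (Trunc Γ m) :=
  inferInstanceAs (Algebra (ZMod 2) (TraceAlg Γ ⧸ lenIdeal Γ m))

variable (Γ) in
/-- The projection to the truncated algebra. -/
def Trunc.mk (m : ℕ) : TraceAlg Γ →ₐ[ZMod 2] Trunc Γ m :=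
  Ideal.Quotient.mkₐ (ZMod 2) (lenIdeal Γ m)

theorem Trunc.mk_surjective (m : ℕ) : Function.Surjective (Trunc.mk Γ m) :=
  Ideal.Quotient.mk_surjective

variable (Γ) in
/-- The filtration by length of the truncated algebra. -/
def filt (m k : ℕ) : Submodule (ZMod 2) (Trunc Γ m) :=
  (lenSub Γ k).map (Trunc.mk Γ m).toLinearMap

theorem Trunc.mk_eq_zero_iff {m : ℕ} {f : TraceAlg Γ} : Trunc.mk Γ m f = 0 ↔ f ∈ lenSub Γ m :=
  Ideal.Quotient.eq_zero_iff_mem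

/-- Truncation discards only terms of length at least `m`, so the conditions on shorter terms
survive. -/
theorem Trunc.mk_mem_filt {m k : ℕ} (h : k ≤ m) {f : TraceAlg Γ} :
    Trunc.mk Γ m f ∈ filt Γ m k ↔ f ∈ lenSub Γ k := by
  constructor
  · rintro ⟨g, hg, hgf⟩
    have h1 : Trunc.mk Γ m (f - g) = 0 := by
      rw [map_sub, sub_eq_zero]; exact hgf.symm
    have h2 := add_mem (lenSub_anti h (Trunc.mk_eq_zero_iff.1 h1)) hg
    rwa [sub_add_cancel] at h2
  · exact fun hf => ⟨f, hf, rfl⟩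

theorem mul_mem_filt {m a b : ℕ} {f g : Trunc Γ m} (hf : f ∈ filt Γ m a)
    (hg : g ∈ filt Γ m b) : f * g ∈ filt Γ m (a + b) := by
  obtain ⟨f, hf, rfl⟩ := hf
  obtain ⟨g, hg, rfl⟩ := hg
  exact ⟨f * g, mul_mem_lenSub hf hg, map_mul (Trunc.mk Γ m) f g⟩

theorem filt_anti {m a b : ℕ} (h : a ≤ b) : filt Γ m b ≤ filt Γ m a :=
  Submodule.map_mono (lenSub_anti h)

theorem filt_zero {m : ℕ} (f : Trunc Γ m) : f ∈ filt Γ m 0 := by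
  obtain ⟨f, rfl⟩ := Trunc.mk_surjective m f
  exact ⟨f, lenSub_zero f, rfl⟩

theorem eq_zero_of_mem_filt {m k : ℕ} (h : m ≤ k) {f : Trunc Γ m} (hf : f ∈ filt Γ m k) :
    f = 0 := by
  obtain ⟨f, hf, rfl⟩ := hf
  exact Trunc.mk_eq_zero_iff.2 (lenSub_anti h hf)

theorem finite_len_lt (m : ℕ) : {w : Trace Γ | Trace.len w < m}.Finite := by
  have h : {w : Trace Γ | Trace.len w < m} = ⋃ n ∈ Finset.range m, {w | Trace.len w = n} := by
    ext w; simp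
  rw [h]
  exact (Finset.range m).finite_toSet.biUnion fun n _ =>
    Set.finite_coe_iff.1 (Trace.finite_len n)

instance (m : ℕ) : Finite (Trunc Γ m) := by
  classical
  have hspan : Submodule.span (ZMod 2) ((fun w => Trunc.mk Γ m (MonoidAlgebra.single w 1)) ''
      {w | Trace.len w < m}) = ⊤ := by
    rw [eq_top_iff]
    rintro f -
    obtain ⟨f, rfl⟩ := Trunc.mk_surjective m f
    rw [← f.sum_coeff_single, Finsupp.sum, map_sum]
    refine Submodule.sum_mem _ fun w _ => ?_
    have e : MonoidAlgebra.single w (f.coeff w) =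
        (f.coeff w) • (MonoidAlgebra.single w 1 : TraceAlg Γ) := by
      rw [MonoidAlgebra.smul_single, smul_eq_mul, mul_one]
    by_cases hw : Trace.len w < m
    · rw [e]
      change Trunc.mk Γ m _ ∈ _
      rw [map_smul]
      exact Submodule.smul_mem _ _ (Submodule.subset_span ⟨w, hw, rfl⟩)
    · have : Trunc.mk Γ m (MonoidAlgebra.single w (f.coeff w)) = 0 := by
        rw [Trunc.mk_eq_zero_iff, mem_lenSub]
        intro v hv
        rw [MonoidAlgebra.coeff_single, Finsupp.single_apply, if_neg]
        rintro rfl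
        exact hw hv
      change Trunc.mk Γ m _ ∈ _
      rw [this]
      exact zero_mem _
  have : Module.Finite (ZMod 2) (Trunc Γ m) :=
    ⟨⟨((finite_len_lt m).image _).toFinset, by rw [Set.Finite.coe_toFinset]; exact hspan⟩⟩
  exact Module.finite_of_finite (ZMod 2)

variable (Γ) in
/-- The group of the units congruent to `1` modulo the elements of positive length. -/
def unitGroup (m : ℕ) : Subgroup (Trunc Γ m)ˣ where
  carrier := {u | (u : Trunc Γ m) - 1 ∈ filt Γ m 1}
  one_mem' := by simp
  mul_mem' {u v} hu hv := by
    rw [Set.mem_ofPred_eq] at *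
    rw [Units.val_mul, ident_mul]
    have := mul_mem_filt hu (filt_zero (v : Trunc Γ m))
    exact add_mem this hv
  inv_mem' {u} hu := by
    rw [Set.mem_ofPred_eq] at *
    have e : (u⁻¹ : (Trunc Γ m)ˣ) - (1 : Trunc Γ m) = -((u⁻¹ : (Trunc Γ m)ˣ) * ((u : Trunc Γ m) - 1)) := by
      rw [mul_sub, Units.inv_mul, mul_one, neg_sub]
    rw [e]
    have := mul_mem_filt (filt_zero ((u⁻¹ : (Trunc Γ m)ˣ) : Trunc Γ m)) hu
    rw [zero_add] at this
    exact neg_mem this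

/-- In characteristic two `u² - 1 = (u - 1)²`, so repeated squaring doubles the length of `u - 1`
until it passes `m`. -/
theorem isPGroup_unitGroup (m : ℕ) : IsPGroup 2 (unitGroup Γ m) := by
  rintro ⟨u, hu⟩
  refine ⟨m, Subtype.ext (Units.ext ?_)⟩
  have key : ∀ k : ℕ, ((u : Trunc Γ m) ^ 2 ^ k) - 1 ∈ filt Γ m (2 ^ k) := fun k => by
    induction k with
    | zero => rw [pow_zero, pow_one]; exact hu
    | succ k ih =>
      rw [pow_succ 2 k, pow_mul, ident_sq _ (two_eq_zero_of_algebra _), mul_two]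
      exact mul_mem_filt ih ih
  have h := eq_zero_of_mem_filt (Nat.lt_two_pow_self).le (key m)
  simpa [sub_eq_zero] using h

/-- The letter `i` in the truncated algebra. -/
abbrev Trunc.letter (m : ℕ) (i : Fin d) : Trunc Γ m :=
  Trunc.mk Γ m (MonoidAlgebra.of (ZMod 2) (Trace Γ) (Trace.of Γ i))

theorem letter_mem (m : ℕ) (i : Fin d) : Trunc.letter m i ∈ filt Γ m 1 := by
  classical
  refine ⟨_, mem_lenSub.2 fun w hw => ?_, rfl⟩
  rw [MonoidAlgebra.of_apply, MonoidAlgebra.coeff_single, Finsupp.single_apply, if_neg]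
  rintro rfl
  simp at hw

variable (Γ) in
/-- The Magnus representation of `G_Γ`. -/
theorem exists_magnus (m : ℕ) : ∃ f : RAAG Γ →* Trunc Γ m,
    (∀ i, f (RAAG.gen Γ i) = 1 + Trunc.letter m i) ∧ (∀ g, f g - 1 ∈ filt Γ m 1) ∧
      IsOpen (f.ker : Set (RAAG Γ)) := by
  have hu : ∀ i : Fin d, ∃ u : unitGroup Γ m, (u.1 : Trunc Γ m) = 1 + Trunc.letter m i := fun i => by
    have hnil : IsNilpotent (Trunc.letter (Γ := Γ) m i) := by
      refine ⟨m, eq_zero_of_mem_filt le_rfl ?_⟩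
      have key : ∀ k : ℕ, (Trunc.letter (Γ := Γ) m i) ^ k ∈ filt Γ m k := fun k => by
        induction k with
        | zero => exact filt_zero _
        | succ k ih => rw [pow_succ]; exact mul_mem_filt ih (letter_mem m i)
      exact key m
    obtain ⟨u, hu⟩ := hnil.isUnit_one_add
    refine ⟨⟨u, ?_⟩, hu⟩
    change (u : Trunc Γ m) - 1 ∈ filt Γ m 1
    rw [hu, add_sub_cancel_left]
    exact letter_mem m i
  choose u hu using hu
  -- The units form a finite 2-group and adjacent letters commute, which is exactly what the
  -- universal property of `G_Γ` asks for.
  obtain ⟨f, hf, ho⟩ := RAAG.exists_lift (Γ := Γ) (isPGroup_unitGroup m) u (fun i j hij => by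
    refine Subtype.ext (Units.ext ?_)
    change (u i).1.1 * (u j).1.1 = (u j).1.1 * (u i).1.1
    have e : (Trunc.letter (Γ := Γ) m i) * Trunc.letter m j =
        Trunc.letter m j * Trunc.letter m i := by
      rw [← map_mul, ← map_mul, Trace.of_mul_of hij, map_mul, map_mul]
    rw [hu, hu]
    exact (Commute.one_left _).add_left ((Commute.one_right _).add_right e))
  refine ⟨(Units.coeHom _).comp ((unitGroup Γ m).subtype.comp f), fun i => ?_, fun g => (f g).2, ?_⟩
  · change ((f (RAAG.gen Γ i)).1 : Trunc Γ m) = _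
    rw [hf, hu]
  · convert ho using 2
    ext g
    change ((f g).1 : Trunc Γ m) = 1 ↔ f g = 1
    rw [Units.val_eq_one, OneMemClass.coe_eq_one]

end Truncated

/-! ### A filtered representation of a Δ-RAAG by matrices -/

section Representation

variable {d : ℕ} {Γ : SimpleGraph (Fin d)} {m : ℕ}

theorem conj_sub_identity {R : Type*} [Ring R] [Algebra (ZMod 2) R] (a b : R) :
    a * b * a - b = (a - 1) * (a - 1) + (a - 1) * (b - 1) + (b - 1) * (a - 1) +
      (a - 1) * (b - 1) * (a - 1) := by
  have h : a * b * a - b = ((a - 1) + (a - 1)) + ((a - 1) * (a - 1) + (a - 1) * (b - 1) +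
      (b - 1) * (a - 1) + (a - 1) * (b - 1) * (a - 1)) := by noncomm_ring
  rw [h, ← two_mul, two_eq_zero_of_algebra, zero_mul, zero_add]

theorem mul_sub_mul_identity {R : Type*} [Ring R] (a b a' b' : R) :
    a' * b' - a * b = a' * (b' - b) + (a' - a) * b := by
  noncomm_ring

theorem mul_sub_one_identity {R : Type*} [Ring R] (a b : R) :
    a * b - 1 = (a - 1) * (b - 1) + (a - 1) + (b - 1) := by
  noncomm_ring

/-- The induced representation has `diag(a, b)` on `G_Γ` and the swap for `x_0`. Conjugation by the
lower unitriangular matrix with entry `1` turns these, in characteristic two, into the matrices used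
here. In this basis the image of `x_0` is upper unipotent. -/
theorem shear_mul_identity {R : Type*} [Ring R] [Algebra (ZMod 2) R] (a b : R) :
    !![1, 1; 0, 1] * !![a, 0; b - a, b] = !![b, 0; a - b, a] * !![(1 : R), 1; 0, 1] := by
  have h : a - b + a = b := by rw [← neg_sub, neg_eq_self_of_algebra, sub_add_cancel]
  have h' : b - a = a - b := by rw [← neg_sub, neg_eq_self_of_algebra]
  rw [Matrix.mul_fin_two, Matrix.mul_fin_two]
  simp only [one_mul, mul_one, zero_mul, mul_zero, add_zero, zero_add,
    add_sub_cancel, h]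
  rw [h']

theorem shear_mul_self {R : Type*} [Ring R] [Algebra (ZMod 2) R] :
    !![1, 1; 0, 1] * !![(1 : R), 1; 0, 1] = 1 := by
  rw [Matrix.mul_fin_two, Matrix.one_fin_two]
  simp [one_add_one_eq_two, two_eq_zero_of_algebra R]

theorem lower_mul_lower {R : Type*} [Ring R] (a b a' b' : R) :
    !![a, 0; b - a, b] * !![a', 0; b' - a', b'] = !![a * a', 0; b * b' - a * a', b * b'] := by
  rw [Matrix.mul_fin_two]
  simp only [mul_zero, zero_mul, add_zero, mul_sub_mul_identity a a' b b', add_comm]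

theorem conj_inv_sub_identity {R : Type*} [Ring R] {a a' b b' : R} (ha : a' * a = 1)
    (hb : b' * b = 1) : b' * a' * b - a = -(b' * (a' * (a * b * a - b))) := by
  have h : a' * (a * b * a - b) = b * a - a' * b := by
    rw [mul_sub, ← mul_assoc, ← mul_assoc, ha, one_mul]
  rw [h, mul_sub, ← mul_assoc, hb, one_mul, mul_assoc, neg_sub]

theorem inv_sub_inv_identity {R : Type*} [Ring R] {a a' b b' : R} (ha : a' * a = 1)
    (hb : b * b' = 1) : a' - b' = -(a' * (a - b) * b') := by
  rw [mul_sub, ha, sub_mul, one_mul, mul_assoc, hb, mul_one, neg_sub]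

theorem conj_sub_mem {a b : Trunc Γ m} (ha : a - 1 ∈ filt Γ m 1) (hb : b - 1 ∈ filt Γ m 1) :
    a * b * a - b ∈ filt Γ m 2 := by
  rw [conj_sub_identity]
  refine add_mem (add_mem (add_mem ?_ ?_) ?_) (filt_anti (show 2 ≤ 1 + 1 + 1 by omega) ?_)
  · exact mul_mem_filt (a := 1) (b := 1) ha ha
  · exact mul_mem_filt (a := 1) (b := 1) ha hb
  · exact mul_mem_filt (a := 1) (b := 1) hb ha
  · exact mul_mem_filt (a := 1 + 1) (b := 1) (mul_mem_filt (a := 1) (b := 1) ha hb) ha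

theorem mul_mem_filt_right {n : ℕ} {a : Trunc Γ m} (ha : a ∈ filt Γ m n) (b : Trunc Γ m) :
    a * b ∈ filt Γ m n :=
  mul_mem_filt (a := n) (b := 0) ha (filt_zero b)

theorem mul_mem_filt_left (a : Trunc Γ m) {n : ℕ} {b : Trunc Γ m} (hb : b ∈ filt Γ m n) :
    a * b ∈ filt Γ m n := by
  have h := mul_mem_filt (filt_zero a) hb
  rwa [zero_add] at h

/-- Modulo length two the image is commutative of exponent two, so neither inversion nor conjugation
is seen. -/
theorem magnus_sub_mem {f : RAAG Γ →* Trunc Γ m} (hf : ∀ g, f g - 1 ∈ filt Γ m 1)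
    (g x : RAAG Γ) : f (g⁻¹ * x⁻¹ * g) - f x ∈ filt Γ m 2 := by
  have h1 : f x⁻¹ * f x = 1 := by rw [← map_mul, inv_mul_cancel, map_one]
  have h2 : f g⁻¹ * f g = 1 := by rw [← map_mul, inv_mul_cancel, map_one]
  rw [map_mul, map_mul, conj_inv_sub_identity h1 h2]
  exact neg_mem (mul_mem_filt_left _ (mul_mem_filt_left _ (conj_sub_mem (hf x) (hf g))))

variable (Γ m) in
/-- The matrices over the truncated algebra. -/
abbrev Mat : Type := Matrix (Fin 2) (Fin 2) (Trunc Γ m)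

variable (Γ m) in
/-- A filtration of the algebra of matrices. -/
def matFilt (n : ℕ) : Submodule (ZMod 2) (Mat Γ m) where
  -- The two basis vectors differ by one in weight, which shifts the off-diagonal entries in
  -- opposite directions. The constant `1` in the upper right corner of the image of `x_0 - 1` then
  -- has weight one.
  carrier := {M | M 0 0 ∈ filt Γ m n ∧ M 0 1 ∈ filt Γ m (n - 1) ∧ M 1 0 ∈ filt Γ m (n + 1) ∧
    M 1 1 ∈ filt Γ m n}
  add_mem' h h' := ⟨add_mem h.1 h'.1, add_mem h.2.1 h'.2.1, add_mem h.2.2.1 h'.2.2.1,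
    add_mem h.2.2.2 h'.2.2.2⟩
  zero_mem' := ⟨zero_mem _, zero_mem _, zero_mem _, zero_mem _⟩
  smul_mem' r _ h := ⟨Submodule.smul_mem _ r h.1, Submodule.smul_mem _ r h.2.1,
    Submodule.smul_mem _ r h.2.2.1, Submodule.smul_mem _ r h.2.2.2⟩

theorem mul_mem_matFilt {n : ℕ} {M N : Mat Γ m} (hM : M ∈ matFilt Γ m 1)
    (hN : N ∈ matFilt Γ m n) : M * N ∈ matFilt Γ m (n + 1) := by
  obtain ⟨a, b, c, e⟩ := hM
  obtain ⟨a', b', c', e'⟩ := hN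
  refine ⟨?_, ?_, ?_, ?_⟩ <;> rw [Matrix.mul_apply, Fin.sum_univ_two]
  · exact add_mem (filt_anti (by omega) (mul_mem_filt a a'))
      (filt_anti (by omega) (mul_mem_filt b c'))
  · exact add_mem (filt_anti (by omega) (mul_mem_filt a b'))
      (filt_anti (by omega) (mul_mem_filt b e'))
  · exact add_mem (filt_anti (by omega) (mul_mem_filt c a'))
      (filt_anti (by omega) (mul_mem_filt e c'))
  · exact add_mem (filt_anti (by omega) (mul_mem_filt c b'))
      (filt_anti (by omega) (mul_mem_filt e e'))

theorem matFilt_anti {a b : ℕ} (h : a ≤ b) : matFilt Γ m b ≤ matFilt Γ m a := fun _ hM =>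
  ⟨filt_anti h hM.1, filt_anti (by omega) hM.2.1, filt_anti (by omega) hM.2.2.1,
    filt_anti h hM.2.2.2⟩

/-- The matrix attached to an element of `G_Γ`. -/
def raagMat (f f' : RAAG Γ →* Trunc Γ m) : RAAG Γ →* Mat Γ m where
  toFun g := !![f g, 0; f' g - f g, f' g]
  map_one' := by rw [map_one, map_one, sub_self, Matrix.one_fin_two]
  map_mul' g h := by
    rw [lower_mul_lower, map_mul, map_mul]

theorem Delta.mul_self (s : Delta) : s * s = 1 := by
  revert s; decide

variable (Γ m) in
/-- The matrix attached to an element of `Δ`. -/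
def deltaMat : Delta →* Mat Γ m where
  toFun s := if s = 1 then 1 else !![1, 1; 0, 1]
  map_one' := if_pos rfl
  map_mul' s t := by
    have hne : Delta.x₀ ≠ 1 := by decide
    obtain rfl | rfl := Delta.eq_one_or s <;> obtain rfl | rfl := Delta.eq_one_or t
    · simp
    · simp
    · simp
    · rw [Delta.mul_self, if_pos rfl, if_neg hne, shear_mul_self]

theorem deltaMat_x₀ : deltaMat Γ m Delta.x₀ = !![1, 1; 0, 1] :=
  if_neg (c := Delta.x₀ = 1) (t := (1 : Mat Γ m)) (show ¬ Delta.x₀ = 1 by decide)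

variable {z : Fin d → RAAG Γ} {δ : Delta →* MulAut (RAAG Γ)}

/-- The semidirect product relation. Since `x_0` acts with order at most two, it exchanges `f` and
its twist. -/
theorem deltaMat_mul_raagMat (f : RAAG Γ →* Trunc Γ m) (s : Delta) (g : RAAG Γ) :
    deltaMat Γ m s * raagMat f (f.comp (δ Delta.x₀).toMonoidHom) g =
      raagMat f (f.comp (δ Delta.x₀).toMonoidHom) (δ s g) * deltaMat Γ m s := by
  obtain rfl | rfl := Delta.eq_one_or s
  · simp
  have h1 : δ Delta.x₀ (δ Delta.x₀ g) = g := by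
    rw [← MulAut.mul_apply, ← map_mul, Delta.mul_self, map_one, MulAut.one_apply]
  rw [deltaMat_x₀]
  change _ * !![f g, 0; f (δ Delta.x₀ g) - f g, f (δ Delta.x₀ g)] =
    !![f (δ Delta.x₀ g), 0; f (δ Delta.x₀ (δ Delta.x₀ g)) - f (δ Delta.x₀ g),
      f (δ Delta.x₀ (δ Delta.x₀ g))] * _
  rw [h1]
  exact shear_mul_identity _ _

/-- The representation of `G_z` by matrices attached to a representation of `G_Γ`. -/
def gzMat (δ : Delta →* MulAut (RAAG Γ)) (f : RAAG Γ →* Trunc Γ m) : GZ δ →* Mat Γ m where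
  toFun g := raagMat f (f.comp (δ Delta.x₀).toMonoidHom) g.left * deltaMat Γ m g.right
  map_one' := by simp
  map_mul' g h := by
    rw [SemidirectProduct.mul_left, SemidirectProduct.mul_right, map_mul, map_mul,
      mul_assoc (raagMat f _ g.left) (deltaMat Γ m g.right),
      ← mul_assoc (deltaMat Γ m g.right) (raagMat f _ h.left), deltaMat_mul_raagMat]
    simp only [mul_assoc]

theorem gzMat_gen_succ (f : RAAG Γ →* Trunc Γ m) (i : Fin d) :
    gzMat δ f (deltaGen δ i.succ) = !![f (RAAG.gen Γ i), 0;
      f (δ Delta.x₀ (RAAG.gen Γ i)) - f (RAAG.gen Γ i), f (δ Delta.x₀ (RAAG.gen Γ i))] := by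
  change raagMat f _ (RAAG.gen Γ i) * deltaMat Γ m 1 = _
  rw [map_one, mul_one]
  rfl

theorem gzMat_gen_zero (f : RAAG Γ →* Trunc Γ m) :
    gzMat δ f (deltaGen δ 0) = !![1, 1; 0, 1] := by
  change raagMat f _ 1 * deltaMat Γ m Delta.x₀ = _
  rw [map_one, one_mul, deltaMat_x₀]

/-- The elements at which two homomorphisms are congruent modulo elements of length at least
`2`. -/
def agreeSubgroup {G : Type*} [Group G] (f f' : G →* Trunc Γ m) : Subgroup G where
  carrier := {g | f' g - f g ∈ filt Γ m 2}
  one_mem' := by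
    rw [Set.mem_ofPred_eq, map_one, map_one, sub_self]
    exact zero_mem _
  mul_mem' {g h} hg hh := by
    rw [Set.mem_ofPred_eq] at *
    rw [map_mul, map_mul, mul_sub_mul_identity]
    exact add_mem (mul_mem_filt_left _ hh) (mul_mem_filt_right hg _)
  inv_mem' {g} hg := by
    rw [Set.mem_ofPred_eq] at *
    have h1 : f' g⁻¹ * f' g = 1 := by rw [← map_mul, inv_mul_cancel, map_one]
    have h2 : f g * f g⁻¹ = 1 := by rw [← map_mul, mul_inv_cancel, map_one]
    rw [inv_sub_inv_identity h1 h2]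
    exact neg_mem (mul_mem_filt_right (mul_mem_filt_left _ hg) _)

/-- The elements satisfying this form a subgroup containing the generators and an open subgroup. It
gives the lower left entry of the matrices the extra weight demanded by `matFilt`. -/
theorem magnus_delta_sub_mem (hδ : IsDeltaAction Γ z δ) {f : RAAG Γ →* Trunc Γ m}
    (hf : ∀ g, f g - 1 ∈ filt Γ m 1) (ho : IsOpen (f.ker : Set (RAAG Γ))) (g : RAAG Γ) :
    f (δ Delta.x₀ g) - f g ∈ filt Γ m 2 := by
  let H : Subgroup (RAAG Γ) := agreeSubgroup f (f.comp (δ Delta.x₀).toMonoidHom)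
  have htop : H = ⊤ := by
    refine RAAG.eq_top_of_isOpen (N := f.ker.comap (δ Delta.x₀).toMonoidHom ⊓ f.ker)
      (IsOpen.inter (ho.preimage (hδ.continuous Delta.x₀)) ho) ?_ ?_
    · rintro g ⟨h1, h2⟩
      have h1' : f (δ Delta.x₀ g) = 1 := h1
      have h2' : f g = 1 := h2
      change f (δ Delta.x₀ g) - f g ∈ filt Γ m 2
      rw [h1', h2', sub_self]
      exact zero_mem _
    · intro i
      change f (δ Delta.x₀ (RAAG.gen Γ i)) - f (RAAG.gen Γ i) ∈ filt Γ m 2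
      rw [hδ.apply_gen]
      exact magnus_sub_mem hf _ _
  have : g ∈ H := htop ▸ Subgroup.mem_top g
  exact this

/-- Hence powers of the augmentation ideal land in the corresponding steps of `matFilt`. -/
theorem gzMat_sub_one_mem (hδ : IsDeltaAction Γ z δ) {f : RAAG Γ →* Trunc Γ m}
    (hf : ∀ g, f g - 1 ∈ filt Γ m 1) (ho : IsOpen (f.ker : Set (RAAG Γ))) (g : GZ δ) :
    gzMat δ f g - 1 ∈ matFilt Γ m 1 := by
  have h1 : raagMat f (f.comp (δ Delta.x₀).toMonoidHom) g.left - 1 ∈ matFilt Γ m 1 := by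
    rw [Matrix.one_fin_two]
    refine ⟨?_, ?_, ?_, ?_⟩
    · exact hf _
    · exact filt_zero _
    · change (f (δ Delta.x₀ g.left) - f g.left) - 0 ∈ _
      rw [sub_zero]
      exact magnus_delta_sub_mem hδ hf ho _
    · exact hf _
  have h2 : deltaMat Γ m g.right - 1 ∈ matFilt Γ m 1 := by
    obtain h | h := Delta.eq_one_or g.right
    · rw [h, map_one, sub_self]
      exact zero_mem _
    · rw [h, deltaMat_x₀,
        Matrix.one_fin_two]
      refine ⟨?_, filt_zero _, ?_, ?_⟩ <;> simp
  have e : gzMat δ f g - 1 = (raagMat f (f.comp (δ Delta.x₀).toMonoidHom) g.left - 1) *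
      (deltaMat Γ m g.right - 1) + (raagMat f (f.comp (δ Delta.x₀).toMonoidHom) g.left - 1) +
        (deltaMat Γ m g.right - 1) := by
    exact mul_sub_one_identity _ _
  rw [e]
  exact add_mem (add_mem (matFilt_anti (by omega) (mul_mem_matFilt h1 h2)) h1) h2

theorem gzMat_isOpen_ker (hδ : IsDeltaAction Γ z δ) {f : RAAG Γ →* Trunc Γ m}
    (ho : IsOpen (f.ker : Set (RAAG Γ))) : IsOpen ((gzMat δ f).ker : Set (GZ δ)) := by
  -- The openness criterion is stated for maps to a group, hence the passage to units.
  have h := GZ.isOpen_ker δ (gzMat δ f).toHomUnits (by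
    refine Subgroup.isOpen_mono (H₁ := f.ker.comap (δ Delta.x₀).toMonoidHom ⊓ f.ker) ?_
      (IsOpen.inter (ho.preimage (hδ.continuous Delta.x₀)) ho)
    rintro g ⟨h1, h2⟩
    have h1' : f (δ Delta.x₀ g) = 1 := h1
    have h2' : f g = 1 := h2
    rw [MonoidHom.mem_ker]
    refine Units.ext ?_
    change raagMat f _ g * deltaMat Γ m 1 = 1
    rw [map_one, mul_one, Matrix.one_fin_two]
    simp [raagMat, h1', h2'])
  convert h using 2
  ext g
  rw [MonoidHom.mem_ker, MonoidHom.mem_ker, ← Units.val_inj]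
  rfl

end Representation

end

end DeltaRAAG

namespace DeltaRAAG

noncomputable section

/-! ### Normal forms in the algebra `𝓔_z` -/

section NormalForms

variable {d : ℕ} {Γ : SimpleGraph (Fin d)} {z : Fin d → RAAG Γ} {δ : Delta →* MulAut (RAAG Γ)}

variable (z) in
/-- The classes of the words in the letters `X₁, …, X_d`. -/
def traceEZ : Trace Γ →* EZ z :=
  Trace.lift (fun i => EZ.mk z (var i.succ)) fun i j h => by
    have h1 := EZ.mk_eq_zero_of_isRelator (IsRelator.edge (z := z) i j h)
    rw [lie_eq, map_sub, map_mul, map_mul, sub_eq_zero] at h1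
    exact h1

theorem traceEZ_of (i : Fin d) : traceEZ z (Trace.of Γ i) = EZ.mk z (var i.succ) :=
  Trace.lift_of _ _ _

variable (Γ) in
/-- The normal forms `w X₀ ^ b`. -/
abbrev NormalWord : Type := Trace Γ × Fin 2

/-- The degree of a normal form. -/
def NormalWord.wt (i : NormalWord Γ) : ℕ := Trace.len i.1 + i.2

variable (z) in
/-- The element of `𝓔_z` given by a normal form. -/
def normalEZ (i : NormalWord Γ) : EZ z := traceEZ z i.1 * EZ.mk z (var 0) ^ (i.2 : ℕ)

variable (z) in
/-- The elements of `𝓔_z` which preserve the span of the normal forms. -/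
def normalStab : Subalgebra (ZMod 2) (EZ z) where
  carrier := {a | ∀ s ∈ Submodule.span (ZMod 2) (Set.range (normalEZ z)),
    a * s ∈ Submodule.span (ZMod 2) (Set.range (normalEZ z))}
  mul_mem' ha hb s hs := by rw [mul_assoc]; exact ha _ (hb s hs)
  add_mem' ha hb s hs := by rw [add_mul]; exact add_mem (ha s hs) (hb s hs)
  algebraMap_mem' r s hs := by
    rw [← Algebra.smul_def]; exact Submodule.smul_mem _ r hs

theorem mem_normalStab_of_forall {a : EZ z} (h : ∀ i, a * normalEZ z i ∈
    Submodule.span (ZMod 2) (Set.range (normalEZ z))) : a ∈ normalStab z := by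
  intro s hs
  have : Submodule.span (ZMod 2) (Set.range (normalEZ z)) ≤
      (Submodule.span (ZMod 2) (Set.range (normalEZ z))).comap (LinearMap.mulLeft (ZMod 2) a) := by
    rw [Submodule.span_le]
    rintro _ ⟨i, rfl⟩
    exact h i
  exact this hs

theorem letter_mem_normalStab (i : Fin d) : EZ.mk z (var i.succ) ∈ normalStab z := by
  refine mem_normalStab_of_forall fun ⟨w, b⟩ => Submodule.subset_span ⟨(Trace.of Γ i * w, b), ?_⟩
  rw [normalEZ, normalEZ, map_mul, traceEZ_of, mul_assoc]

/-- The vertex relation as a rewriting rule that moves `X_0` to the right. The correction involves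
only `X_1, …, X_d`. -/
theorem zero_mul_letter (k : Fin d) : EZ.mk z (var 0) * EZ.mk z (var k.succ) =
    EZ.mk z (var k.succ) * EZ.mk z (var 0) + EZ.mk z (⁅(var k.succ : NCPoly d), epsilon (z k)⁆ +
      var k.succ * var k.succ) := by
  have h := EZ.mk_eq_zero_of_isRelator (IsRelator.vertex (z := z) k)
  rw [add_assoc, map_add, lie_eq, map_sub, map_mul, map_mul] at h
  rw [← neg_eq_self_of_algebra (EZ.mk z (⁅(var k.succ : NCPoly d), epsilon (z k)⁆ +
      var k.succ * var k.succ)), eq_comm, ← sub_eq_zero, ← neg_eq_zero, ← h]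
  abel

/-- Induction on the trace. When `X_0` passes the first letter, the corrections are products of
letters `X_1, …, X_d`, which are already known to preserve the span. -/
theorem zero_mem_normalStab : EZ.mk z (var 0) ∈ normalStab z := by
  refine mem_normalStab_of_forall fun ⟨w, b⟩ => ?_
  induction w using Trace.induction with
  | one =>
    have h0 : EZ.mk z (var 0) * EZ.mk z (var 0) = 0 := by
      rw [← map_mul]; exact EZ.mk_eq_zero_of_isRelator IsRelator.sq_zero
    revert b
    rw [Fin.forall_fin_two]
    refine ⟨Submodule.subset_span ⟨(1, 1), ?_⟩, ?_⟩
    · simp [normalEZ]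
    · have : EZ.mk z (var 0) * normalEZ z (1, 1) = 0 := by simp [normalEZ, h0]
      rw [this]
      exact zero_mem _
  | of_mul i w ih =>
    have e : EZ.mk z (var 0) * normalEZ z (Trace.of Γ i * w, b) =
        EZ.mk z (var i.succ) * (EZ.mk z (var 0) * normalEZ z (w, b)) +
          EZ.mk z (⁅(var i.succ : NCPoly d), epsilon (z i)⁆ + var i.succ * var i.succ) *
            normalEZ z (w, b) := by
      simp only [normalEZ]
      rw [map_mul, traceEZ_of, mul_assoc (EZ.mk z (var i.succ)), ← mul_assoc (EZ.mk z (var 0)),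
        zero_mul_letter, add_mul, mul_assoc]
    rw [e]
    have hl := letter_mem_normalStab (z := z) i
    have he : EZ.mk z (epsilon (z i)) ∈ normalStab z := by
      rw [epsilon, map_sum]
      refine sum_mem fun j _ => ?_
      rw [map_smul]
      exact Subalgebra.smul_mem _ (letter_mem_normalStab j) _
    refine add_mem (hl _ ih) ?_
    have hm : EZ.mk z (⁅(var i.succ : NCPoly d), epsilon (z i)⁆ + var i.succ * var i.succ) ∈
        normalStab z := by
      rw [lie_eq, map_add, map_sub, map_mul, map_mul, map_mul]
      exact add_mem (sub_mem (mul_mem hl he) (mul_mem he hl)) (mul_mem hl hl)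
    exact hm _ (Submodule.subset_span ⟨_, rfl⟩)

variable (z) in
-- The span contains `1` and is stable under left multiplication by every generator.
theorem span_normalEZ : Submodule.span (ZMod 2) (Set.range (normalEZ z)) = ⊤ := by
  rw [eq_top_iff]
  rintro u -
  obtain ⟨p, rfl⟩ := EZ.mk_surjective u
  have hp : EZ.mk z p ∈ normalStab z := by
    induction p using FreeAlgebra.induction with
    | grade0 r => rw [AlgHom.commutes]; exact Subalgebra.algebraMap_mem _ r
    | grade1 i =>
      induction i using Fin.cases with
      | zero => exact zero_mem_normalStab
      | succ i => exact letter_mem_normalStab i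
    | mul a b ha hb => rw [map_mul]; exact mul_mem ha hb
    | add a b ha hb => rw [map_add]; exact add_mem ha hb
  have := hp 1 (Submodule.subset_span ⟨(1, 0), by simp [normalEZ]⟩)
  rwa [mul_one] at this

variable (z) in
-- The lift is fixed before `m` and `θ`, so that one polynomial serves every representation. If the
-- first rows of the letters are `(X_i, 0)`, the first row of a product does not involve second
-- rows, and the twisted part of the representation need not be known.
theorem exists_trace_lift (w : Trace Γ) : ∃ p ∈ ncHomogeneous d (Trace.len w),
    EZ.mk z p = traceEZ z w ∧ ∀ (m : ℕ) (θ : NCPoly d →ₐ[ZMod 2] Mat Γ m),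
      (∀ i : Fin d, θ (var i.succ) 0 0 = Trunc.letter m i ∧ θ (var i.succ) 0 1 = 0) →
        θ p 0 0 = Trunc.mk Γ m (MonoidAlgebra.single w 1) ∧ θ p 0 1 = 0 := by
  induction w using Trace.induction with
  | one =>
    refine ⟨1, ?_, by rw [map_one, map_one], fun m θ _ => ?_⟩
    · rw [Trace.len_one, ncHomogeneous, pow_zero]
      exact Submodule.one_le.1 le_rfl
    · rw [map_one, ← MonoidAlgebra.one_def, map_one]
      exact ⟨rfl, rfl⟩
  | of_mul i w ih =>
    obtain ⟨p, hp, e, hθ⟩ := ih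
    refine ⟨var i.succ * p, ?_, ?_, fun m θ h => ?_⟩
    · rw [Trace.len_mul, Trace.len_of]
      exact mul_mem_ncHomogeneous (var_mem_ncHomogeneous _) hp
    · rw [map_mul, map_mul, e, traceEZ_of]
    · obtain ⟨h1, h2⟩ := hθ m θ h
      rw [map_mul, Matrix.mul_apply, Matrix.mul_apply, Fin.sum_univ_two, Fin.sum_univ_two, (h i).1,
        (h i).2, zero_mul, zero_mul, add_zero, add_zero, h1, h2, mul_zero]
      refine ⟨?_, rfl⟩
      rw [← map_mul, MonoidAlgebra.of_apply, MonoidAlgebra.single_mul_single, one_mul]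

variable (z) in
-- Multiplying by `X_0` on the right moves the entry of the first row `(w, 0)` to the second column.
theorem exists_normal_lift (i : NormalWord Γ) : ∃ p ∈ ncHomogeneous d i.wt,
    EZ.mk z p = normalEZ z i ∧ ∀ (m : ℕ) (θ : NCPoly d →ₐ[ZMod 2] Mat Γ m),
      (∀ i : Fin d, θ (var i.succ) 0 0 = Trunc.letter m i ∧ θ (var i.succ) 0 1 = 0) →
      θ (var 0) = !![0, 1; 0, 0] → ∀ b : Fin 2, θ p 0 b =
        if i.2 = b then Trunc.mk Γ m (MonoidAlgebra.single i.1 1) else 0 := by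
  obtain ⟨w, b⟩ := i
  obtain ⟨p, hp, e, hθ⟩ := exists_trace_lift z w
  revert b
  rw [Fin.forall_fin_two]
  constructor
  · refine ⟨p, hp, by simp [normalEZ, e], fun m θ h _ => ?_⟩
    rw [Fin.forall_fin_two, (hθ m θ h).1, (hθ m θ h).2]
    exact ⟨(if_pos rfl).symm, (if_neg (show ¬ (0 : Fin 2) = 1 by decide)).symm⟩
  · refine ⟨p * var 0, mul_mem_ncHomogeneous hp (var_mem_ncHomogeneous 0), by simp [normalEZ, e],
      fun m θ h h0 => ?_⟩
    rw [Fin.forall_fin_two, map_mul, Matrix.mul_apply, Matrix.mul_apply, Fin.sum_univ_two,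
      Fin.sum_univ_two, (hθ m θ h).1, (hθ m θ h).2, h0]
    refine ⟨?_, ?_⟩
    · rw [if_neg (show ¬ (1 : Fin 2) = 0 by decide), zero_mul, add_zero]
      exact mul_zero _
    · rw [if_pos rfl, zero_mul, add_zero]
      exact mul_one _

variable (z) in
/-- A lift of a normal form to a homogeneous noncommutative polynomial. -/
def normalLift (i : NormalWord Γ) : NCPoly d := (exists_normal_lift z i).choose

theorem normalLift_mem (i : NormalWord Γ) : normalLift z i ∈ ncHomogeneous d i.wt :=
  (exists_normal_lift z i).choose_spec.1

theorem mk_normalLift (i : NormalWord Γ) : EZ.mk z (normalLift z i) = normalEZ z i :=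
  (exists_normal_lift z i).choose_spec.2.1

theorem normalLift_row (i : NormalWord Γ) (m : ℕ) (θ : NCPoly d →ₐ[ZMod 2] Mat Γ m)
    (h : ∀ i : Fin d, θ (var i.succ) 0 0 = Trunc.letter m i ∧ θ (var i.succ) 0 1 = 0)
    (h0 : θ (var 0) = !![0, 1; 0, 0]) (b : Fin 2) : θ (normalLift z i) 0 b =
      if i.2 = b then Trunc.mk Γ m (MonoidAlgebra.single i.1 1) else 0 :=
  (exists_normal_lift z i).choose_spec.2.2 m θ h h0 b

variable (z) in
/-- The noncommutative polynomials which are combinations of the lifts of the normal forms. -/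
def normalPoly : (NormalWord Γ →₀ ZMod 2) →ₗ[ZMod 2] NCPoly d :=
  Finsupp.linearCombination (ZMod 2) (normalLift z)

theorem normalPoly_mem {n : ℕ} {c : NormalWord Γ →₀ ZMod 2} (hc : ∀ i, c i ≠ 0 → i.wt = n) :
    normalPoly z c ∈ ncHomogeneous d n := by
  rw [normalPoly, Finsupp.linearCombination_apply]
  refine Submodule.sum_mem _ fun i hi => Submodule.smul_mem _ _ ?_
  rw [← hc i (Finsupp.mem_support_iff.1 hi)]
  exact normalLift_mem i

/-- Up to truncation, the first row displays all the coefficients: column `b` collects the normal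
forms ending in `X_0^b`. -/
theorem normalPoly_row (c : NormalWord Γ →₀ ZMod 2) (m : ℕ) (θ : NCPoly d →ₐ[ZMod 2] Mat Γ m)
    (h : ∀ i : Fin d, θ (var i.succ) 0 0 = Trunc.letter m i ∧ θ (var i.succ) 0 1 = 0)
    (h0 : θ (var 0) = !![0, 1; 0, 0]) (b : Fin 2) : ∃ f : TraceAlg Γ,
      θ (normalPoly z c) 0 b = Trunc.mk Γ m f ∧ ∀ w, f.coeff w = c (w, b) := by
  classical
  induction c using Finsupp.induction_linear with
  | zero => exact ⟨0, by rw [map_zero, map_zero, map_zero]; rfl, fun w => rfl⟩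
  | add c c' hc hc' =>
    obtain ⟨f, hf, hf'⟩ := hc
    obtain ⟨g, hg, hg'⟩ := hc'
    refine ⟨f + g, ?_, fun w => ?_⟩
    · rw [map_add, map_add, map_add, ← hf, ← hg]; rfl
    · rw [MonoidAlgebra.coeff_add, Finsupp.add_apply, Finsupp.add_apply, hf', hg']
  | single i r =>
    refine ⟨if i.2 = b then MonoidAlgebra.single i.1 r else 0, ?_, fun w => ?_⟩
    · rw [normalPoly, Finsupp.linearCombination_single, map_smul, Matrix.smul_apply,
        normalLift_row i m θ h h0]
      split_ifs
      · rw [← map_smul, MonoidAlgebra.smul_single, smul_eq_mul, mul_one]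
      · rw [smul_zero, map_zero]
    · obtain ⟨v, b'⟩ := i
      rw [Finsupp.single_apply]
      split_ifs with h1 h2 h2
      · rw [(Prod.ext_iff.1 h2).1, MonoidAlgebra.coeff_single, Finsupp.single_eq_same]
      · rw [MonoidAlgebra.coeff_single, Finsupp.single_apply, if_neg]
        rintro rfl
        exact h2 (Prod.ext rfl h1)
      · exact absurd (Prod.ext_iff.1 h2).2 h1
      · rfl

end NormalForms

/-! ### Independence of the normal forms, and the Hilbert series -/

section Independence

variable {d : ℕ} {Γ : SimpleGraph (Fin d)} {z : Fin d → RAAG Γ} {δ : Delta →* MulAut (RAAG Γ)}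

variable (m : ℕ) in
/-- A homomorphism from `E(G_z)` to a matrix algebra which separates the normal forms of degree
less than `m`. -/
theorem exists_matrix_rep (hδ : IsDeltaAction Γ z δ) : ∃ (N : OpenNormalSubgroup (GZ δ))
    (ρ : CGA (GZ δ) →ₐ[ZMod 2] Mat Γ m),
    (∀ g ∈ N.toSubgroup, ρ (toCGA (GZ δ) g - 1) = 0) ∧
    (∀ n, ∀ a ∈ powSub (augIdeal (GZ δ)) (n + 1), ρ a ∈ matFilt Γ m (n + 1)) ∧
    (∀ i : Fin d, ρ (genSub δ i.succ) 0 0 = Trunc.letter m i ∧ ρ (genSub δ i.succ) 0 1 = 0) ∧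
      ρ (genSub δ 0) = !![0, 1; 0, 0] := by
  obtain ⟨f, hf, hf1, ho⟩ := exists_magnus Γ m
  let N : OpenNormalSubgroup (GZ δ) :=
    { toSubgroup := (gzMat δ f).ker
      isOpen' := gzMat_isOpen_ker hδ ho
      isNormal' := inferInstance }
  have hN : N.toSubgroup ≤ (gzMat δ f).ker := le_rfl
  have hsub : ∀ g, CGA.lift (gzMat δ f) N hN (toCGA (GZ δ) g - 1) = gzMat δ f g - 1 := fun g => by
    rw [map_sub, map_one, CGA.lift_toCGA]
  refine ⟨N, CGA.lift (gzMat δ f) N hN, fun g hg => ?_, fun n => ?_, fun i => ?_, ?_⟩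
  · rw [hsub, sub_eq_zero]
    exact hg
  · have h1 : ∀ a ∈ augIdeal (GZ δ), CGA.lift (gzMat δ f) N hN a ∈ matFilt Γ m 1 := fun a ha =>
      CGA.lift_mem _ N hN _ (gzMat_sub_one_mem hδ hf1 ho) ha
    induction n with
    | zero => exact fun a ha => h1 a (mem_powSub_one.1 ha)
    | succ n ih =>
      intro a ha
      change a ∈ augIdeal (GZ δ) ^ (n + 1 + 1) at ha
      rw [add_comm (n + 1) 1, Ideal.IsTwoSided.pow_add, Submodule.pow_one] at ha
      refine Submodule.smul_induction_on (p := fun a => CGA.lift (gzMat δ f) N hN a ∈ _) ha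
        (fun a ha b hb => ?_) (fun a b ha hb => ?_)
      · rw [smul_eq_mul, map_mul]
        exact mul_mem_matFilt (h1 a ha) (ih b hb)
      · rw [map_add]
        exact add_mem ha hb
  · rw [genSub, hsub, gzMat_gen_succ, hf, Matrix.one_fin_two]
    refine ⟨?_, ?_⟩
    · change 1 + Trunc.letter m i - 1 = _
      rw [add_sub_cancel_left]
    · change (0 : Trunc Γ m) - 0 = 0
      rw [sub_self]
  · rw [genSub, hsub, gzMat_gen_zero, Matrix.one_fin_two]
    ext i j
    fin_cases i <;> fin_cases j <;> simp

/-- A normal form of degree `n` shows in the first row as a trace of length `n` in column `0` or of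
length `n - 1` in column `1`. Both lie just below the bounds imposed by step `n + 1` of the
filtration, and `n + 1 ≤ m` keeps them clear of the truncation. -/
theorem eq_zero_of_normalPoly_mem_matFilt {m n : ℕ} (hnm : n + 1 ≤ m)
    {ρ : CGA (GZ δ) →ₐ[ZMod 2] Mat Γ m}
    (h1 : ∀ i : Fin d, ρ (genSub δ i.succ) 0 0 = Trunc.letter m i ∧ ρ (genSub δ i.succ) 0 1 = 0)
    (h2 : ρ (genSub δ 0) = !![0, 1; 0, 0]) {c : NormalWord Γ →₀ ZMod 2}
    (hc : ∀ i, c i ≠ 0 → i.wt = n)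
    (hmem : ρ (evalAt (genSub δ) (normalPoly z c)) ∈ matFilt Γ m (n + 1)) : c = 0 := by
  have hrow := normalPoly_row (z := z) c m (ρ.comp (evalAt (genSub δ)))
    (fun i => by rw [AlgHom.comp_apply, evalAt_genSub_var]; exact h1 i)
    (by rw [AlgHom.comp_apply, evalAt_genSub_var]; exact h2)
  by_contra hne
  obtain ⟨⟨w, b⟩, hi⟩ := Finsupp.ne_iff.1 hne
  rw [Finsupp.zero_apply] at hi
  have hw := hc _ hi
  obtain ⟨f, hf, hf'⟩ := hrow b
  rw [AlgHom.comp_apply] at hf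
  revert b
  rw [Fin.forall_fin_two]
  constructor
  · intro hi hw hf hf'
    have := hmem.1
    rw [hf, Trunc.mk_mem_filt hnm, mem_lenSub] at this
    refine hi ((hf' w).symm.trans (this w ?_))
    simp only [NormalWord.wt, Fin.val_zero, add_zero] at hw
    omega
  · intro hi hw hf hf'
    have := hmem.2.1
    rw [hf, Nat.add_sub_cancel, Trunc.mk_mem_filt ((Nat.le_succ n).trans hnm), mem_lenSub] at this
    refine hi ((hf' w).symm.trans (this w ?_))
    simp only [NormalWord.wt, Fin.val_one] at hw
    omega

theorem eq_zero_of_evalAt_normalPoly_mem (hδ : IsDeltaAction Γ z δ) {n : ℕ}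
    {c : NormalWord Γ →₀ ZMod 2} (hc : ∀ i, c i ≠ 0 → i.wt = n)
    (h : evalAt (genSub δ) (normalPoly z c) ∈ powSub (augIdeal (GZ δ)) (n + 1)) : c = 0 := by
  obtain ⟨N, ρ, -, hρ, h1, h2⟩ := exists_matrix_rep (n + 1) hδ
  exact eq_zero_of_normalPoly_mem_matFilt le_rfl h1 h2 hc (hρ n _ h)

/-- Reduces independence to one degree at a time. -/
theorem grEval_normalPoly_apply (c : NormalWord Γ →₀ ZMod 2) (n : ℕ) :
    grEval (augIdeal (GZ δ)) (genSub_mem (δ := δ)) (normalPoly z c) n =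
      grEval (augIdeal (GZ δ)) (genSub_mem (δ := δ))
        (normalPoly z (c.filter fun i => i.wt = n)) n := by
  induction c using Finsupp.induction_linear with
  | zero => rw [Finsupp.filter_zero]
  | add c c' hc hc' =>
    rw [Finsupp.filter_add, map_add, map_add, map_add, map_add, DirectSum.add_apply,
      DirectSum.add_apply, hc, hc']
  | single i r =>
    by_cases h : i.wt = n
    · rw [Finsupp.filter_single_of_pos (fun j : NormalWord Γ => j.wt = n) h]
    · rw [Finsupp.filter_single_of_neg (fun j : NormalWord Γ => j.wt = n) h, map_zero, map_zero, DirectSum.zero_apply]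
      obtain ⟨h1, e⟩ := grEval_of_mem (augIdeal (GZ δ)) (genSub_mem (δ := δ))
        (normalPoly_mem (z := z) (n := i.wt) (c := Finsupp.single i r) fun j hj => by
          classical
          rw [Finsupp.single_apply] at hj
          split_ifs at hj with hij
          · rw [hij]
          · exact absurd rfl hj)
      rw [e]
      exact DirectSum.of_eq_of_ne _ _ _ (Ne.symm h)

theorem filter_eq_zero_of_grEval (hδ : IsDeltaAction Γ z δ) {c : NormalWord Γ →₀ ZMod 2} {n : ℕ}
    (h : grEval (augIdeal (GZ δ)) (genSub_mem (δ := δ)) (normalPoly z c) n = 0) :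
    (c.filter fun i => i.wt = n) = 0 := by
  have hc : ∀ i, (c.filter fun i => i.wt = n) i ≠ 0 → i.wt = n := fun i hi => by
    by_contra hne
    exact hi (Finsupp.filter_apply_neg _ _ hne)
  refine eq_zero_of_evalAt_normalPoly_mem hδ hc ?_
  rw [grEval_normalPoly_apply] at h
  obtain ⟨h1, e⟩ := grEval_of_mem (augIdeal (GZ δ)) (genSub_mem (δ := δ)) (normalPoly_mem (z := z) hc)
  rw [e, DirectSum.of_eq_same] at h
  have := (grMk_eq_iff (hb := zero_mem _) _).1 (h.trans (grMk_zero _).symm)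
  rwa [sub_zero] at this

theorem exists_mk_normalPoly (u : EZ z) : ∃ c, u = EZ.mk z (normalPoly z c) := by
  have h : u ∈ Submodule.span (ZMod 2) (Set.range (normalEZ z)) := by
    rw [span_normalEZ]; trivial
  obtain ⟨c, rfl⟩ := (Finsupp.mem_span_range_iff_exists_finsupp).1 h
  refine ⟨c, ?_⟩
  rw [normalPoly, Finsupp.linearCombination_apply, Finsupp.sum, Finsupp.sum, map_sum]
  simp only [map_smul, mk_normalLift]

/-- The normal forms span the source and their images are independent, while the target is generated
in degree one. In particular they form a basis of `𝓔_z`. -/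
theorem toGrE_bijective (hδ : IsDeltaAction Γ z δ) : Function.Bijective (toGrE hδ) := by
  constructor
  · rw [injective_iff_map_eq_zero]
    intro u hu
    obtain ⟨c, rfl⟩ := exists_mk_normalPoly u
    have hu' : grEval (augIdeal (GZ δ)) (genSub_mem (δ := δ)) (normalPoly z c) = 0 := hu
    have : c = 0 := by
      ext i
      have h := filter_eq_zero_of_grEval (n := i.wt) hδ (by rw [hu']; rfl)
      rw [← Finsupp.filter_apply_pos (fun j : NormalWord Γ => j.wt = i.wt) c rfl, h]
    rw [this, map_zero, map_zero]
  · intro x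
    obtain ⟨p, rfl⟩ := (isGenerated_genSub δ).grEval_surjective (genSub_mem (δ := δ)) x
    exact ⟨EZ.mk z p, rfl⟩

variable (z) in
/-- The homogeneous component of degree `n` of `𝓔(G_z)`, in terms of the normal forms. -/
def normalToGr (δ : Delta →* MulAut (RAAG Γ)) (n : ℕ) :
    ({i : NormalWord Γ // i.wt = n} →₀ ZMod 2) →ₗ[ZMod 2] GrPiece (augIdeal (GZ δ)) n :=
  (DirectSum.component (ZMod 2) ℕ (GrPiece (augIdeal (GZ δ))) n) ∘ₗ
    (grEval (augIdeal (GZ δ)) (genSub_mem (δ := δ))).toLinearMap ∘ₗ normalPoly z ∘ₗ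
      Finsupp.lmapDomain (ZMod 2) (ZMod 2) Subtype.val

theorem normalToGr_bijective (hδ : IsDeltaAction Γ z δ) (n : ℕ) :
    Function.Bijective (normalToGr z δ n) := by
  have hinj := Subtype.val_injective (p := fun i : NormalWord Γ => i.wt = n)
  constructor
  · rw [injective_iff_map_eq_zero]
    intro c hc
    have h := filter_eq_zero_of_grEval hδ
      (c := Finsupp.mapDomain Subtype.val c) (n := n) hc
    ext i
    rw [← Finsupp.mapDomain_apply hinj c i,
      ← Finsupp.filter_apply_pos (fun j : NormalWord Γ => j.wt = n) _ i.2, h]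
    rfl
  · intro x
    obtain ⟨u, hu⟩ := (toGrE_bijective hδ).2 (DirectSum.of _ n x)
    obtain ⟨c, rfl⟩ := exists_mk_normalPoly u
    have hc : grEval (augIdeal (GZ δ)) (genSub_mem (δ := δ)) (normalPoly z c) =
      DirectSum.of _ n x := hu
    refine ⟨Finsupp.comapDomain Subtype.val c hinj.injOn, ?_⟩
    change grEval (augIdeal (GZ δ)) (genSub_mem (δ := δ)) (normalPoly z
      (Finsupp.mapDomain Subtype.val (Finsupp.comapDomain Subtype.val c hinj.injOn))) n = x
    have e : Finsupp.mapDomain Subtype.val (Finsupp.comapDomain Subtype.val c hinj.injOn) =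
        c.filter fun i : NormalWord Γ => i.wt = n := by
      ext i
      by_cases h : i.wt = n
      · rw [Finsupp.filter_apply_pos (fun j : NormalWord Γ => j.wt = n) _ h,
          show i = ((⟨i, h⟩ : {i : NormalWord Γ // i.wt = n}) : NormalWord Γ) from rfl,
          Finsupp.mapDomain_apply hinj]
        rfl
      · rw [Finsupp.filter_apply_neg (fun j : NormalWord Γ => j.wt = n) _ h, Finsupp.mapDomain_of_notMem_range]
        rintro ⟨j, rfl⟩
        exact h j.2
    rw [e, ← grEval_normalPoly_apply, hc, DirectSum.of_eq_same]

variable (Γ) in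
/-- The normal forms of degree `n`. -/
def normalEquiv (n : ℕ) : {i : NormalWord Γ // i.wt = n} ≃
    {w : Trace Γ // Trace.len w = n} ⊕ {w : Trace Γ // Trace.len w + 1 = n} where
  toFun i := if h : i.1.2 = 0 then
      .inl ⟨i.1.1, by have := i.2; simpa [NormalWord.wt, h] using this⟩
    else .inr ⟨i.1.1, by
      have := i.2; rw [NormalWord.wt] at this; omega⟩
  invFun := Sum.elim (fun w => ⟨(w.1, 0), w.2⟩) fun w => ⟨(w.1, 1), w.2⟩
  left_inv := by
    rintro ⟨⟨w, b⟩, h⟩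
    revert b
    rw [Fin.forall_fin_two]
    exact ⟨fun h => rfl, fun h => rfl⟩
  right_inv := by
    rintro (⟨w, h⟩ | ⟨w, h⟩) <;> rfl

variable (Γ) in
theorem finite_len_succ (n : ℕ) : Finite {w : Trace Γ // Trace.len w + 1 = n} := by
  cases n with
  | zero =>
    have : IsEmpty {w : Trace Γ // Trace.len w + 1 = 0} := ⟨fun w => Nat.succ_ne_zero _ w.2⟩
    infer_instance
  | succ n =>
    have := Trace.finite_len (Γ := Γ) n
    exact Finite.of_equiv _ (Equiv.subtypeEquivRight fun w : Trace Γ =>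
      (Nat.succ_inj (a := Trace.len w) (b := n)).symm)

theorem finite_grPiece (hδ : IsDeltaAction Γ z δ) (n : ℕ) :
    Module.Finite (ZMod 2) (GrPiece (augIdeal (GZ δ)) n) := by
  have := Trace.finite_len (Γ := Γ) n
  have := finite_len_succ Γ n
  have := Finite.of_equiv _ (normalEquiv Γ n).symm
  exact Module.Finite.equiv (LinearEquiv.ofBijective _ (normalToGr_bijective hδ n))

/-- The two terms count the normal forms without and with a final `X_0`. -/
theorem finrank_grPiece (hδ : IsDeltaAction Γ z δ) (n : ℕ) :
    Module.finrank (ZMod 2) (GrPiece (augIdeal (GZ δ)) n) =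
      Nat.card {w : Trace Γ // Trace.len w = n} + Nat.card {w : Trace Γ // Trace.len w + 1 = n} := by
  have := Trace.finite_len (Γ := Γ) n
  have := finite_len_succ Γ n
  have := Finite.of_equiv _ (normalEquiv Γ n).symm
  have := Fintype.ofFinite {i : NormalWord Γ // i.wt = n}
  rw [← (LinearEquiv.ofBijective _ (normalToGr_bijective hδ n)).finrank_eq,
    Module.finrank_finsupp_self, ← Nat.card_eq_fintype_card, Nat.card_congr (normalEquiv Γ n),
    Nat.card_sum]

theorem gocha_eq (hδ : IsDeltaAction Γ z δ) : gocha (GZ δ) = (1 + PowerSeries.X) *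
    (((cliquePolynomial Γ).comp (-Polynomial.X) : Polynomial ℚ) : PowerSeries ℚ)⁻¹ := by
  have h1 : gocha (GZ δ) = (1 + PowerSeries.X) * Trace.growth Γ := by
    ext n
    rw [gocha, PowerSeries.coeff_mk, finrank_grPiece hδ, add_mul, one_mul, map_add, Trace.growth,
      PowerSeries.coeff_mk, Nat.cast_add]
    congr 1
    cases n with
    | zero =>
      rw [PowerSeries.coeff_zero_X_mul]
      have : IsEmpty {w : Trace Γ // Trace.len w + 1 = 0} := ⟨fun w => Nat.succ_ne_zero _ w.2⟩
      rw [Nat.card_of_isEmpty, Nat.cast_zero]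
    | succ n =>
      rw [PowerSeries.coeff_succ_X_mul, PowerSeries.coeff_mk]
      congr 1
      exact Nat.card_congr (Equiv.subtypeEquivRight fun w => Nat.succ_inj)
  have h2 := Trace.growth_mul (Γ := Γ)
  rw [h1]
  congr 1
  refine (PowerSeries.eq_inv_iff_mul_eq_one ?_).2 h2
  intro h0
  have := congrArg PowerSeries.constantCoeff h2
  rw [map_mul, h0, mul_zero, map_one] at this
  exact zero_ne_one this

/-- The kernel of `𝓔 → 𝓔(G_z)` and the relations. -/
theorem mk_eq_zero_iff (hδ : IsDeltaAction Γ z δ) {p : NCPoly d} : EZ.mk z p = 0 ↔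
    grEval (augIdeal (GZ δ)) (genSub_mem (δ := δ)) p = 0 :=
  ((map_eq_zero_iff (toGrE hδ) (toGrE_bijective hδ).1).symm : _)

end Independence

end

end DeltaRAAG

namespace DeltaRAAG

noncomputable section

/-! ### Subspaces closed under commutators and squares -/

section Restricted

variable {R : Type*} [Ring R] [Algebra (ZMod 2) R]

theorem add_sq_identity (x y : R) : (x + y) * (x + y) = x * x + y * y + (x * y - y * x) := by
  rw [sub_eq_add_neg, neg_eq_self_of_algebra, add_mul, mul_add, mul_add]
  abel

theorem lie_mem_of_span {S T : Set R} {K : Submodule (ZMod 2) R}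
    (h : ∀ x ∈ S, ∀ y ∈ T, x * y - y * x ∈ K) {x y : R} (hx : x ∈ Submodule.span (ZMod 2) S)
    (hy : y ∈ Submodule.span (ZMod 2) T) : x * y - y * x ∈ K := by
  induction hx, hy using Submodule.span_induction₂ with
  | mem_mem x y hx hy => exact h x hx y hy
  | zero_left y hy => rw [zero_mul, mul_zero, sub_zero]; exact zero_mem _
  | zero_right x hx => rw [zero_mul, mul_zero, sub_zero]; exact zero_mem _
  | add_left x y z _ _ _ h1 h2 =>
    rw [add_mul, mul_add, add_sub_add_comm]; exact add_mem h1 h2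
  | add_right x y z _ _ _ h1 h2 =>
    rw [add_mul, mul_add, add_sub_add_comm]; exact add_mem h1 h2
  | smul_left r x y _ _ h =>
    rw [smul_mul_assoc, mul_smul_comm, ← smul_sub]; exact Submodule.smul_mem _ r h
  | smul_right r x y _ _ h =>
    rw [smul_mul_assoc, mul_smul_comm, ← smul_sub]; exact Submodule.smul_mem _ r h

/-- In characteristic two the square is additive up to a commutator, so closure under squares can be
checked on generators once commutators are controlled. -/
theorem sq_mem_of_span {S : Set R} {K : Submodule (ZMod 2) R} (h : ∀ x ∈ S, x * x ∈ K)
    (h2 : ∀ x ∈ Submodule.span (ZMod 2) S, ∀ y ∈ Submodule.span (ZMod 2) S, x * y - y * x ∈ K)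
    {x : R} (hx : x ∈ Submodule.span (ZMod 2) S) : x * x ∈ K := by
  induction hx using Submodule.span_induction with
  | mem x hx => exact h x hx
  | zero => rw [zero_mul]; exact zero_mem _
  | add x y hx hy h1 h1' =>
    rw [add_sq_identity]
    exact add_mem (add_mem h1 h1') (h2 x hx y hy)
  | smul r x _ h =>
    rw [smul_mul_assoc, mul_smul_comm]
    exact Submodule.smul_mem _ r (Submodule.smul_mem _ r h)

/-- A linear map compatible with commutators and squares on the elements of `K`. -/
structure IsRestrictedOn {B : Type*} [Ring B] [Algebra (ZMod 2) B] (f : R →ₗ[ZMod 2] B)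
    (K : Set R) : Prop where
  map_lie : ∀ x ∈ K, ∀ y ∈ K, f (x * y - y * x) = f x * f y - f y * f x
  map_sq : ∀ x ∈ K, f (x * x) = f x * f x

theorem IsRestrictedOn.span {B : Type*} [Ring B] [Algebra (ZMod 2) B] {f : R →ₗ[ZMod 2] B}
    {S : Set R} (h : IsRestrictedOn f S) :
    IsRestrictedOn f (Submodule.span (ZMod 2) S : Set R) := by
  have hl : ∀ x ∈ Submodule.span (ZMod 2) S, ∀ y ∈ Submodule.span (ZMod 2) S,
      f (x * y - y * x) = f x * f y - f y * f x := fun x hx y hy => by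
    induction hx, hy using Submodule.span_induction₂ with
    | mem_mem x y hx hy => exact h.map_lie x hx y hy
    | zero_left y hy => simp only [zero_mul, mul_zero, sub_zero, map_zero]
    | zero_right x hx => simp only [zero_mul, mul_zero, sub_zero, map_zero]
    | add_left x y z _ _ _ h1 h2 =>
      rw [add_mul, mul_add, add_sub_add_comm, map_add, h1, h2, map_add, add_mul, mul_add,
        add_sub_add_comm]
    | add_right x y z _ _ _ h1 h2 =>
      rw [add_mul, mul_add, add_sub_add_comm, map_add, h1, h2, map_add, add_mul, mul_add,
        add_sub_add_comm]
    | smul_left r x y _ _ h =>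
      rw [smul_mul_assoc, mul_smul_comm, ← smul_sub, map_smul, h, map_smul, smul_mul_assoc,
        mul_smul_comm, ← smul_sub]
    | smul_right r x y _ _ h =>
      rw [smul_mul_assoc, mul_smul_comm, ← smul_sub, map_smul, h, map_smul, smul_mul_assoc,
        mul_smul_comm, ← smul_sub]
  refine ⟨hl, fun x hx => ?_⟩
  rw [SetLike.mem_coe] at hx
  induction hx using Submodule.span_induction with
  | mem x hx => exact h.map_sq x hx
  | zero => simp only [zero_mul, map_zero]
  | add x y hx hy h1 h1' =>
    rw [add_sq_identity, map_add, map_add, h1, h1', hl x hx y hy, map_add, add_sq_identity]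
  | smul r x hx h =>
    rw [smul_mul_assoc, mul_smul_comm, map_smul, map_smul, map_smul, h, smul_mul_assoc,
      mul_smul_comm]

/-- Induction along a filtration with finite-dimensional quotients of a subspace closed under
commutators and squares, adding one element at a time. -/
theorem flag_induction {F : ℕ → Submodule (ZMod 2) R}
    (hbr : ∀ k, ∀ x ∈ F 0, ∀ y ∈ F k, x * y - y * x ∈ F (k + 1))
    (hsq : ∀ k, ∀ x ∈ F k, x * x ∈ F (k + 1))
    (hanti : ∀ k, F (k + 1) ≤ F k)
    (hfin : ∀ k, ∃ s : Set R, s.Finite ∧ s ⊆ F k ∧ F k ≤ F (k + 1) ⊔ Submodule.span (ZMod 2) s)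
    {P : Submodule (ZMod 2) R → Prop} (n : ℕ) (h0 : P (F n))
    (step : ∀ K x, F n ≤ K → K ≤ F 0 → x ∈ F 0 → x ∉ K → (∀ y ∈ K, x * y - y * x ∈ K) →
      (∀ y ∈ K, ∀ y' ∈ K, y * y' - y' * y ∈ K) → (∀ y ∈ K, y * y ∈ K) → x * x ∈ K → P K →
        P (K ⊔ Submodule.span (ZMod 2) {x})) : P (F 0) := by
  have hmono : Antitone F := antitone_nat_of_succ_le hanti
  have key : ∀ k, k ≤ n → P (F k) := by
    intro k hk
    induction hk using Nat.decreasingInduction with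
    | self => exact h0
    | of_succ k hk ih =>
      obtain ⟨s, hs, hsF, hF⟩ := hfin k
      have h1 : ∀ t : Set R, t.Finite → t ⊆ F k →
          P (F (k + 1) ⊔ Submodule.span (ZMod 2) t) := by
        intro t ht
        induction t, ht using Set.Finite.induction_on with
        | empty => intro _; rwa [Submodule.span_empty, sup_bot_eq]
        | @insert a t _ _ iht =>
          intro hat
          rw [Set.insert_subset_iff] at hat
          have hP := iht hat.2
          set K := F (k + 1) ⊔ Submodule.span (ZMod 2) t with hK
          have hKF : K ≤ F k := sup_le (hanti k) (Submodule.span_le.2 hat.2)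
          have hFK : F (k + 1) ≤ K := le_sup_left
          have e : F (k + 1) ⊔ Submodule.span (ZMod 2) (insert a t) =
              K ⊔ Submodule.span (ZMod 2) {a} := by
            rw [hK, sup_assoc, ← Submodule.span_union, Set.union_singleton]
          rw [e]
          by_cases haK : a ∈ K
          · rwa [sup_eq_left.2 (Submodule.span_le.2 (Set.singleton_subset_iff.2 haK))]
          · have h0k : F k ≤ F 0 := hmono (Nat.zero_le k)
            -- Between `F (k + 1)` and `F k` every subspace is closed: brackets and squares of
            -- elements of `F k` already lie in `F (k + 1)`.
            exact step K a ((hmono (show k + 1 ≤ n from hk)).trans hFK) (hKF.trans h0k) (h0k hat.1) haK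
              (fun y hy => hFK (hbr k a (h0k hat.1) y (hKF hy)))
              (fun y hy y' hy' => hFK (hbr k y (h0k (hKF hy)) y' (hKF hy')))
              (fun y hy => hFK (hsq k y (hKF hy))) (hFK (hsq k a hat.1)) hP
      have h2 := h1 s hs hsF
      rwa [← le_antisymm hF (sup_le (hanti k) (Submodule.span_le.2 hsF))] at h2
  exact key 0 (Nat.zero_le n)

end Restricted

/-! ### Extending a representation of a restricted Lie algebra -/

section Extension

theorem jacobi_identity {R : Type*} [Ring R] (x u v : R) : x * (u * v - v * u) - (u * v - v * u) * x =
    ((x * u - u * x) * v - v * (x * u - u * x)) + (u * (x * v - v * x) - (x * v - v * x) * u) := by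
  noncomm_ring

theorem matrix_two_eq_iff {B : Type*} {a b c e a' b' c' e' : B} :
    !![a, b; c, e] = !![a', b'; c', e'] ↔ a = a' ∧ b = b' ∧ c = c' ∧ e = e' := by
  constructor
  · intro h
    exact ⟨congrFun (congrFun h 0) 0, congrFun (congrFun h 0) 1, congrFun (congrFun h 1) 0,
      congrFun (congrFun h 1) 1⟩
  · rintro ⟨rfl, rfl, rfl, rfl⟩
    rfl

theorem matrix_two_sub {B : Type*} [Ring B] (a b c e a' b' c' e' : B) :
    !![a, b; c, e] - !![a', b'; c', e'] = !![a - a', b - b'; c - c', e - e'] := by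
  ext i j
  fin_cases i <;> fin_cases j <;> rfl

variable {R : Type*} [Ring R] [Algebra (ZMod 2) R]

/-- There is a linear map to an algebra which is compatible with commutators and squares on `K`,
and whose kernel on `K` is `J`. -/
def HasRep (J K : Submodule (ZMod 2) R) : Prop :=
  ∃ (B : Type) (_ : Ring B) (_ : Algebra (ZMod 2) B) (_ : Nontrivial B) (f : R →ₗ[ZMod 2] B),
    IsRestrictedOn f K ∧ ∀ x ∈ K, f x = 0 ↔ x ∈ J

/-- The zero map, into a nonzero algebra: nontriviality is what later detects the element that is
adjoined. -/
theorem hasRep_self {J : Submodule (ZMod 2) R} : HasRep J J :=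
  ⟨ZMod 2, inferInstance, inferInstance, inferInstance, 0,
    ⟨fun _ _ _ _ => by simp, fun _ _ => by simp⟩, fun x hx => by simp [hx]⟩

variable {B : Type*} [Ring B] [Algebra (ZMod 2) B]

/-- The matrices which extend a linear map along a derivation. -/
def repBlock (f : R →ₗ[ZMod 2] B) (x : R) : R →ₗ[ZMod 2] Matrix (Fin 2) (Fin 2) B where
  toFun v := !![f v, 0; f (x * v - v * x), f v]
  map_add' u v := by
    ext i j
    fin_cases i <;> fin_cases j <;> simp [mul_add, add_mul, add_sub_add_comm]
  map_smul' r v := by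
    ext i j
    fin_cases i <;> fin_cases j <;> simp [← smul_sub]

theorem repBlock_apply (f : R →ₗ[ZMod 2] B) (x v : R) :
    repBlock f x v = !![f v, 0; f (x * v - v * x), f v] := rfl

theorem sub_eq_add_of_algebra (a b : R) : a - b = a + b := by
  rw [sub_eq_add_neg, neg_eq_self_of_algebra]

theorem lie_sq_identity (x u : R) : x * (u * u) - (u * u) * x =
    (x * u - u * x) * u - u * (x * u - u * x) := by
  have h : u * (x * u) + u * (x * u) = 0 := by rw [← two_mul, two_eq_zero_of_algebra, zero_mul]
  simp only [sub_eq_add_of_algebra, add_mul, mul_add, mul_assoc]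
  rw [← add_zero (x * (u * u) + u * (u * x)), ← h]
  abel

theorem sq_lie_identity (x u : R) : x * x * u - u * (x * x) =
    x * (x * u - u * x) - (x * u - u * x) * x := by
  have h : x * (u * x) + x * (u * x) = 0 := by rw [← two_mul, two_eq_zero_of_algebra, zero_mul]
  simp only [sub_eq_add_of_algebra, add_mul, mul_add, mul_assoc]
  rw [← add_zero (x * (x * u) + u * (x * x)), ← h]
  abel

theorem block_lie {B : Type*} [Ring B] (a c a' c' : B) : !![a, 0; c, a] * !![a', 0; c', a'] -
    !![a', 0; c', a'] * !![a, 0; c, a] =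
      !![a * a' - a' * a, 0; (c * a' - a' * c) + (a * c' - c' * a), a * a' - a' * a] := by
  rw [Matrix.mul_fin_two, Matrix.mul_fin_two, matrix_two_sub]
  refine matrix_two_eq_iff.2 ⟨?_, ?_, ?_, ?_⟩
  · rw [zero_mul, zero_mul, add_zero, add_zero]
  · rw [mul_zero, mul_zero, zero_mul, zero_mul, add_zero, sub_zero]
  · abel
  · rw [mul_zero, mul_zero, zero_add, zero_add]

theorem shift_lie_block (s a c : B) : !![0, 1; s, 0] * !![a, 0; c, a] -
    !![a, 0; c, a] * !![0, 1; s, 0] = !![c, 0; s * a - a * s, c] := by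
  rw [Matrix.mul_fin_two, Matrix.mul_fin_two, matrix_two_sub]
  refine matrix_two_eq_iff.2 ⟨?_, ?_, ?_, ?_⟩ <;> simp only [mul_zero, zero_mul, add_zero,
    zero_add, sub_zero, mul_one, one_mul, sub_self, zero_sub]
  rw [neg_eq_self_of_algebra]

/-- The representation of `K` is induced to `K + 𝔽₂ x`: the underlying module doubles, `x` acts by a
matrix of square `f(x²)`, and `y` in `K` by `f y` on the diagonal with `f [x, y]` below it. The
Jacobi identity and its restricted forms `[x, u²] = [[x, u], u]` and `[x², u] = [x, [x, u]]` give
the compatibilities. The kernel does not change because `J` is stable under bracketing with `x`. -/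
theorem HasRep.step {J K : Submodule (ZMod 2) R} {x : R} (hJK : J ≤ K) (hxK : x ∉ K)
    (hxJ : ∀ y ∈ J, x * y - y * x ∈ J) (hbr : ∀ y ∈ K, x * y - y * x ∈ K)
    (hKK : ∀ y ∈ K, ∀ y' ∈ K, y * y' - y' * y ∈ K) (hKsq : ∀ y ∈ K, y * y ∈ K)
    (hsq : x * x ∈ K) (h : HasRep J K) : HasRep J (K ⊔ Submodule.span (ZMod 2) {x}) := by
  obtain ⟨B, _, _, _, f, hf, hker⟩ := h
  -- A linear form that vanishes on `K` and is `1` at `x`; it reads the coefficient of `x` and makes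
  -- `f'` linear on the whole algebra.
  obtain ⟨c₀, hc₀, hcK⟩ := Submodule.exists_le_ker_of_notMem hxK
  have hc1 : c₀ x = 1 := by
    generalize c₀ x = r at hc₀
    revert r; decide
  have hc0 : ∀ y ∈ K, c₀ y = 0 := fun y hy => hcK hy
  let X : Matrix (Fin 2) (Fin 2) B := !![0, 1; f (x * x), 0]
  let f' : R →ₗ[ZMod 2] Matrix (Fin 2) (Fin 2) B :=
    (repBlock f x).comp (LinearMap.id - c₀.smulRight x) + c₀.smulRight X
  have hf' : ∀ v, f' v = repBlock f x (v - c₀ v • x) + c₀ v • X := fun v => rfl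
  have hK : ∀ y ∈ K, f' y = repBlock f x y := fun y hy => by
    rw [hf', hc0 y hy, zero_smul, zero_smul, sub_zero, add_zero]
  have hX : f' x = X := by
    rw [hf', hc1, one_smul, one_smul, sub_self, map_zero, zero_add]
  have hxy : ∀ y ∈ K, f' (x * y - y * x) = f' x * f' y - f' y * f' x := fun y hy => by
    rw [hK _ (hbr y hy), hX, hK y hy, repBlock_apply, repBlock_apply, shift_lie_block,
      ← sq_lie_identity, hf.map_lie _ hsq _ hy]
  refine ⟨Matrix (Fin 2) (Fin 2) B, inferInstance, inferInstance, inferInstance, f', ?_, ?_⟩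
  · have hspan : K ⊔ Submodule.span (ZMod 2) {x} = Submodule.span (ZMod 2) (K ∪ {x}) := by
      rw [Submodule.span_union, Submodule.span_eq]
    rw [hspan]
    refine IsRestrictedOn.span ⟨?_, ?_⟩
    · rintro u (hu | rfl) v (hv | rfl)
      · rw [hK _ (hKK u hu v hv), hK u hu, hK v hv, repBlock_apply, repBlock_apply,
          repBlock_apply, block_lie, jacobi_identity, map_add, hf.map_lie _ hu _ hv,
          hf.map_lie _ (hbr u hu) _ hv, hf.map_lie _ hu _ (hbr v hv)]
      · rw [← neg_sub, map_neg, hxy u hu, neg_sub]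
      · exact hxy v hv
      · rw [sub_self, sub_self, map_zero]
    · rintro u (hu | rfl)
      · rw [hK _ (hKsq u hu), hK u hu, repBlock_apply, repBlock_apply, hf.map_sq u hu,
          lie_sq_identity, hf.map_lie _ (hbr u hu) _ hu, Matrix.mul_fin_two]
        refine matrix_two_eq_iff.2 ⟨?_, ?_, ?_, ?_⟩
        · rw [zero_mul, add_zero]
        · rw [mul_zero, zero_mul, add_zero]
        · rw [sub_eq_add_neg, neg_eq_self_of_algebra]
        · rw [mul_zero, zero_add]
      · rw [hK _ hsq, hX, repBlock_apply, Matrix.mul_fin_two]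
        refine matrix_two_eq_iff.2 ⟨?_, ?_, ?_, ?_⟩
        · rw [zero_mul, zero_add, one_mul]
        · rw [zero_mul, mul_zero, add_zero]
        · rw [mul_zero, zero_mul, add_zero, mul_assoc, sub_self, map_zero]
        · rw [mul_one, mul_zero, add_zero]
  · intro v hv
    obtain ⟨u, hu, w, hw, rfl⟩ := Submodule.mem_sup.1 hv
    obtain ⟨r, rfl⟩ := Submodule.mem_span_singleton.1 hw
    have hr : ∀ r : ZMod 2, r = 0 ∨ r = 1 := by decide
    have e : f' (u + r • x) = repBlock f x u + r • X := by
      rw [map_add, map_smul, hK u hu, hX]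
    constructor
    · intro h0
      rw [e] at h0
      obtain rfl | rfl := hr r
      · rw [zero_smul, add_zero] at *
        exact (hker u hu).1 (congrFun (congrFun h0 0) 0)
      · rw [one_smul] at h0
        -- The upper right entry is the coefficient of `x`, so nothing outside `K` is killed.
        have := congrFun (congrFun h0 0) 1
        change (0 : B) + 1 = 0 at this
        rw [zero_add] at this
        exact absurd this one_ne_zero
    · intro hJ
      obtain rfl | rfl := hr r
      · rw [zero_smul, add_zero] at *
        rw [hK u hu, repBlock_apply, (hker u hu).2 hJ, (hker _ (hbr u hu)).2 (hxJ u hJ)]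
        exact (Matrix.eta_fin_two 0).symm
      · refine absurd ?_ hxK
        rw [one_smul] at hJ
        have := sub_mem (hJK hJ) hu
        rwa [add_sub_cancel_left] at this

end Extension

end

end DeltaRAAG

namespace DeltaRAAG

noncomputable section

/-! ### Homogeneous components of noncommutative polynomials -/

section Components

variable {d : ℕ}

variable (d) in
/-- The homomorphism `Xᵢ ↦ Xᵢ t`. -/
def degHom : NCPoly d →ₐ[ZMod 2] Polynomial (NCPoly d) :=
  FreeAlgebra.lift (ZMod 2) fun i => Polynomial.monomial 1 (var i)

theorem degHom_var (i : Fin (d + 1)) : degHom d (var i) = Polynomial.monomial 1 (var i) :=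
  FreeAlgebra.lift_ι_apply _ _

/-- The homogeneous component of degree `n`. -/
def comp (n : ℕ) : NCPoly d →ₗ[ZMod 2] NCPoly d where
  toFun x := (degHom d x).coeff n
  map_add' x y := by rw [map_add, Polynomial.coeff_add]
  map_smul' r x := by rw [map_smul, Polynomial.coeff_smul, RingHom.id_apply]

theorem comp_apply (n : ℕ) (x : NCPoly d) : comp n x = (degHom d x).coeff n := rfl

theorem comp_mul (n : ℕ) (x y : NCPoly d) :
    comp n (x * y) = ∑ p ∈ Finset.HasAntidiagonal.antidiagonal n, comp p.1 x * comp p.2 y := by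
  rw [comp_apply, map_mul, Polynomial.coeff_mul]
  rfl

theorem degHom_of_mem {n : ℕ} {x : NCPoly d} (hx : x ∈ ncHomogeneous d n) :
    degHom d x = Polynomial.monomial n x := by
  have hlin : ∀ m ∈ Submodule.span (ZMod 2) (Set.range (var (d := d))),
      degHom d m = Polynomial.monomial 1 m := fun m hm => by
    induction hm using Submodule.span_induction with
    | mem m hm =>
      obtain ⟨i, rfl⟩ := hm
      exact degHom_var i
    | zero => rw [map_zero, map_zero]
    | add a b _ _ ha hb => rw [map_add, map_add, ha, hb]
    | smul r a _ ha => rw [map_smul, ha, Polynomial.smul_monomial]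
  induction hx using Submodule.pow_induction_on_right' with
  | algebraMap r =>
    rw [AlgHom.commutes]
    rfl
  | add a b i _ _ ha hb => rw [map_add, map_add, ha, hb]
  | mul_mem i a _ ha m hm => rw [map_mul, ha, hlin m hm, Polynomial.monomial_mul_monomial]

theorem comp_of_mem {n : ℕ} {x : NCPoly d} (hx : x ∈ ncHomogeneous d n) (k : ℕ) :
    comp k x = if n = k then x else 0 := by
  rw [comp_apply, degHom_of_mem hx, Polynomial.coeff_monomial]

theorem comp_mem (n : ℕ) (x : NCPoly d) : comp n x ∈ ncHomogeneous d n := by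
  classical
  induction x using FreeAlgebra.induction generalizing n with
  | grade0 r =>
    have h : algebraMap (ZMod 2) (NCPoly d) r ∈ ncHomogeneous d 0 := by
      rw [ncHomogeneous, pow_zero]
      exact Submodule.algebraMap_mem r
    rw [comp_of_mem h]
    split_ifs with h0
    · rwa [← h0]
    · exact zero_mem _
  | grade1 i =>
    rw [comp_of_mem (var_mem_ncHomogeneous i)]
    split_ifs with h0
    · rw [← h0]; exact var_mem_ncHomogeneous i
    · exact zero_mem _
  | mul a b ha hb =>
    rw [comp_mul]
    refine Submodule.sum_mem _ fun p hp => ?_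
    rw [← Finset.HasAntidiagonal.mem_antidiagonal.1 hp]
    exact mul_mem_ncHomogeneous (ha _) (hb _)
  | add a b ha hb => rw [map_add]; exact add_mem (ha n) (hb n)

theorem sum_comp (x : NCPoly d) : ∑ n ∈ (degHom d x).support, comp n x = x := by
  let ev : Polynomial (NCPoly d) →+* NCPoly d :=
    Polynomial.eval₂RingHom' (RingHom.id _) 1 fun _ => Commute.one_right _
  have hev : ∀ p, ev p = ∑ n ∈ p.support, p.coeff n := fun p => by
    change Polynomial.eval₂ _ _ p = _
    rw [Polynomial.eval₂_eq_sum, Polynomial.sum]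
    simp
  have h : ev (degHom d x) = x := by
    have hm : ∀ n a, ev (Polynomial.monomial n a) = a := fun n a => by
      change Polynomial.eval₂ _ _ _ = _
      simp
    induction x using FreeAlgebra.induction with
    | grade0 r => rw [AlgHom.commutes]; exact hm 0 _
    | grade1 i => rw [degHom_var, hm]
    | mul a b ha hb => rw [map_mul, map_mul, ha, hb]
    | add a b ha hb => rw [map_add, map_add, ha, hb]
  exact (hev _).symm.trans h

theorem mem_of_forall_comp_mem {M : Submodule (ZMod 2) (NCPoly d)} {x : NCPoly d}
    (h : ∀ n, comp n x ∈ M) : x ∈ M := by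
  rw [← sum_comp x]
  exact Submodule.sum_mem _ fun n _ => h n

variable (d) in
/-- The noncommutative polynomials without terms of degree less than `n`. -/
def degSub (n : ℕ) : Submodule (ZMod 2) (NCPoly d) := ⨅ i : Fin n, LinearMap.ker (comp (d := d) i)

theorem mem_degSub {n : ℕ} {x : NCPoly d} : x ∈ degSub d n ↔ ∀ i < n, comp i x = 0 := by
  rw [degSub, Submodule.mem_iInf]
  exact ⟨fun h i hi => h ⟨i, hi⟩, fun h i => h i i.2⟩

theorem mul_mem_degSub {m n : ℕ} {x y : NCPoly d} (hx : x ∈ degSub d m) (hy : y ∈ degSub d n) :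
    x * y ∈ degSub d (m + n) := by
  rw [mem_degSub] at *
  intro i hi
  rw [comp_mul]
  refine Finset.sum_eq_zero fun p hp => ?_
  have := Finset.HasAntidiagonal.mem_antidiagonal.1 hp
  by_cases h : p.1 < m
  · rw [hx _ h, zero_mul]
  · rw [hy _ (by omega), mul_zero]

theorem degSub_anti {m n : ℕ} (h : m ≤ n) : degSub d n ≤ degSub d m := fun _ hx =>
  mem_degSub.2 fun i hi => mem_degSub.1 hx i (hi.trans_le h)

theorem lie_mem_degSub {m n : ℕ} {x y : NCPoly d} (hx : x ∈ degSub d m) (hy : y ∈ degSub d n) :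
    x * y - y * x ∈ degSub d (m + n) :=
  sub_mem (mul_mem_degSub hx hy) (add_comm n m ▸ mul_mem_degSub hy hx)

theorem finite_ncHomogeneous (n : ℕ) : (ncHomogeneous d n : Set (NCPoly d)).Finite := by
  have h : (ncHomogeneous d n).FG := by
    rw [ncHomogeneous]
    exact Submodule.FG.pow (Submodule.fg_span (Set.finite_range _)) n
  have : Module.Finite (ZMod 2) (ncHomogeneous d n) := Module.Finite.iff_fg.2 h
  exact Set.finite_coe_iff.1 (Module.finite_of_finite (ZMod 2) (M := ncHomogeneous d n))

/-- The homogeneous elements of a subspace. -/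
def homGens (M : Submodule (ZMod 2) (NCPoly d)) : Set (NCPoly d) :=
  {x | x ∈ M ∧ ∃ n, x ∈ ncHomogeneous d n}

/-- The span of the homogeneous elements of a subspace. -/
def homSpan (M : Submodule (ZMod 2) (NCPoly d)) : Submodule (ZMod 2) (NCPoly d) :=
  Submodule.span (ZMod 2) (homGens M)

theorem homSpan_le (M : Submodule (ZMod 2) (NCPoly d)) : homSpan M ≤ M :=
  Submodule.span_le.2 fun _ h => h.1

/-- Turns generation by homogeneous elements into closure under taking components. -/
theorem comp_mem_of_le_homSpan {M : Submodule (ZMod 2) (NCPoly d)} (hM : M ≤ homSpan M)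
    {x : NCPoly d} (hx : x ∈ M) (n : ℕ) : comp n x ∈ M := by
  have h : homSpan M ≤ M.comap (comp n) := Submodule.span_le.2 fun x hx => by
    obtain ⟨hx, k, hk⟩ := hx
    change comp n x ∈ M
    rw [comp_of_mem hk]
    split_ifs
    · exact hx
    · exact zero_mem _
  exact h (hM hx)

theorem restrictedFree_le {K : Submodule (ZMod 2) (NCPoly d)} (hv : ∀ i, var i ∈ K)
    (hl : ∀ x ∈ K, ∀ y ∈ K, x * y - y * x ∈ K) (hs : ∀ x ∈ K, x * x ∈ K) :
    (restrictedFree d).toSubmodule ≤ K := fun _ hx =>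
  mem_restrictedFree.1 hx { K with lie_mem' := fun {x y} hx hy => hl x hx y hy } hv hs

/-- The span of the homogeneous Lie elements contains the variables and is closed under brackets and
squares, so minimality applies. -/
theorem restrictedFree_le_homSpan :
    (restrictedFree d).toSubmodule ≤ homSpan (restrictedFree d).toSubmodule := by
  have hl : ∀ x ∈ homSpan (restrictedFree d).toSubmodule,
      ∀ y ∈ homSpan (restrictedFree d).toSubmodule,
        x * y - y * x ∈ homSpan (restrictedFree d).toSubmodule := fun x hx y hy =>
    lie_mem_of_span (S := homGens _) (T := homGens _) (fun x ⟨hx, n, hn⟩ y ⟨hy, m, hm⟩ => Submodule.subset_span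
      ⟨(restrictedFree d).lie_mem hx hy, n + m, sub_mem (mul_mem_ncHomogeneous hn hm)
        (add_comm m n ▸ mul_mem_ncHomogeneous hm hn)⟩) hx hy
  refine restrictedFree_le (fun i => Submodule.subset_span
    ⟨var_mem_restrictedFree i, 1, var_mem_ncHomogeneous i⟩) hl fun x hx => ?_
  exact sq_mem_of_span (S := homGens _) (fun x ⟨hx, n, hn⟩ => Submodule.subset_span
    ⟨sq_mem_restrictedFree hx, n + n, mul_mem_ncHomogeneous hn hn⟩) hl hx

theorem comp_mem_restrictedFree {x : NCPoly d} (hx : x ∈ restrictedFree d) (n : ℕ) :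
    comp n x ∈ restrictedFree d :=
  comp_mem_of_le_homSpan restrictedFree_le_homSpan hx n

theorem restrictedFree_le_degSub : (restrictedFree d).toSubmodule ≤ degSub d 1 := by
  have h2 : degSub d (1 + 1) ≤ degSub d 1 := degSub_anti (by omega)
  refine restrictedFree_le (fun i => mem_degSub.2 fun k hk => ?_)
    (fun x hx y hy => h2 (lie_mem_degSub hx hy)) (fun x hx => h2 (mul_mem_degSub hx hx))
  rw [comp_of_mem (var_mem_ncHomogeneous i), if_neg (by omega)]

end Components

/-! ### The restricted Lie algebra of relations -/

section Relations

variable {d : ℕ} {Γ : SimpleGraph (Fin d)} (z : Fin d → RAAG Γ)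

/-- The restricted Lie ideal `𝓙_z` as a subspace of the free algebra. -/
def subJ : Submodule (ZMod 2) (NCPoly d) :=
  (idealJ z).toSubmodule.map (restrictedFree d).toSubmodule.subtype

variable {z}

theorem mem_subJ {x : ↥(restrictedFree d)} : x.1 ∈ subJ z ↔ x ∈ idealJ z := by
  constructor
  · rintro ⟨y, hy, e⟩
    rwa [← Subtype.ext e]
  · exact fun h => ⟨x, h, rfl⟩

theorem mem_idealJ {x : ↥(restrictedFree d)} : x ∈ idealJ z ↔
    ∀ K : LieIdeal (ZMod 2) ↥(restrictedFree d),
      (∀ x : ↥(restrictedFree d), IsRelator z x.1 → x ∈ K) → (∀ x ∈ K, restrictedSq x ∈ K) →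
        x ∈ K := by
  rw [idealJ, ← SetLike.mem_coe, LieSubmodule.coe_sInf, Set.mem_iInter₂]
  exact ⟨fun h K h1 h2 => h K ⟨h1, h2⟩, fun h K hK => h K hK.1 hK.2⟩

theorem subJ_le : subJ z ≤ (restrictedFree d).toSubmodule := by
  rintro _ ⟨x, -, rfl⟩
  exact x.2

theorem IsRelator.mem_subJ {r : NCPoly d} (h : IsRelator z r) : r ∈ subJ z :=
  DeltaRAAG.mem_subJ (x := ⟨r, h.mem_restrictedFree⟩).2 (mem_idealJ.2 fun _ h1 _ => h1 _ h)

theorem lie_mem_subJ {x y : NCPoly d} (hx : x ∈ restrictedFree d) (hy : y ∈ subJ z) :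
    x * y - y * x ∈ subJ z := by
  obtain ⟨y, hy, rfl⟩ := hy
  exact ⟨⁅(⟨x, hx⟩ : ↥(restrictedFree d)), y⁆, lie_mem_right (ZMod 2) _ (idealJ z) _ _ hy, rfl⟩

theorem sq_mem_subJ {x : NCPoly d} (hx : x ∈ subJ z) : x * x ∈ subJ z := by
  obtain ⟨x, hx, rfl⟩ := hx
  exact ⟨restrictedSq x, mem_idealJ.2 fun K h1 h2 => h2 x (mem_idealJ.1 hx K h1 h2), rfl⟩

theorem subJ_le_of {K : Submodule (ZMod 2) (NCPoly d)} (hr : ∀ r, IsRelator z r → r ∈ K)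
    (hl : ∀ x ∈ restrictedFree d, ∀ y ∈ K, x * y - y * x ∈ K) (hs : ∀ x ∈ K, x * x ∈ K) :
    subJ z ≤ K := by
  rintro _ ⟨x, hx, rfl⟩
  exact mem_idealJ.1 hx
    { K.comap (restrictedFree d).toSubmodule.subtype with
      lie_mem := fun {x y} hy => hl x.1 x.2 y.1 hy } (fun x hx => hr _ hx) (fun x hx => hs _ hx)

/-- The relators are homogeneous of degree two, hence the ideal they generate is graded. -/
theorem subJ_le_homSpan : subJ z ≤ homSpan (subJ z) := by
  have hl : ∀ x ∈ restrictedFree d, ∀ y ∈ homSpan (subJ z), x * y - y * x ∈ homSpan (subJ z) :=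
    fun x hx y hy => lie_mem_of_span (S := homGens _) (T := homGens _) (fun x ⟨hx, n, hn⟩ y ⟨hy, m, hm⟩ => Submodule.subset_span
      ⟨lie_mem_subJ hx hy, n + m, sub_mem (mul_mem_ncHomogeneous hn hm)
        (add_comm m n ▸ mul_mem_ncHomogeneous hm hn)⟩) (restrictedFree_le_homSpan hx) hy
  refine subJ_le_of (fun r hr => Submodule.subset_span ⟨hr.mem_subJ, 2, hr.mem_ncHomogeneous⟩) hl
    fun x hx => ?_
  exact sq_mem_of_span (S := homGens _) (fun x ⟨hx, n, hn⟩ => Submodule.subset_span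
    ⟨sq_mem_subJ hx, n + n, mul_mem_ncHomogeneous hn hn⟩)
      (fun x hx y hy => hl x (subJ_le (homSpan_le _ hx)) y hy) hx

variable (z) in
/-- The restricted Lie ideal `𝓙_z` enlarged by the elements of degree greater than `k`. -/
def flagJ (k : ℕ) : Submodule (ZMod 2) (NCPoly d) :=
  subJ z ⊔ ((restrictedFree d).toSubmodule ⊓ degSub d (k + 1))

theorem flagJ_zero : flagJ z 0 = (restrictedFree d).toSubmodule := by
  rw [flagJ, zero_add, inf_eq_left.2 restrictedFree_le_degSub, sup_eq_right]
  exact subJ_le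

theorem flagJ_le (k : ℕ) : flagJ z k ≤ (restrictedFree d).toSubmodule :=
  sup_le subJ_le inf_le_left

theorem flagJ_succ_le (k : ℕ) : flagJ z (k + 1) ≤ flagJ z k :=
  sup_le_sup_left (inf_le_inf_left _ (degSub_anti (Nat.le_succ _))) _

/-- Elements of `𝓛` have no constant term, so bracketing raises the degree of the second summand
while `𝓙_z` absorbs the first. -/
theorem lie_mem_flagJ {k : ℕ} {x y : NCPoly d} (hx : x ∈ restrictedFree d) (hy : y ∈ flagJ z k) :
    x * y - y * x ∈ flagJ z (k + 1) := by
  obtain ⟨j, hj, r, hr, rfl⟩ := Submodule.mem_sup.1 hy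
  rw [mul_add, add_mul, add_sub_add_comm]
  refine Submodule.add_mem_sup (lie_mem_subJ hx hj) ⟨(restrictedFree d).lie_mem hx hr.1, ?_⟩
  have := lie_mem_degSub (restrictedFree_le_degSub hx) hr.2
  rwa [add_comm 1] at this

theorem sq_mem_flagJ {k : ℕ} {x : NCPoly d} (hx : x ∈ flagJ z k) : x * x ∈ flagJ z (k + 1) := by
  obtain ⟨j, hj, r, hr, rfl⟩ := Submodule.mem_sup.1 hx
  rw [add_sq_identity]
  refine add_mem (Submodule.add_mem_sup (sq_mem_subJ hj) ⟨sq_mem_restrictedFree hr.1, ?_⟩)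
    (lie_mem_flagJ (subJ_le hj) (Submodule.mem_sup_right hr))
  exact degSub_anti (by omega) (mul_mem_degSub hr.2 hr.2)

theorem sub_comp_mem_degSub {k : ℕ} {x : NCPoly d} (hx : x ∈ degSub d k) :
    x - comp k x ∈ degSub d (k + 1) := by
  rw [mem_degSub] at *
  intro i hi
  rw [map_sub, comp_of_mem (comp_mem k x)]
  split_ifs with h
  · rw [h, sub_self]
  · rw [hx i (by omega), sub_zero]

theorem exists_finite_flag (k : ℕ) : ∃ s : Set (NCPoly d), s.Finite ∧
    s ⊆ ((restrictedFree d).toSubmodule ⊓ degSub d k : Submodule (ZMod 2) (NCPoly d)) ∧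
      (restrictedFree d).toSubmodule ⊓ degSub d k ≤
        ((restrictedFree d).toSubmodule ⊓ degSub d (k + 1)) ⊔ Submodule.span (ZMod 2) s := by
  refine ⟨{x | x ∈ restrictedFree d ∧ x ∈ ncHomogeneous d k},
    (finite_ncHomogeneous k).subset fun x h => h.2, fun x h => ⟨h.1, ?_⟩, fun x hx => ?_⟩
  · refine mem_degSub.2 fun i hi => ?_
    rw [comp_of_mem h.2, if_neg (by omega)]
  · rw [← sub_add_cancel x (comp k x)]
    exact Submodule.add_mem_sup ⟨sub_mem hx.1 (comp_mem_restrictedFree hx.1 k),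
      sub_comp_mem_degSub hx.2⟩ (Submodule.subset_span ⟨comp_mem_restrictedFree hx.1 k, comp_mem k x⟩)

/-- Cutting off at degree `n` makes the codimension in `𝓛` finite, so finitely many applications of
`HasRep.step` lead from `flagJ z n` to all of `𝓛`. -/
theorem hasRep_flagJ (n : ℕ) : HasRep (flagJ z n) (restrictedFree d).toSubmodule := by
  rw [← flagJ_zero (z := z)]
  refine flag_induction (F := flagJ z)
    (fun k x hx y hy => lie_mem_flagJ (flagJ_le 0 hx) hy) (fun k x hx => sq_mem_flagJ hx)
    flagJ_succ_le (fun k => ?_) n hasRep_self ?_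
  · obtain ⟨s, hs, hsF, hF⟩ := exists_finite_flag (d := d) (k + 1)
    refine ⟨s, hs, hsF.trans (SetLike.coe_subset_coe.2 le_sup_right), ?_⟩
    rw [flagJ, flagJ, sup_assoc]
    exact sup_le_sup_left hF _
  · intro K x hJK hK0 hx hxK h1 h2 h3 h4 hP
    exact hP.step hJK hxK (fun y hy => flagJ_succ_le n (lie_mem_flagJ (flagJ_le 0 hx) hy)) h1 h2 h3 h4

/-- A restricted form of the Poincaré–Birkhoff–Witt theorem: an element of the free restricted
Lie algebra which vanishes in `𝓔_z` belongs to `𝓙_z`. -/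
theorem mem_subJ_of_mk_eq_zero {x : NCPoly d} (hx : x ∈ restrictedFree d) (h : EZ.mk z x = 0) :
    x ∈ subJ z := by
  have key : ∀ n, x ∈ flagJ z n := fun n => by
    obtain ⟨B, _, _, _, f, hf, hker⟩ := hasRep_flagJ (z := z) n
    -- The algebra map with the same values on the variables agrees with `f` on `𝓛`, hence kills the
    -- relators and factors through `𝓔_z`.
    let g : NCPoly d →ₐ[ZMod 2] B := FreeAlgebra.lift (ZMod 2) fun i => f (var i)
    have hfg : (restrictedFree d).toSubmodule ≤
        (restrictedFree d).toSubmodule ⊓ LinearMap.eqLocus f g.toLinearMap := by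
      refine restrictedFree_le (fun i => ⟨var_mem_restrictedFree i, ?_⟩) ?_ ?_
      · exact (FreeAlgebra.lift_ι_apply (R := ZMod 2) (fun i => f (var i)) i).symm
      · rintro x ⟨hx, ex⟩ y ⟨hy, ey⟩
        refine ⟨(restrictedFree d).lie_mem hx hy, ?_⟩
        have ex' : f x = g x := ex
        have ey' : f y = g y := ey
        change f (x * y - y * x) = g (x * y - y * x)
        rw [hf.map_lie x hx y hy, map_sub, map_mul, map_mul, ex', ey']
      · rintro x ⟨hx, ex⟩
        refine ⟨sq_mem_restrictedFree hx, ?_⟩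
        have ex' : f x = g x := ex
        change f (x * x) = g (x * x)
        rw [hf.map_sq x hx, map_mul, ex']
    have hgr : ∀ r, IsRelator z r → g r = 0 := fun r hr => by
      have h1 : f r = g r := (hfg hr.mem_restrictedFree).2
      rw [← h1]
      exact (hker r hr.mem_restrictedFree).2 (Submodule.mem_sup_left hr.mem_subJ)
    refine (hker x hx).1 ?_
    have h1 : f x = g x := (hfg hx).2
    rw [h1, ← EZ.lift_mk g hgr, h, map_zero]
  -- The cut-off is removed degree by degree: the component of degree `n` is not affected by terms
  -- of degree above `n`, and `𝓙_z` is graded.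
  refine mem_of_forall_comp_mem fun n => ?_
  obtain ⟨j, hj, r, hr, rfl⟩ := Submodule.mem_sup.1 (key n)
  rw [map_add, mem_degSub.1 hr.2 n (Nat.lt_succ_self n), add_zero]
  exact comp_mem_of_le_homSpan subJ_le_homSpan hj n

theorem mk_eq_zero_of_mem_subJ {x : NCPoly d} (h : x ∈ subJ z) : EZ.mk z x = 0 := by
  have h1 : subJ z ≤ LinearMap.ker (EZ.mk z).toLinearMap := by
    refine subJ_le_of (fun r hr => EZ.mk_eq_zero_of_isRelator hr) (fun x _ y hy => ?_) fun x hx => ?_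
    · have hy' : EZ.mk z y = 0 := hy
      change EZ.mk z _ = 0
      rw [map_sub, map_mul, map_mul, hy', mul_zero, zero_mul, sub_zero]
    · have hx' : EZ.mk z x = 0 := hx
      change EZ.mk z _ = 0
      rw [map_mul, hx', mul_zero]
  exact h1 h

end Relations

end

end DeltaRAAG

namespace DeltaRAAG

noncomputable section

/-! ### The augmentation ideal of a finite 2-group -/

section GroupAlgebra

variable (P : Type*) [Group P]

/-- The augmentation ideal of the group algebra. -/
abbrev augKer : Ideal (MonoidAlgebra (ZMod 2) P) := RingHom.ker (augMap P)

variable {P}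

/-- The 2-group `P` acts on the nonzero finite quotient by `K`, whose order is even. As `0` is
fixed, there is another fixed vector, and fixed vectors are killed by the augmentation ideal. -/
theorem exists_mul_mem_of_ne_top [Finite P] (hP : IsPGroup 2 P)
    {K : Ideal (MonoidAlgebra (ZMod 2) P)} (hK : K ≠ ⊤) :
    ∃ a ∉ K, ∀ x ∈ augKer P, x * a ∈ K := by
  have : Module.Finite (ZMod 2) (MonoidAlgebra (ZMod 2) P) :=
    Module.Finite.of_basis (MonoidAlgebra.basis P (ZMod 2))
  have : Finite (MonoidAlgebra (ZMod 2) P) := Module.finite_of_finite (ZMod 2)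
  have : Fact (Nat.Prime 2) := ⟨Nat.prime_two⟩
  let V := MonoidAlgebra (ZMod 2) P ⧸ K
  have : Nontrivial V := Submodule.Quotient.nontrivial_iff.2 hK
  have : Finite V := Finite.of_surjective _ (Submodule.mkQ_surjective K)
  have : Module.Finite (ZMod 2) V := Module.Finite.of_finite
  let act : MulAction P V := MulAction.compHom V (MonoidAlgebra.of (ZMod 2) P)
  have hsmul : ∀ (g : P) (v : V), g • v = MonoidAlgebra.of (ZMod 2) P g • v := fun _ _ => rfl
  have hdvd : 2 ∣ Nat.card V := by
    rw [Module.natCard_eq_pow_finrank (K := ZMod 2) (V := V), Nat.card_zmod]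
    exact dvd_pow_self 2 (Module.finrank_pos (R := ZMod 2) (M := V)).ne'
  obtain ⟨b, hb, hne⟩ := hP.exists_fixed_point_of_prime_dvd_card_of_fixed_point V hdvd
    (a := 0) (fun g => by rw [hsmul, smul_zero])
  obtain ⟨a, rfl⟩ := Submodule.mkQ_surjective K b
  refine ⟨a, fun ha => hne ((Submodule.Quotient.mk_eq_zero K).2 ha).symm, fun x hx => ?_⟩
  have h := lift_sub_augMap_mem (Submodule.comap (LinearMap.mulRight (ZMod 2) a)
    (K.restrictScalars (ZMod 2))) (MonoidAlgebra.of (ZMod 2) P) (fun g => by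
      have hg : g • K.mkQ a = K.mkQ a := hb g
      rw [hsmul, ← map_smul, ← sub_eq_zero, ← map_sub] at hg
      have := (Submodule.Quotient.mk_eq_zero K).1 hg
      change (MonoidAlgebra.of (ZMod 2) P g - 1) * a ∈ K
      rwa [sub_mul, one_mul]) x
  have e : MonoidAlgebra.lift (ZMod 2) _ P (MonoidAlgebra.of (ZMod 2) P) =
      AlgHom.id (ZMod 2) (MonoidAlgebra (ZMod 2) P) := by
    ext; simp
  rw [(hx : augMap P x = 0), map_zero, sub_zero, e] at h
  exact h

theorem exists_augKer_pow_eq_bot [Finite P] (hP : IsPGroup 2 P) : ∃ n, augKer P ^ n = ⊥ := by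
  have : Module.Finite (ZMod 2) (MonoidAlgebra (ZMod 2) P) :=
    Module.Finite.of_basis (MonoidAlgebra.basis P (ZMod 2))
  have : Finite (MonoidAlgebra (ZMod 2) P) := Module.finite_of_finite (ZMod 2)
  -- The right annihilators of the powers of the augmentation ideal. The chain stabilises, and the
  -- previous lemma forces its limit to be everything.
  let K : ℕ →o Ideal (MonoidAlgebra (ZMod 2) P) :=
    { toFun := fun n =>
        { carrier := {a | ∀ x ∈ augKer P ^ n, x * a = 0}
          add_mem' := fun {a b} ha hb x hx => by rw [mul_add, ha x hx, hb x hx, add_zero]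
          zero_mem' := fun x _ => mul_zero x
          smul_mem' := fun r a ha x hx => by
            rw [smul_eq_mul, ← mul_assoc]
            exact ha _ ((augKer P ^ n).mul_mem_right r hx) }
      monotone' := fun m n hmn a ha x hx => ha x (Ideal.pow_le_pow_right hmn hx) }
  obtain ⟨n, hn⟩ := monotone_stabilizes_iff_noetherian.2 inferInstance K
  refine ⟨n, ?_⟩
  have htop : K n = ⊤ := by
    by_contra hne
    obtain ⟨a, ha, haI⟩ := exists_mul_mem_of_ne_top hP hne
    refine ha ?_
    rw [hn (n + 1) (Nat.le_succ n)]
    intro x hx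
    rw [Ideal.IsTwoSided.pow_add, Submodule.pow_one] at hx
    refine Submodule.smul_induction_on (p := fun x => x * a = 0) hx (fun u hu v hv => ?_)
      (fun u v hu hv => ?_)
    · rw [smul_eq_mul, mul_assoc]
      exact haI v hv u hu
    · rw [add_mul, hu, hv, add_zero]
  rw [eq_bot_iff]
  intro x hx
  have h1 : (1 : MonoidAlgebra (ZMod 2) P) ∈ K n := htop ▸ Submodule.mem_top
  have := h1 x hx
  rwa [mul_one] at this

end GroupAlgebra

/-! ### Dimensions of graded algebras -/

section Dimension

variable {A : Type*} [Ring A] [Algebra (ZMod 2) A]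

theorem finrank_eq_sum_grPiece [Module.Finite (ZMod 2) A] (I : Ideal A) (n : ℕ) :
    Module.finrank (ZMod 2) A = ∑ i ∈ Finset.range n, Module.finrank (ZMod 2) (GrPiece I i) +
      Module.finrank (ZMod 2) (powSub I n) := by
  induction n with
  | zero =>
    have : powSub I 0 = ⊤ := eq_top_iff.2 fun a _ => mem_powSub_zero I a
    rw [this, Finset.sum_range_zero, zero_add, finrank_top]
  | succ n ih =>
    have h := Submodule.finrank_quotient_add_finrank ((powSub I (n + 1)).submoduleOf (powSub I n))
    rw [(Submodule.submoduleOfEquivOfLe (powSub_anti I (Nat.le_succ n))).finrank_eq] at h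
    rw [Finset.sum_range_succ, add_assoc]
    exact ih.trans (congrArg _ h.symm)

/-- The dimension telescopes along the powers of `I`, and only the pieces of degree below `n` are
needed. -/
theorem finrank_le_finrank_gr [Module.Finite (ZMod 2) A] {I : Ideal A} {n : ℕ} (hn : I ^ n = ⊥)
    [Module.Finite (ZMod 2) (⨁ n, GrPiece I n)] :
    Module.finrank (ZMod 2) A ≤ Module.finrank (ZMod 2) (⨁ n, GrPiece I n) := by
  have h0 : powSub I n = ⊥ := by
    rw [eq_bot_iff]
    intro a ha
    have ha' : a ∈ I ^ n := ha
    rwa [hn] at ha'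
  have hfin : ∀ i, Module.Finite (ZMod 2) (GrPiece I i) := fun i =>
    inferInstanceAs (Module.Finite (ZMod 2)
      (↥(powSub I i) ⧸ (powSub I (i + 1)).submoduleOf (powSub I i)))
  let T : (⨁ n, GrPiece I n) →ₗ[ZMod 2] ∀ i : Fin n, GrPiece I i :=
    LinearMap.pi fun i => DirectSum.component (ZMod 2) ℕ (GrPiece I) i
  have hT : Function.Surjective T := by
    intro v
    refine ⟨∑ i : Fin n, DirectSum.of (GrPiece I) i (v i), funext fun j => ?_⟩
    change DirectSum.component (ZMod 2) ℕ (GrPiece I) j _ = _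
    rw [map_sum, Finset.sum_eq_single j]
    · exact DirectSum.of_eq_same _ _
    · intro i _ hij
      exact DirectSum.of_eq_of_ne _ _ _ fun h => hij (Fin.ext h.symm)
    · exact fun h => absurd (Finset.mem_univ j) h
  have h1 := LinearMap.finrank_le_finrank_of_surjective hT
  rw [Module.finrank_pi_fintype, Fin.sum_univ_eq_sum_range
    (fun i => Module.finrank (ZMod 2) (GrPiece I i)) n] at h1
  rwa [finrank_eq_sum_grPiece I n, h0, finrank_bot, add_zero]

/-- A subspace containing `1` and stable under `K`, of dimension at most `2 ^ dim K`. -/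
def HasStable (K : Submodule (ZMod 2) A) : Prop :=
  Module.Finite (ZMod 2) K ∧ ∃ W : Submodule (ZMod 2) A, Module.Finite (ZMod 2) W ∧ 1 ∈ W ∧
    (∀ a ∈ K, ∀ w ∈ W, a * w ∈ W) ∧
      Module.finrank (ZMod 2) W ≤ 2 ^ Module.finrank (ZMod 2) K

theorem hasStable_bot : HasStable (⊥ : Submodule (ZMod 2) A) := by
  refine ⟨inferInstance, Submodule.span (ZMod 2) {1}, inferInstance,
    Submodule.mem_span_singleton_self 1, fun a ha w _ => ?_, ?_⟩
  · rw [(Submodule.mem_bot _).1 ha, zero_mul]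
    exact zero_mem _
  · rw [finrank_bot, pow_zero]
    exact (finrank_span_le_card {(1 : A)}).trans (by simp)

theorem finrank_sup_span_singleton {V : Type*} [AddCommGroup V] [Module (ZMod 2) V]
    {K : Submodule (ZMod 2) V} [Module.Finite (ZMod 2) K] {x : V} (hx : x ∉ K) :
    Module.finrank (ZMod 2) ↥(K ⊔ Submodule.span (ZMod 2) {x}) =
      Module.finrank (ZMod 2) K + 1 := by
  have h := Submodule.finrank_sup_add_finrank_inf_eq K (Submodule.span (ZMod 2) {x})
  have h0 : x ≠ 0 := fun h0 => hx (h0 ▸ zero_mem K)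
  have hd : K ⊓ Submodule.span (ZMod 2) {x} = ⊥ := by
    rw [eq_bot_iff]
    rintro y ⟨hy, hy'⟩
    obtain ⟨r, rfl⟩ := Submodule.mem_span_singleton.1 hy'
    have hr : ∀ r : ZMod 2, r = 0 ∨ r = 1 := by decide
    obtain rfl | rfl := hr r
    · rw [zero_smul]; exact zero_mem _
    · rw [one_smul] at hy
      exact absurd hy hx
  rw [hd, finrank_bot, add_zero, finrank_span_singleton h0] at h
  exact h

/-- The easy half of the restricted Poincaré–Birkhoff–Witt theorem: `W + xW` is stable under `K + 𝔽₂
x`, because `y` moves past `x` at the cost of `[x, y]`, and `x²` falls back into `K`. The dimension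
at most doubles. -/
theorem HasStable.step {K : Submodule (ZMod 2) A} {x : A} (hx : x ∉ K)
    (hbr : ∀ y ∈ K, x * y - y * x ∈ K) (hsq : x * x ∈ K) (h : HasStable K) :
    HasStable (K ⊔ Submodule.span (ZMod 2) {x}) := by
  obtain ⟨hK, W, hW, h1, hKW, hrank⟩ := h
  refine ⟨inferInstance, W ⊔ W.map (LinearMap.mulLeft (ZMod 2) x), inferInstance,
    Submodule.mem_sup_left h1, fun a ha w hw => ?_, ?_⟩
  · obtain ⟨y, hy, u, hu, rfl⟩ := Submodule.mem_sup.1 ha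
    obtain ⟨r, rfl⟩ := Submodule.mem_span_singleton.1 hu
    obtain ⟨w₁, hw₁, v, hv, rfl⟩ := Submodule.mem_sup.1 hw
    obtain ⟨w₂, hw₂, rfl⟩ := hv
    change (y + r • x) * (w₁ + x * w₂) ∈ _
    have e : (y + r • x) * (w₁ + x * w₂) =
        (y * w₁ + r • (x * x * w₂) - (x * y - y * x) * w₂) + x * (y * w₂ + r • w₁) := by
      simp only [add_mul, mul_add, smul_mul_assoc, mul_smul_comm, sub_mul, mul_assoc]
      abel
    rw [e]
    refine Submodule.add_mem_sup (sub_mem (add_mem (hKW y hy w₁ hw₁)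
      (W.smul_mem r (hKW _ hsq w₂ hw₂))) (hKW _ (hbr y hy) w₂ hw₂))
        ⟨_, add_mem (hKW y hy w₂ hw₂) (W.smul_mem r hw₁), rfl⟩
  · rw [finrank_sup_span_singleton hx, pow_succ, mul_two]
    exact (Submodule.finrank_add_le_finrank_add_finrank _ _).trans
      (add_le_add hrank ((Submodule.finrank_map_le _ _).trans hrank))

end Dimension

/-! ### Surjections of filtered algebras -/

section Surjection

variable {A A' : Type*} [Ring A] [Algebra (ZMod 2) A] [Ring A'] [Algebra (ZMod 2) A']
  {I : Ideal A} {I' : Ideal A'} [I.IsTwoSided] [I'.IsTwoSided] {π : A →ₐ[ZMod 2] A'}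

theorem map_mem_powSub (h : ∀ a ∈ I, π a ∈ I') {n : ℕ} {a : A} (ha : a ∈ powSub I n) :
    π a ∈ powSub I' n := by
  induction n generalizing a with
  | zero => exact mem_powSub_zero _ _
  | succ n ih =>
    change a ∈ I ^ (n + 1) at ha
    rw [Ideal.IsTwoSided.pow_add, Submodule.pow_one] at ha
    refine Submodule.smul_induction_on (p := fun a => π a ∈ powSub I' (n + 1)) ha
      (fun u hu v hv => ?_) (fun u v hu hv => ?_)
    · rw [smul_eq_mul, map_mul]
      exact mul_mem_powSub I' (ih hu) (mem_powSub_one.2 (h v hv))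
    · rw [map_add]
      exact add_mem hu hv

theorem exists_mem_powSub (hπ : Function.Surjective π) (h : ∀ a, π a ∈ I' → a ∈ I) {n : ℕ}
    {a' : A'} (ha : a' ∈ powSub I' n) : ∃ a ∈ powSub I n, π a = a' := by
  induction n generalizing a' with
  | zero =>
    obtain ⟨a, rfl⟩ := hπ a'
    exact ⟨a, mem_powSub_zero _ _, rfl⟩
  | succ n ih =>
    change a' ∈ I' ^ (n + 1) at ha
    rw [Ideal.IsTwoSided.pow_add, Submodule.pow_one] at ha
    refine Submodule.smul_induction_on (p := fun a' => ∃ a ∈ powSub I (n + 1), π a = a') ha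
      (fun u hu v hv => ?_) (fun u v hu hv => ?_)
    · obtain ⟨u, hu', rfl⟩ := ih hu
      obtain ⟨v, rfl⟩ := hπ v
      exact ⟨u * v, mul_mem_powSub I hu' (mem_powSub_one.2 (h v hv)), map_mul _ _ _⟩
    · obtain ⟨u, hu', rfl⟩ := hu
      obtain ⟨v, hv', rfl⟩ := hv
      exact ⟨u + v, add_mem hu' hv', map_add _ _ _⟩

theorem IsGenerated.map {d : ℕ} {y : Fin (d + 1) → A} (hI : IsGenerated I y)
    (hπ : Function.Surjective π) (h : ∀ a, a ∈ I ↔ π a ∈ I') :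
    IsGenerated I' fun i => π (y i) := by
  intro n a' ha'
  obtain ⟨a, ha, rfl⟩ := exists_mem_powSub hπ (fun a => (h a).2) ha'
  obtain ⟨p, hp, hap⟩ := hI n a ha
  refine ⟨p, hp, ?_⟩
  have e : evalAt (fun i => π (y i)) = π.comp (evalAt y) := by
    ext i
    simp [evalAt]
  have := map_mem_powSub (fun a => (h a).1) hap
  rwa [map_sub, ← AlgHom.comp_apply, ← e] at this

end Surjection

end

end DeltaRAAG

namespace DeltaRAAG

noncomputable section

/-! ### The subgroups of the Zassenhaus filtration -/

section ZassenhausSubgroups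

variable {G : Type*} [Group G] [TopologicalSpace G]

instance (m : ℕ) : (zassenhaus G m).Normal where
  conj_mem h hh g := by
    rw [mem_zassenhaus] at *
    have e : toCGA G (g * h * g⁻¹) - 1 = toCGA G g * (toCGA G h - 1) * toCGA G g⁻¹ := by
      rw [mul_sub, sub_mul, mul_one, ← map_mul, ← map_mul, ← map_mul, mul_inv_cancel, map_one]
    rw [e]
    exact mul_mem_powSub_right _ (mul_mem_powSub_left _ hh)

theorem pow_mem_zassenhaus (g : G) (k : ℕ) : g ^ 2 ^ k ∈ zassenhaus G (2 ^ k) := by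
  induction k with
  | zero => exact mem_zassenhaus_one _
  | succ k ih =>
    rw [pow_succ 2 k, pow_mul, mul_comm (2 ^ k) 2]
    exact sq_mem_zassenhaus ih

/-- Squaring doubles the Zassenhaus degree, and `2^m` exceeds `m`. -/
theorem isPGroup_of_zassenhaus_le {m : ℕ} {N : Subgroup G} [N.Normal]
    (hN : zassenhaus G m ≤ N) : IsPGroup 2 (G ⧸ N) := by
  intro q
  obtain ⟨g, rfl⟩ := QuotientGroup.mk_surjective q
  exact ⟨m, (QuotientGroup.eq_one_iff _).2
    (hN (zassenhaus_anti Nat.lt_two_pow_self.le (pow_mem_zassenhaus g m)))⟩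

theorem index_zassenhaus (m : ℕ) :
    (zassenhaus G m).index = ∏ k ∈ Finset.range m, Nat.card (LiePiece G k) := by
  induction m with
  | zero =>
    have : zassenhaus G 0 = ⊤ := eq_top_iff.2 fun g _ => mem_zassenhaus_zero g
    rw [this, Subgroup.index_top, Finset.prod_range_zero]
  | succ m ih =>
    rw [← Subgroup.relIndex_mul_index (zassenhaus_anti (G := G) (Nat.le_succ m)), ih,
      Finset.prod_range_succ, mul_comm]
    rfl

/-- The inclusion of `Gₙ / Gₙ₊₁` as a linear map. -/
def lieToGrLin (n : ℕ) : LiePiece G n →ₗ[ZMod 2] GrPiece (augIdeal G) n :=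
  (lieToGrHom n).toZModLinearMap 2

theorem lieToGrLin_injective (n : ℕ) : Function.Injective (lieToGrLin (G := G) n) :=
  lieToGr_injective n

variable (G) in
/-- The subspace of `𝓔(G)` corresponding to the elements of degree `n` of `𝓛(G)`. -/
def lieRange (n : ℕ) : Submodule (ZMod 2) (GrE G) :=
  LinearMap.range (DirectSum.lof (ZMod 2) ℕ (GrPiece (augIdeal G)) n ∘ₗ lieToGrLin n)

theorem finrank_lieRange (n : ℕ) :
    Module.finrank (ZMod 2) (lieRange G n) = Module.finrank (ZMod 2) (LiePiece G n) :=
  LinearMap.finrank_range_of_inj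
    ((DirectSum.of_injective (β := GrPiece (augIdeal G)) n).comp (lieToGrLin_injective n))

/-- The subspace of `𝓔(G)` corresponding to `𝓛(G)`. -/
def GrL.toGrELin : GrL G →ₗ[ZMod 2] GrE G := GrL.toGrE.toZModLinearMap 2

theorem GrL.toGrELin_apply (u : GrL G) : GrL.toGrELin u = GrL.toGrE u := rfl

theorem of_lieToGr_sq {n : ℕ} {g : G} (hg : g ∈ zassenhaus G n) :
    DirectSum.of (GrPiece (augIdeal G)) n (lieToGr n (lieMk g hg)) *
        DirectSum.of (GrPiece (augIdeal G)) n (lieToGr n (lieMk g hg)) =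
      DirectSum.of (GrPiece (augIdeal G)) (2 * n)
        (lieToGr (2 * n) (lieMk (g ^ 2) (sq_mem_zassenhaus hg))) := by
  rw [lieToGr_lieMk, lieToGr_lieMk, of_grMk_mul]
  refine DirectSum.of_eq_of_gradedMonoid_eq
    (gradedMonoid_grMk_congr (augIdeal G) _ _ (two_mul n).symm ?_)
  rw [map_pow, ident_sq _ (two_eq_zero_of_algebra _)]

/-- On homogeneous elements squaring is induced by `g ↦ g²`; cross terms are brackets. -/
theorem GrL.sq_mem_range {u : GrE G} (hu : u ∈ LinearMap.range (GrL.toGrELin (G := G))) :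
    u * u ∈ LinearMap.range (GrL.toGrELin (G := G)) := by
  obtain ⟨x, rfl⟩ := hu
  induction x using GrL.induction_on with
  | h0 => rw [map_zero, zero_mul]; exact zero_mem _
  | hof n x =>
    obtain ⟨g, hg, rfl⟩ := exists_lieMk x
    refine ⟨GrL.of G (2 * n) (lieMk (g ^ 2) (sq_mem_zassenhaus hg)), ?_⟩
    rw [GrL.toGrELin_apply, GrL.toGrELin_apply, GrL.toGrE_of, GrL.toGrE_of, of_lieToGr_sq]
  | hadd x y hx hy =>
    rw [map_add, add_sq_identity]
    refine add_mem (add_mem hx hy) ⟨⁅x, y⁆, ?_⟩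
    exact GrL.toGrE_bracket x y

/-- The homogeneous component of degree `n` of an element of `𝓛(G)`. -/
def GrL.coeff (n : ℕ) : GrL G →ₗ[ZMod 2] LiePiece G n :=
  DirectSum.component (ZMod 2) ℕ (LiePiece G) n

theorem GrL.toGrE_apply (u : GrL G) (n : ℕ) : GrL.toGrE u n = lieToGr n (GrL.coeff n u) :=
  DirectSum.map_apply _ _ _

variable {d : ℕ}

/-- The homomorphism from the free algebra to `𝓔(G)` attached to a family of elements of `G`. -/
def genGr (x : Fin (d + 1) → G) : NCPoly d →ₐ[ZMod 2] GrE G :=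
  grEval (augIdeal G) (y := fun i => toCGA G (x i) - 1) fun i => toCGA_sub_one_mem (x i)

theorem genGr_var (x : Fin (d + 1) → G) (i : Fin (d + 1)) : genGr x (var i) =
    DirectSum.of (GrPiece (augIdeal G)) 1 (lieToGr 1 (lieMk (x i) (mem_zassenhaus_one _))) :=
  grEval_var _ _ i

theorem genGr_mem_range (x : Fin (d + 1) → G) {p : NCPoly d} (hp : p ∈ restrictedFree d) :
    genGr x p ∈ LinearMap.range (GrL.toGrELin (G := G)) := by
  have h : (restrictedFree d).toSubmodule ≤
      (LinearMap.range (GrL.toGrELin (G := G))).comap (genGr x).toLinearMap := by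
    refine restrictedFree_le (fun i => ?_) (fun p hp q hq => ?_) (fun p hp => ?_)
    · refine ⟨GrL.of G 1 (lieMk (x i) (mem_zassenhaus_one _)), ?_⟩
      exact (GrL.toGrE_of _).trans (genGr_var x i).symm
    · obtain ⟨u, hu⟩ := hp
      obtain ⟨v, hv⟩ := hq
      have hu' : GrL.toGrE u = genGr x p := hu
      have hv' : GrL.toGrE v = genGr x q := hv
      refine ⟨⁅u, v⁆, ?_⟩
      change GrL.toGrE ⁅u, v⁆ = genGr x (p * q - q * p)
      rw [GrL.toGrE_bracket, hu', hv', map_sub, map_mul, map_mul]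
    · have := GrL.sq_mem_range hp
      change genGr x (p * p) ∈ LinearMap.range (GrL.toGrELin (G := G))
      rw [map_mul]
      exact this
  exact h hp

theorem genGr_mem_lieRange (x : Fin (d + 1) → G) {p : NCPoly d} (hp : p ∈ restrictedFree d)
    {n : ℕ} (hn : p ∈ ncHomogeneous d n) : genGr x p ∈ lieRange G n := by
  obtain ⟨u, hu⟩ := genGr_mem_range x hp
  obtain ⟨h, e⟩ := grEval_of_mem (augIdeal G) (fun i => toCGA_sub_one_mem (x i)) hn
  have e' : genGr x p = DirectSum.of _ n (grMk (augIdeal G) _ h) := e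
  have hu' : GrL.toGrE u = genGr x p := hu
  refine ⟨GrL.coeff n u, ?_⟩
  change DirectSum.of _ n (lieToGr n (GrL.coeff n u)) = _
  rw [← GrL.toGrE_apply, hu', e', DirectSum.of_eq_same]

end ZassenhausSubgroups

/-! ### Openness of the Zassenhaus subgroups of a Δ-RAAG -/

section ZassenhausOpen

variable {d : ℕ} {Γ : SimpleGraph (Fin d)} {z : Fin d → RAAG Γ} {δ : Delta →* MulAut (RAAG Γ)}

theorem exists_normalPoly_sub_mem (hδ : IsDeltaAction Γ z δ) {n : ℕ} {a : CGA (GZ δ)}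
    (ha : a ∈ powSub (augIdeal (GZ δ)) n) : ∃ c : NormalWord Γ →₀ ZMod 2,
      (∀ i, c i ≠ 0 → i.wt = n) ∧
        a - evalAt (genSub δ) (normalPoly z c) ∈ powSub (augIdeal (GZ δ)) (n + 1) := by
  obtain ⟨c, hc⟩ := (normalToGr_bijective hδ n).2 (grMk (augIdeal (GZ δ)) a ha)
  have hc' : ∀ i, Finsupp.lmapDomain (ZMod 2) (ZMod 2)
      (Subtype.val : {i : NormalWord Γ // i.wt = n} → NormalWord Γ) c i ≠ 0 → i.wt = n := by
    intro i hi
    by_contra hne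
    refine hi (Finsupp.mapDomain_of_notMem_range _ _ ?_)
    rintro ⟨j, rfl⟩
    exact hne j.2
  refine ⟨_, hc', ?_⟩
  obtain ⟨h, e⟩ := grEval_of_mem (augIdeal (GZ δ)) (genSub_mem (δ := δ))
    (normalPoly_mem (z := z) hc')
  have h1 : grEval (augIdeal (GZ δ)) (genSub_mem (δ := δ)) (normalPoly z _) n =
    grMk (augIdeal (GZ δ)) a ha := hc
  rw [e, DirectSum.of_eq_same] at h1
  exact (grMk_eq_iff _).1 h1.symm

/-- The matrix representation truncated at length `m` has its kernel inside the `m`-th power of the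
augmentation ideal. Indeed, an element of the kernel known to lie in degree `n < m` is there
congruent to a combination of normal forms, which the matrices show to be zero, so it lies in degree
`n + 1`. -/
theorem isOpen_zassenhaus (hδ : IsDeltaAction Γ z δ) (m : ℕ) :
    IsOpen (zassenhaus (GZ δ) m : Set (GZ δ)) := by
  obtain ⟨N, ρ, hN, hρ, h1, h2⟩ := exists_matrix_rep m hδ
  have key : ∀ n ≤ m, ∀ a, ρ a = 0 → a ∈ powSub (augIdeal (GZ δ)) n := by
    intro n
    induction n with
    | zero => exact fun _ a _ => mem_powSub_zero _ a
    | succ n ih =>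
      intro hn a ha
      obtain ⟨c, hc, hac⟩ := exists_normalPoly_sub_mem hδ (ih (by omega) a ha)
      have hmem := hρ n _ hac
      rw [map_sub, ha, zero_sub] at hmem
      have hc0 := eq_zero_of_normalPoly_mem_matFilt hn h1 h2 hc (neg_mem_iff.1 hmem)
      rwa [hc0, map_zero, map_zero, sub_zero] at hac
  have h := GZ.isOpen_ker δ (QuotientGroup.mk' (zassenhaus (GZ δ) m)) (by
    refine Subgroup.isOpen_mono (H₁ := N.toSubgroup.comap SemidirectProduct.inl) (fun g hg => ?_)
      (N.isOpen'.preimage (GZ.continuous_inl δ))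
    exact (QuotientGroup.eq_one_iff _).2 (key m le_rfl _ (hN _ hg)))
  rwa [QuotientGroup.ker_mk'] at h

end ZassenhausOpen

end

end DeltaRAAG

namespace DeltaRAAG

noncomputable section

/-! ### Generation of `𝓛(G)` in degree one -/

section Generation

theorem finrank_map_le_of_ker {V V₁ V₂ : Type*} [AddCommGroup V] [Module (ZMod 2) V]
    [AddCommGroup V₁] [Module (ZMod 2) V₁] [AddCommGroup V₂] [Module (ZMod 2) V₂]
    {M : Submodule (ZMod 2) V} [Module.Finite (ZMod 2) M] {f : V →ₗ[ZMod 2] V₁}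
    {g : V →ₗ[ZMod 2] V₂} (h : ∀ x ∈ M, f x = 0 → g x = 0) :
    Module.finrank (ZMod 2) (M.map g) ≤ Module.finrank (ZMod 2) (M.map f) := by
  have h1 := LinearMap.finrank_range_add_finrank_ker (f.domRestrict M)
  have h2 := LinearMap.finrank_range_add_finrank_ker (g.domRestrict M)
  have h3 : Module.finrank (ZMod 2) (LinearMap.ker (f.domRestrict M)) ≤
      Module.finrank (ZMod 2) (LinearMap.ker (g.domRestrict M)) :=
    Submodule.finrank_mono fun x hx => h x.1 x.2 hx
  rw [LinearMap.range_domRestrict] at h1 h2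
  omega

variable {d : ℕ} {G : Type*} [Group G] [TopologicalSpace G]

variable (d) in
/-- The homogeneous elements of degree `k` of the free restricted Lie algebra. -/
def lieHom (k : ℕ) : Submodule (ZMod 2) (NCPoly d) :=
  (restrictedFree d).toSubmodule ⊓ ncHomogeneous d k

instance (k : ℕ) : Module.Finite (ZMod 2) (lieHom d k) := by
  have : Finite (lieHom d k) := ((finite_ncHomogeneous (d := d) k).subset fun _ h => h.2).to_subtype
  exact Module.Finite.of_finite

theorem finite_grPiece_of_isGenerated {A : Type*} [Ring A] [Algebra (ZMod 2) A] {I : Ideal A}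
    [I.IsTwoSided] {y : Fin (d + 1) → A} (hy : ∀ i, y i ∈ powSub I 1) (hI : IsGenerated I y)
    (n : ℕ) : Finite (GrPiece I n) := by
  have h := hI.map_ncHomogeneous hy n
  have : Finite ((ncHomogeneous d n).map (grEval I hy).toLinearMap) :=
    ((finite_ncHomogeneous (d := d) n).image _).to_subtype
  rw [h] at this
  exact Finite.of_injective (fun x : GrPiece I n =>
    (⟨_, x, rfl⟩ : LinearMap.range (DirectSum.lof (ZMod 2) ℕ (GrPiece I) n))) fun x y hxy =>
      DirectSum.of_injective (β := GrPiece I) n (Subtype.ext_iff.1 hxy)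

/-! ### The graded group algebra of a finite quotient -/

section Quotient

variable (x : Fin (d + 1) → G) (N : OpenNormalSubgroup G)

theorem mem_augIdeal_iff_proj (a : CGA G) :
    a ∈ augIdeal G ↔ CGA.proj G N a ∈ augKer (G ⧸ N.toSubgroup) := by
  rw [CGA.mem_augIdeal_iff, RingHom.mem_ker]
  change augMap _ (CGA.proj G (topSubgroup G) a) = 0 ↔ augMap _ (CGA.proj G N a) = 0
  rw [CGA.augMap_proj (N := N) (M := topSubgroup G) (fun _ _ => trivial)]

/-- The images of the `xᵢ - 1` in the group algebra of a finite quotient. -/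
def quotSub (i : Fin (d + 1)) : MonoidAlgebra (ZMod 2) (G ⧸ N.toSubgroup) :=
  CGA.proj G N (toCGA G (x i) - 1)

theorem quotSub_mem (i : Fin (d + 1)) :
    quotSub x N i ∈ powSub (augKer (G ⧸ N.toSubgroup)) 1 :=
  map_mem_powSub (fun a => (mem_augIdeal_iff_proj N a).1) (toCGA_sub_one_mem (x i))

/-- The homomorphism from the free algebra to the graded algebra of a finite quotient. -/
def quotGr : NCPoly d →ₐ[ZMod 2] ⨁ n, GrPiece (augKer (G ⧸ N.toSubgroup)) n :=
  grEval _ (quotSub_mem x N)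

theorem evalAt_quotSub (p : NCPoly d) :
    evalAt (quotSub x N) p = CGA.proj G N (evalAt (fun i => toCGA G (x i) - 1) p) := by
  have e : evalAt (quotSub x N) = (CGA.proj G N).comp (evalAt fun i => toCGA G (x i) - 1) := by
    ext i
    simp [evalAt, quotSub]
  rw [e, AlgHom.comp_apply]

/-- If `p` is represented by `g - 1` with `g` in `N`, its leading term disappears in the group
algebra of `G/N`. -/
theorem quotGr_eq_zero {n : ℕ} {p : NCPoly d} (hp : p ∈ ncHomogeneous d n) {g : G}
    (hg : g ∈ N.toSubgroup)
    (h : evalAt (fun i => toCGA G (x i) - 1) p - (toCGA G g - 1) ∈ powSub (augIdeal G) (n + 1)) :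
    quotGr x N p = 0 := by
  obtain ⟨h1, e⟩ := grEval_of_mem _ (quotSub_mem x N) hp
  have h2 : evalAt (quotSub x N) p ∈ powSub (augKer (G ⧸ N.toSubgroup)) (n + 1) := by
    have h3 := map_mem_powSub (I' := augKer (G ⧸ N.toSubgroup))
      (fun a => (mem_augIdeal_iff_proj N a).1) h
    have h4 : CGA.proj G N (toCGA G g) = 1 := by
      rw [proj_toCGA, (QuotientGroup.eq_one_iff g).2 hg, map_one]
    rwa [map_sub, map_sub, h4, map_one, sub_self, sub_zero, ← evalAt_quotSub] at h3
  rw [quotGr, e, (grMk_eq_iff (hb := zero_mem _) _).2 (by rwa [sub_zero]), grMk_zero, map_zero]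

theorem exists_sub_mem_of_mem_lieHom {n : ℕ} {p : NCPoly d} (hp : p ∈ lieHom d n) :
    ∃ g ∈ zassenhaus G n,
      evalAt (fun i => toCGA G (x i) - 1) p - (toCGA G g - 1) ∈ powSub (augIdeal G) (n + 1) := by
  obtain ⟨a, ha⟩ := genGr_mem_lieRange x hp.1 hp.2
  obtain ⟨g, hg, rfl⟩ := exists_lieMk a
  obtain ⟨h, e⟩ := grEval_of_mem (augIdeal G) (fun i => toCGA_sub_one_mem (x i)) hp.2
  refine ⟨g, hg, (grMk_eq_iff _ (ha := h) (hb := mem_zassenhaus.1 hg)).1 ?_⟩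
  exact DirectSum.of_injective (β := GrPiece (augIdeal G)) n (e.symm.trans ha.symm)

variable {x N} {m : ℕ}

theorem quotGr_eq_zero_of_genGr {n : ℕ} {p : NCPoly d} (hp : p ∈ lieHom d n)
    (h : genGr x p = 0) : quotGr x N p = 0 := by
  obtain ⟨h1, e⟩ := grEval_of_mem (augIdeal G) (fun i => toCGA_sub_one_mem (x i)) hp.2
  refine quotGr_eq_zero x N hp.2 (one_mem N.toSubgroup) ?_
  rw [map_one, sub_self]
  have e' : genGr x p = DirectSum.of _ n (grMk (augIdeal G) _ h1) := e
  rw [h, eq_comm, ← map_zero (DirectSum.of (GrPiece (augIdeal G)) n), ← grMk_zero] at e'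
  exact (grMk_eq_iff _).1 (DirectSum.of_injective (β := GrPiece (augIdeal G)) n e')

variable (x) in
/-- The image in the graded algebra of a finite quotient of the elements of degree at least `k` of
the free restricted Lie algebra. -/
def quotFlag (N : OpenNormalSubgroup G) (k : ℕ) :
    Submodule (ZMod 2) (⨁ n, GrPiece (augKer (G ⧸ N.toSubgroup)) n) :=
  ((restrictedFree d).toSubmodule ⊓ degSub d k).map (quotGr x N).toLinearMap

/-- A Lie element of degree `n ≥ m` is represented by an element of `G_n`, which lies in `G_m = N`.
This makes the image of `𝓛` finite-dimensional. -/
theorem quotFlag_eq_bot (hN : N.toSubgroup = zassenhaus G m) : quotFlag x N m = ⊥ := by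
  rw [eq_bot_iff]
  rintro _ ⟨p, ⟨hp, hpm⟩, rfl⟩
  rw [Submodule.mem_bot]
  change quotGr x N p = 0
  rw [← sum_comp p, map_sum]
  refine Finset.sum_eq_zero fun n _ => ?_
  by_cases hn : n < m
  · rw [mem_degSub.1 hpm n hn, map_zero]
  · obtain ⟨g, hg, h⟩ := exists_sub_mem_of_mem_lieHom x
      (show comp n p ∈ lieHom d n from ⟨comp_mem_restrictedFree hp n, comp_mem n p⟩)
    exact quotGr_eq_zero x N (comp_mem n p) (hN ▸ zassenhaus_anti (by omega) hg) h

theorem quotFlag_anti (k : ℕ) : quotFlag x N (k + 1) ≤ quotFlag x N k :=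
  Submodule.map_mono (inf_le_inf_left _ (degSub_anti (Nat.le_succ k)))

theorem quotFlag_one :
    quotFlag x N 1 = (restrictedFree d).toSubmodule.map (quotGr x N).toLinearMap := by
  rw [quotFlag, inf_eq_left.2 restrictedFree_le_degSub]

theorem quotFlag_zero : quotFlag x N 0 = quotFlag x N 1 := by
  rw [quotFlag_one, quotFlag, inf_eq_left.2 fun p _ => mem_degSub.2 fun i hi => absurd hi (by omega)]

theorem hasStable_quotFlag (hN : N.toSubgroup = zassenhaus G m) : HasStable (quotFlag x N 0) := by
  rw [quotFlag_zero]
  -- The flag starts in degree one so that brackets and squares move strictly down it.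
  refine flag_induction (F := fun k => quotFlag x N (k + 1)) (fun k => ?_) (fun k => ?_)
    (fun k => quotFlag_anti (k + 1)) (fun k => ?_) (P := HasStable) m ?_ ?_
  · rintro _ ⟨p, ⟨hp, hp1⟩, rfl⟩ _ ⟨q, ⟨hq, hqk⟩, rfl⟩
    refine ⟨p * q - q * p, ⟨(restrictedFree d).lie_mem hp hq, ?_⟩, ?_⟩
    · exact degSub_anti (by omega) (lie_mem_degSub hp1 hqk)
    · change quotGr x N (p * q - q * p) = _
      rw [map_sub, map_mul, map_mul]
      rfl
  · rintro _ ⟨p, ⟨hp, hpk⟩, rfl⟩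
    refine ⟨p * p, ⟨sq_mem_restrictedFree hp, degSub_anti (by omega) (mul_mem_degSub hpk hpk)⟩, ?_⟩
    exact map_mul (quotGr x N) p p
  · obtain ⟨s, hs, hsF, hF⟩ := exists_finite_flag (d := d) (k + 1)
    refine ⟨(quotGr x N).toLinearMap '' s, hs.image _, ?_, ?_⟩
    · rintro _ ⟨p, hp, rfl⟩
      exact ⟨p, hsF hp, rfl⟩
    · have := Submodule.map_mono (f := (quotGr x N).toLinearMap) hF
      rwa [Submodule.map_sup, Submodule.map_span] at this
  · have h : quotFlag x N (m + 1) = ⊥ := by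
      rw [eq_bot_iff, ← quotFlag_eq_bot (x := x) hN]
      exact quotFlag_anti m
    change HasStable (quotFlag x N (m + 1))
    rw [h]
    exact hasStable_bot
  · intro K u _ _ _ huK h1 _ _ h4 hP
    exact hP.step huK h1 h4

theorem quotFlag_le (k : ℕ) : quotFlag x N k ≤
    quotFlag x N (k + 1) ⊔ (lieHom d k).map (quotGr x N).toLinearMap := by
  rintro _ ⟨p, ⟨hp, hpk⟩, rfl⟩
  rw [← sub_add_cancel p (comp k p), map_add]
  have h := comp_mem_restrictedFree hp k
  exact Submodule.add_mem_sup ⟨_, ⟨sub_mem hp h, sub_comp_mem_degSub hpk⟩, rfl⟩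
    ⟨_, ⟨h, comp_mem k p⟩, rfl⟩

/-- The image of `𝓛` for the finite quotient is, degree by degree, a quotient of its image in
`𝓔(G)`, and stops before degree `m`. -/
theorem finrank_quotFlag_le (hN : N.toSubgroup = zassenhaus G m) :
    Module.finrank (ZMod 2) (quotFlag x N 0) ≤ ∑ k ∈ Finset.range m,
      Module.finrank (ZMod 2) ((lieHom d k).map (genGr x).toLinearMap) := by
  have hfin := (hasStable_quotFlag (x := x) hN).1
  have hanti : Antitone (quotFlag x N) := antitone_nat_of_succ_le quotFlag_anti
  have hfin' : ∀ k, Module.Finite (ZMod 2) (quotFlag x N k) := fun k =>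
    Submodule.finiteDimensional_of_le (hanti (Nat.zero_le k))
  have key : ∀ k ≤ m, Module.finrank (ZMod 2) (quotFlag x N k) ≤ ∑ j ∈ Finset.Ico k m,
      Module.finrank (ZMod 2) ((lieHom d j).map (genGr x).toLinearMap) := by
    intro k hk
    induction hk using Nat.decreasingInduction with
    | self => rw [quotFlag_eq_bot hN, finrank_bot]; exact Nat.zero_le _
    | of_succ k hk ih =>
      rw [Finset.sum_eq_sum_Ico_succ_bot hk, add_comm]
      refine (Submodule.finrank_mono (quotFlag_le (x := x) (N := N) k)).trans
        ((Submodule.finrank_add_le_finrank_add_finrank _ _).trans (add_le_add ih ?_))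
      exact finrank_map_le_of_ker (f := (genGr x).toLinearMap) (g := (quotGr x N).toLinearMap)
        fun p hp h => quotGr_eq_zero_of_genGr hp h
  rw [Finset.range_eq_Ico]
  exact key 0 (Nat.zero_le m)

/-- The order of `G/N` is the dimension of its group algebra. Since the augmentation ideal is
nilpotent, this is at most the dimension of the graded algebra. The latter is generated by the image
of `𝓛`, so the stable subspace containing `1` is everything. -/
theorem card_quotient_le (hx : IsTopGen x) (hN : N.toSubgroup = zassenhaus G m) :
    Nat.card (G ⧸ N.toSubgroup) ≤ 2 ^ ∑ k ∈ Finset.range m,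
      Module.finrank (ZMod 2) ((lieHom d k).map (genGr x).toLinearMap) := by
  have hfinP : Finite (G ⧸ N.toSubgroup) := (hx N).1
  have hP : IsPGroup 2 (G ⧸ N.toSubgroup) := isPGroup_of_zassenhaus_le hN.ge
  have hA : Module.Finite (ZMod 2) (MonoidAlgebra (ZMod 2) (G ⧸ N.toSubgroup)) :=
    Module.Finite.of_basis (MonoidAlgebra.basis (G ⧸ N.toSubgroup) (ZMod 2))
  obtain ⟨n, hn⟩ := exists_augKer_pow_eq_bot hP
  obtain ⟨-, W, hW, h1, hstab, hrank⟩ := hasStable_quotFlag (x := x) hN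
  have hgen : IsGenerated (augKer (G ⧸ N.toSubgroup)) (quotSub x N) :=
    hx.isGenerated.map (CGA.proj_surjective N) (mem_augIdeal_iff_proj N)
  have htop : W = ⊤ := by
    rw [eq_top_iff]
    rintro u -
    obtain ⟨p, rfl⟩ := hgen.grEval_surjective (quotSub_mem x N) u
    have hp : ∀ w ∈ W, quotGr x N p * w ∈ W := by
      induction p using FreeAlgebra.induction with
      | grade0 r =>
        intro w hw
        rw [AlgHom.commutes, ← Algebra.smul_def]
        exact W.smul_mem r hw
      | grade1 i =>
        refine fun w hw => hstab _ ?_ w hw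
        rw [quotFlag_zero, quotFlag_one]
        exact ⟨var i, var_mem_restrictedFree i, rfl⟩
      | mul a b ha hb =>
        intro w hw
        rw [map_mul, mul_assoc]
        exact ha _ (hb w hw)
      | add a b ha hb =>
        intro w hw
        rw [map_add, add_mul]
        exact add_mem (ha w hw) (hb w hw)
    have := hp 1 h1
    rwa [mul_one] at this
  subst htop
  have hR : Module.Finite (ZMod 2) (⨁ n, GrPiece (augKer (G ⧸ N.toSubgroup)) n) :=
    Module.finite_def.2 ((Submodule.fg_top _).1 (Module.finite_def.1 hW))
  have h2 := finrank_le_finrank_gr hn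
  have := Fintype.ofFinite (G ⧸ N.toSubgroup)
  rw [Module.finrank_eq_card_basis (MonoidAlgebra.basis (G ⧸ N.toSubgroup) (ZMod 2)),
    ← Nat.card_eq_fintype_card] at h2
  rw [finrank_top] at hrank
  exact (h2.trans hrank).trans (Nat.pow_le_pow_right two_pos (finrank_quotFlag_le hN))

end Quotient

variable {x : Fin (d + 1) → G}

/-- The graded restricted Lie algebra of the Zassenhaus filtration is generated in degree one. -/
theorem map_lieHom_eq_lieRange (hx : IsTopGen x)
    (ho : ∀ m, IsOpen (zassenhaus G m : Set G)) (k : ℕ) :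
    (lieHom d k).map (genGr x).toLinearMap = lieRange G k := by
  have hgr : ∀ n, Finite (GrPiece (augIdeal G) n) := fun n =>
    finite_grPiece_of_isGenerated (fun i => toCGA_sub_one_mem (x i)) hx.isGenerated n
  have hlie : ∀ n, Finite (LiePiece G n) := fun n =>
    Finite.of_injective _ (lieToGr_injective (G := G) n)
  have hle : ∀ n, (lieHom d n).map (genGr x).toLinearMap ≤ lieRange G n := by
    rintro n _ ⟨p, hp, rfl⟩
    exact genGr_mem_lieRange x hp.1 hp.2
  have hfin : ∀ n, Module.Finite (ZMod 2) (lieRange G n) := fun n =>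
    Module.Finite.range _
  have hrank : ∀ n, Module.finrank (ZMod 2) ((lieHom d n).map (genGr x).toLinearMap) ≤
      Module.finrank (ZMod 2) (LiePiece G n) := fun n =>
    (Submodule.finrank_mono (hle n)).trans (finrank_lieRange n).le
  let N : OpenNormalSubgroup G :=
    { toSubgroup := zassenhaus G (k + 1)
      isOpen' := ho (k + 1)
      isNormal' := inferInstance }
  have hcard := card_quotient_le (N := N) (m := k + 1) hx rfl
  have hindex : Nat.card (G ⧸ N.toSubgroup) =
      2 ^ ∑ n ∈ Finset.range (k + 1), Module.finrank (ZMod 2) (LiePiece G n) := by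
    refine (index_zassenhaus (k + 1)).trans ?_
    rw [← Finset.prod_pow_eq_pow_sum]
    refine Finset.prod_congr rfl fun n _ => ?_
    rw [Module.natCard_eq_pow_finrank (K := ZMod 2), Nat.card_zmod]
  rw [hindex] at hcard
  -- The termwise inequalities go the other way, so the sums agree and each term is an equality.
  have hsum := (Nat.pow_le_pow_iff_right (le_refl 2)).1 hcard
  have heq := (Finset.sum_eq_sum_iff_of_le fun n _ => hrank n).1
    (le_antisymm (Finset.sum_le_sum fun n _ => hrank n) hsum) k (Finset.self_mem_range_succ k)
  exact Submodule.eq_of_le_of_finrank_le (hle k) (by rw [heq, finrank_lieRange])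

end Generation

end

end DeltaRAAG

namespace DeltaRAAG

noncomputable section

/-! ### The isomorphism of restricted Lie algebras -/

section LieIso

variable {d : ℕ}

section

variable {G : Type*} [Group G] [TopologicalSpace G] (x : Fin (d + 1) → G)

/-- The homomorphism from the free restricted Lie algebra to `𝓛(G)` attached to a family of
elements of `G`, as a linear map. -/
def genLieLin : ↥(restrictedFree d) →ₗ[ZMod 2] GrL G :=
  (LinearEquiv.ofInjective GrL.toGrELin GrL.toGrE_injective).symm.toLinearMap ∘ₗ
    ((genGr x).toLinearMap ∘ₗ (restrictedFree d).toSubmodule.subtype).codRestrict _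
      fun p => genGr_mem_range x p.2

theorem toGrE_genLieLin (p : ↥(restrictedFree d)) :
    GrL.toGrE (genLieLin x p) = genGr x p.1 :=
  congrArg Subtype.val ((LinearEquiv.ofInjective (GrL.toGrELin (G := G))
    GrL.toGrE_injective).apply_symm_apply ⟨genGr x p.1, genGr_mem_range x p.2⟩)

theorem genLieLin_lie (p q : ↥(restrictedFree d)) :
    genLieLin x ⁅p, q⁆ = ⁅genLieLin x p, genLieLin x q⁆ := by
  apply GrL.toGrE_injective
  rw [GrL.toGrE_bracket, toGrE_genLieLin, toGrE_genLieLin, toGrE_genLieLin]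
  change genGr x (p.1 * q.1 - q.1 * p.1) = _
  rw [map_sub, map_mul, map_mul]

theorem genLieLin_var (i : Fin (d + 1)) : genLieLin x ⟨var i, var_mem_restrictedFree i⟩ =
    GrL.of G 1 (lieMk (x i) (mem_zassenhaus_one _)) := by
  apply GrL.toGrE_injective
  rw [toGrE_genLieLin, GrL.toGrE_of, genGr_var]

theorem genLieLin_sq {n : ℕ} {p : ↥(restrictedFree d)} {g : G} (hg : g ∈ zassenhaus G n)
    (h : genLieLin x p = GrL.of G n (lieMk g hg)) : genLieLin x (restrictedSq p) =
      GrL.of G (2 * n) (lieMk (g ^ 2) (sq_mem_zassenhaus hg)) := by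
  have h1 := toGrE_genLieLin x p
  rw [h, GrL.toGrE_of] at h1
  apply GrL.toGrE_injective
  rw [toGrE_genLieLin, GrL.toGrE_of, ← of_lieToGr_sq hg, h1]
  exact map_mul (genGr x) p.1 p.1

variable {x}

theorem map_genLieLin (hx : IsTopGen x) (ho : ∀ m, IsOpen (zassenhaus G m : Set G)) (n : ℕ) :
    ((ncHomogeneous d n).comap (restrictedFree d).toSubmodule.subtype).map (genLieLin x) =
      LinearMap.range (GrL.of G n) := by
  apply le_antisymm
  · rintro _ ⟨p, hp, rfl⟩
    obtain ⟨a, ha⟩ := genGr_mem_lieRange x p.2 hp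
    refine ⟨a, GrL.toGrE_injective ?_⟩
    rw [toGrE_genLieLin, GrL.toGrE_of]
    exact ha
  · rintro _ ⟨a, rfl⟩
    have ha : DirectSum.of (GrPiece (augIdeal G)) n (lieToGr n a) ∈ lieRange G n := ⟨a, rfl⟩
    rw [← map_lieHom_eq_lieRange hx ho] at ha
    obtain ⟨p, hp, e⟩ := ha
    refine ⟨⟨p, hp.1⟩, hp.2, GrL.toGrE_injective ?_⟩
    rw [toGrE_genLieLin, GrL.toGrE_of]
    exact e

theorem genLieLin_surjective (hx : IsTopGen x) (ho : ∀ m, IsOpen (zassenhaus G m : Set G)) :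
    Function.Surjective (genLieLin x) := by
  intro u
  induction u using GrL.induction_on with
  | h0 => exact ⟨0, map_zero _⟩
  | hof n a =>
    have ha : GrL.of G n a ∈ LinearMap.range (GrL.of G n) := ⟨a, rfl⟩
    rw [← map_genLieLin hx ho] at ha
    obtain ⟨p, -, e⟩ := ha
    exact ⟨p, e⟩
  | hadd u v hu hv =>
    obtain ⟨p, rfl⟩ := hu
    obtain ⟨q, rfl⟩ := hv
    exact ⟨p + q, map_add _ _ _⟩

end

variable {Γ : SimpleGraph (Fin d)} {z : Fin d → RAAG Γ} {δ : Delta →* MulAut (RAAG Γ)}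

/-- Vanishing in `𝓛(G_z)` can be tested in `𝓔(G_z)`, hence in `𝓔_z` by the first isomorphism, and
there the restricted Poincaré–Birkhoff–Witt argument identifies the kernel. -/
theorem genLieLin_eq_zero_iff (hδ : IsDeltaAction Γ z δ) (p : ↥(restrictedFree d)) :
    genLieLin (deltaGen δ) p = 0 ↔ p ∈ idealJ z := by
  rw [← map_eq_zero_iff GrL.toGrE GrL.toGrE_injective, toGrE_genLieLin, ← mem_subJ]
  refine (mk_eq_zero_iff hδ).symm.trans ⟨mem_subJ_of_mk_eq_zero p.2, mk_eq_zero_of_mem_subJ⟩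

/-- The homomorphism `𝓛_z → 𝓛(G_z)` as a linear map. -/
def lzToGrL (hδ : IsDeltaAction Γ z δ) : LZ z →ₗ[ZMod 2] GrL (GZ δ) :=
  (idealJ z).toSubmodule.liftQ (genLieLin (deltaGen δ)) fun p hp =>
    (genLieLin_eq_zero_iff hδ p).2 hp

theorem lzToGrL_bijective (hδ : IsDeltaAction Γ z δ) : Function.Bijective (lzToGrL hδ) := by
  constructor
  · rw [injective_iff_map_eq_zero]
    intro u hu
    obtain ⟨p, rfl⟩ := (idealJ z).toSubmodule.mkQ_surjective u
    exact (Submodule.Quotient.mk_eq_zero _).2 ((genLieLin_eq_zero_iff hδ p).1 hu)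
  · intro u
    obtain ⟨p, rfl⟩ := genLieLin_surjective (GZ.isTopGen δ) (isOpen_zassenhaus hδ) u
    exact ⟨LZ.mk z p, rfl⟩

/-- The isomorphism `𝓛_z ≃ 𝓛(G_z)`. -/
def lzEquiv (hδ : IsDeltaAction Γ z δ) : LZ z ≃ₗ⁅ZMod 2⁆ GrL (GZ δ) :=
  { LinearEquiv.ofBijective (lzToGrL hδ) (lzToGrL_bijective hδ) with
    map_lie' := fun {u v} => by
      obtain ⟨p, rfl⟩ := (idealJ z).toSubmodule.mkQ_surjective u
      obtain ⟨q, rfl⟩ := (idealJ z).toSubmodule.mkQ_surjective v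
      exact genLieLin_lie (deltaGen δ) p q }

theorem map_lzEquiv (hδ : IsDeltaAction Γ z δ) (n : ℕ) :
    (LZ.homogeneous z n).map (lzEquiv hδ : LZ z →ₗ[ZMod 2] GrL (GZ δ)) =
      LinearMap.range (GrL.of (GZ δ) n) := by
  rw [← map_genLieLin (GZ.isTopGen δ) (isOpen_zassenhaus hδ), LZ.homogeneous, ← Submodule.map_comp]
  rfl

end LieIso

end

end DeltaRAAG
open DeltaRAAG in
theorem mainTheorem5 (d : ℕ) (Γ : SimpleGraph (Fin d)) (z : Fin d → RAAG Γ)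
    (δ : Delta →* MulAut (RAAG Γ)) (hδ : IsDeltaAction Γ z δ) :
    -- `𝓔(G_z) ≅ 𝓔_z` as graded algebras, with `X_i` corresponding to the class of `x_i - 1`
    (∃ φ : EZ z ≃ₐ[ZMod 2] GrE (GZ δ),
      (∀ n : ℕ, (EZ.homogeneous z n).map φ.toLinearMap =
        LinearMap.range (DirectSum.lof (ZMod 2) ℕ
          (GrPiece (augIdeal (GZ δ))) n)) ∧
      ∀ i : Fin (d + 1), φ (EZ.mk z (var i)) =
        DirectSum.of (GrPiece (augIdeal (GZ δ))) 1
          (grMk _ (toCGA _ (deltaGen δ i) - 1) (toCGA_sub_one_mem _))) ∧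
    -- `𝓛(G_z) ≅ 𝓛_z` as graded restricted Lie algebras, with `X_i` corresponding to the class
    -- of `x_i`
    (∃ ψ : LZ z ≃ₗ⁅ZMod 2⁆ GrL (GZ δ),
      (∀ n : ℕ, (LZ.homogeneous z n).map (ψ : LZ z →ₗ[ZMod 2] GrL (GZ δ)) =
        LinearMap.range (GrL.of (GZ δ) n)) ∧
      (∀ (n : ℕ) (x : ↥(restrictedFree d)) (g : GZ δ)
        (hg : g ∈ zassenhaus (GZ δ) n),
        ψ (LZ.mk z x) = GrL.of _ n (lieMk g hg) →
          ψ (LZ.mk z (restrictedSq x)) =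
            GrL.of _ (2 * n) (lieMk (g ^ 2) (sq_mem_zassenhaus hg))) ∧
      ∀ i : Fin (d + 1), ψ (LZ.mk z ⟨var i, var_mem_restrictedFree i⟩) =
        GrL.of _ 1 (lieMk (deltaGen δ i) (mem_zassenhaus_one _))) ∧
    -- the dimensions `c_n` are finite and `gocha(G_z, t) = (1 + t) / Γ(-t)`
    (∀ n : ℕ, Module.Finite (ZMod 2) (GrPiece (augIdeal (GZ δ)) n)) ∧
    gocha (GZ δ) =
      (1 + PowerSeries.X) *
        (((cliquePolynomial Γ).comp (-Polynomial.X) : Polynomial ℚ) : PowerSeries ℚ)⁻¹ := by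
  refine ⟨⟨AlgEquiv.ofBijective (toGrE hδ) (toGrE_bijective hδ), fun n => ?_, fun i => ?_⟩, ?_,
    finite_grPiece hδ, gocha_eq hδ⟩
  · rw [← (isGenerated_genSub δ).map_ncHomogeneous (genSub_mem (δ := δ)) n, EZ.homogeneous,
      ← Submodule.map_comp]
    rfl
  · exact grEval_var _ _ i
  · exact ⟨lzEquiv hδ, map_lzEquiv hδ, fun n p g hg h => genLieLin_sq _ hg h, fun i => genLieLin_var _ i⟩
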